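/- For a finite simple graph $G$, let $SC(G)$ be the set of simple cycles of $G$, each regarded as a set of edges. For $c : E(G) \to \mathbb{Q}_{\ge 0}$ put $N_c(C) = \prod_{e \in C} c(e)$ for $C \in SC(G)$, and, if $N_c$ is not identically zero on $SC(G)$, let $\nu_c$ be the probability distribution on $SC(G)$ with $\nu_c(C) = N_c(C) / \sum_{C' \in SC(G)} N_c(C')$. The treewidth of $G$ is the least $k$ such that $G$ is isomorphic to a subgraph of a $k$-tree, where $k$-trees are the graphs obtained from a $k$-clique by repeatedly adding a new vertex and joining it to all vertices of an existing $k$-clique. **Theorem.** Sampling from $\nu_c$ is polynomial-time solvable on the class of graphs of treewidth at most $2$. That is, there are a probabilistic Turing machine $M$ (using independent fair coin flips) and a polynomial $p$ such that 1. on every input word $x$, $M$ halts within $p(|x|)$ steps, whatever the coin flips are; and 2. for every graph $G$ on the vertex set $\{0, \dots, n-1\}$ of treewidth at most $2$ and every $c : E(G) \to \mathbb{Q}_{\ge 0}$ such that some simple cycle $C$ of $G$ has $N_c(C) \neq 0$, the machine $M$ on input $(G, c)$ accepts with probability at least $1/2$, and, conditionally on acceptance, its output is a simple cycle of $G$ distributed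 exactly according to $\nu_c$. Here $(G,c)$ is given as its weighted adjacency matrix, with the weights written as reduced fractions in binary, and an edge set is output as its $0/1$ adjacency matrix. -/

import Mathlib

open scoped ENNReal NNReal

/-! ### Probabilistic Turing machines -/

/-- A probabilistic Turing machine, as a machine with finitely many stacks (Mathlib's `TM2` model,
whose statements are finite programs built from push, peek, pop, register updates, branches,
jumps and halt).  All components are finite.  There are two transition functions,
`prog false` and `prog true`; at every step a fair coin decides which of them is used. -/
structure ProbTM (Γin Γout : Type) where
  /-- index set of the stacks -/
  K : Type
  [decEqK : DecidableEq K]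
  [fintypeK : Fintype K]
  /-- the stack alphabets -/
  Γ : K → Type
  [fintypeΓ : ∀ k, Fintype (Γ k)]
  /-- the input stack -/
  kin : K
  /-- the output stack -/
  kout : K
  /-- how an input symbol is written on the input stack -/
  inSym : Γin → Γ kin
  /-- how a symbol of the output stack is read -/
  outSym : Γ kout → Γout
  /-- the program labels (control states) -/
  Λ : Type
  [fintypeΛ : Fintype Λ]
  /-- the label at which the machine starts -/
  main : Λ
  /-- the values of the internal register -/
  σ : Type
  [fintypeσ : Fintype σ]
  /-- the initial value of the register -/
  start : σ
  /-- a halted machine accepts if the register has such a value -/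
  accept : σ → Bool
  /-- the two transition functions -/
  prog : Bool → Λ → Turing.TM2.Stmt Γ Λ σ

attribute [instance] ProbTM.decEqK ProbTM.fintypeK ProbTM.fintypeΓ ProbTM.fintypeΛ ProbTM.fintypeσ

namespace ProbTM

variable {Γin Γout : Type} (M : ProbTM Γin Γout)

/-- Configurations: current label (`none` when halted), register, contents of the stacks. -/
abbrev Cfg : Type := Turing.TM2.Cfg M.Γ M.Λ M.σ

/-- The initial configuration on input `x`: the first symbol of `x` is on top of the input stack,
all other stacks are empty. -/
def initCfg (x : List Γin) : M.Cfg where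
  l := some M.main
  var := M.start
  stk := Function.update (fun _ => []) M.kin (x.map M.inSym)

/-- One step with coin `b`; a halted configuration does not change. -/
def step (b : Bool) (c : M.Cfg) : M.Cfg :=
  (Turing.TM2.step (M.prog b) c).getD c

/-- The law of the configuration after `t` steps with independent fair coins. -/
noncomputable def run : ℕ → M.Cfg → PMF M.Cfg
  | 0, c => PMF.pure c
  | t + 1, c => (PMF.uniformOfFintype Bool).bind fun b => run t (M.step b c)

/-- On input `x`, the machine has halted after at most `t` steps, whatever the coins show. -/
def HaltsWithin (x : List Γin) (t : ℕ) : Prop :=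
  ∀ c ∈ (M.run t (M.initCfg x)).support, c.l = none

/-- The result of a computation that has ended in `c`: the output word (the output stack, read from
the top) if `c` is halted and accepting, and `none` otherwise. -/
def outcome (c : M.Cfg) : Option (List Γout) :=
  match c.l with
  | none => if M.accept c.var = true then some ((c.stk M.kout).map M.outSym) else none
  | some _ => none

/-- The law of the result of the first `t` steps on input `x`. -/
noncomputable def outcomeLaw (x : List Γin) (t : ℕ) : PMF (Option (List Γout)) :=
  (M.run t (M.initCfg x)).map M.outcome

/-- The probability that `M` has halted and accepted `x` after `t` steps. -/
noncomputable def acceptProb (x : List Γin) (t : ℕ) : ℝ≥0∞ :=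
  (M.outcomeLaw x t).toOuterMeasure {o | o.isSome}

/-- Within `t` steps on input `x`, the machine accepts with probability at least `1/2`, and
conditionally on acceptance its output word has exactly the law `μ`. -/
def Samples (x : List Γin) (t : ℕ) (μ : PMF (List Γout)) : Prop :=
  1 / 2 ≤ M.acceptProb x t ∧
    ∀ y : List Γout, M.outcomeLaw x t (some y) = M.acceptProb x t * μ y

end ProbTM

/-! ### Treewidth -/

/-- Add a new vertex (the last one) to `G` and join it to all vertices of `Q`. -/
def addVertex {m : ℕ} (G : SimpleGraph (Fin m)) (Q : Finset (Fin m)) :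
    SimpleGraph (Fin (m + 1)) :=
  G.map Fin.castSuccEmb ⊔
    SimpleGraph.fromEdgeSet {e | ∃ u ∈ Q, e = s(u.castSucc, Fin.last m)}

/-- `k`-trees: start with a `k`-clique and repeatedly join a new vertex to all vertices of a
`k`-clique. -/
inductive IsKTree (k : ℕ) : (m : ℕ) → SimpleGraph (Fin m) → Prop
  | base : IsKTree k k ⊤
  | extend {m : ℕ} {G : SimpleGraph (Fin m)} (hG : IsKTree k m G) (Q : Finset (Fin m))
      (hQ : G.IsNClique k Q) : IsKTree k (m + 1) (addVertex G Q)

/-- A partial `k`-tree is (isomorphic to) a subgraph of a `k`-tree. -/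
def IsPartialKTree {V : Type} (k : ℕ) (G : SimpleGraph V) : Prop :=
  ∃ (m : ℕ) (T : SimpleGraph (Fin m)), IsKTree k m T ∧ G.IsContained T

/-- The treewidth of `G`: the least `k` such that `G` is a partial `k`-tree. -/
noncomputable def treewidth {V : Type} (G : SimpleGraph V) : ℕ∞ :=
  ⨅ (k : ℕ) (_ : IsPartialKTree k G), (k : ℕ∞)

/-! ### The distribution on simple cycles -/

section Cycles

variable {V : Type} [Fintype V] [DecidableEq V]

open Classical in
/-- The simple cycles of `G`, each one given by its set of edges. -/
noncomputable def simpleCycles (G : SimpleGraph V) : Finset (Finset (Sym2 V)) :=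
  Finset.univ.filter fun C => ∃ (v : V) (p : G.Walk v v), p.IsCycle ∧ p.edges.toFinset = C

/-- The weight of an edge set: the product of the weights of its edges. -/
def edgeProd (c : Sym2 V → ℚ≥0) (C : Finset (Sym2 V)) : ℚ≥0 := ∏ e ∈ C, c e

/-- The measure `N_c` on simple cycles, as a function on all edge sets. -/
noncomputable def cycleMass (G : SimpleGraph V) (c : Sym2 V → ℚ≥0) (C : Finset (Sym2 V)) : ℝ≥0∞ :=
  if C ∈ simpleCycles G then (((edgeProd c C : ℚ≥0) : ℝ≥0) : ℝ≥0∞) else 0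

theorem cycleMass_tsum_ne_zero (G : SimpleGraph V) (c : Sym2 V → ℚ≥0)
    (h : ∃ C ∈ simpleCycles G, edgeProd c C ≠ 0) : ∑' C, cycleMass G c C ≠ 0 := by
  obtain ⟨C, hC, hc⟩ := h
  intro h0
  have h1 := ENNReal.tsum_eq_zero.mp h0 C
  simp [cycleMass, hC, hc] at h1

theorem cycleMass_tsum_ne_top (G : SimpleGraph V) (c : Sym2 V → ℚ≥0) :
    ∑' C, cycleMass G c C ≠ ∞ := by
  rw [tsum_fintype]
  refine (ENNReal.sum_lt_top.mpr fun C _ => ?_).ne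
  unfold cycleMass
  split_ifs <;> simp

/-- The probability distribution `ν_c`, obtained by normalizing `N_c`; it exists as soon as some
simple cycle has non-zero weight. -/
noncomputable def cycleLaw (G : SimpleGraph V) (c : Sym2 V → ℚ≥0)
    (h : ∃ C ∈ simpleCycles G, edgeProd c C ≠ 0) : PMF (Finset (Sym2 V)) :=
  PMF.normalize (cycleMass G c) (cycleMass_tsum_ne_zero G c h) (cycleMass_tsum_ne_top G c)

end Cycles

/-! ### Encodings -/

/-- The input alphabet. -/
inductive InSym : Type
  | bit (b : Bool)
  | edge
  | nonedge
  | slash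
  | endRow
  deriving DecidableEq, Fintype

/-- A non-negative rational: numerator and denominator in lowest terms, in binary with the least
significant digit first, separated by a slash. -/
def encodeRat (q : ℚ≥0) : List InSym :=
  q.num.bits.map InSym.bit ++ InSym.slash :: q.den.bits.map InSym.bit

open Classical in
/-- A weighted graph on `0, …, n - 1` is given to the machine as its weighted adjacency matrix, row
by row.  The values of `c` off the edge set of `G` play no role. -/
noncomputable def encodeInstance {n : ℕ} (G : SimpleGraph (Fin n)) (c : Sym2 (Fin n) → ℚ≥0) :
    List InSym :=
  (List.ofFn fun i : Fin n =>
    (List.ofFn fun j : Fin n =>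
      if G.Adj i j then InSym.edge :: encodeRat (c s(i, j)) else [InSym.nonedge]).flatten
    ++ [InSym.endRow]).flatten

/-- An edge set is output as its adjacency matrix, row by row. -/
def encodeEdgeSet {n : ℕ} (C : Finset (Sym2 (Fin n))) : List Bool :=
  (List.ofFn fun i : Fin n => List.ofFn fun j : Fin n => decide (s(i, j) ∈ C)).flatten

/-! Let `v` be a vertex whose only neighbours are `a` and `b`. A cycle through `v` consists of the
two edges at `v` and a path from `a` to `b` that avoids `v`. Replacing `a v b` by an edge `a b`,
merged with the old edge between them, turns it into a cycle of a smaller graph, except when the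
path is the edge `a b` itself. So the sum over cycles survives the elimination of `v`, up to one
separate term for the triangle (`cycleSum_contract`); a vertex with at most one neighbour lies on no
cycle (`cycleSum_delete`). For treewidth at most two such vertices exist as long as there are edges:
`k`-trees with `k ≤ 2` are dismantled in the reverse order of their construction
(`reducible_addVertex`), subgraphs inherit this (`Reducible.mono`), and the order of elimination is
irrelevant (`Reducible.elimVertex`), so a greedy algorithm succeeds.

The identity is used not for numbers but in the semiring `Poly` of formal sums of multisets of
edges. Elimination works with series-parallel expressions, series meaning product and parallel
meaning sum; the final expression expands into one monomial for each simple cycle and one of weight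
zero (`poly_eliminate`, `weighted_eliminate`). Every edge expression is used once in the remaining
graph and copied at most once per step into the total, so sizes stay polynomial (`elim_fold_mass`).

The weight of the final expression is an unreduced fraction `num / den`. As many fair coins as `num`
has binary digits give a uniform number `r`, which is accepted if `r < num`; this has probability at
least one half. An accepted `r` then directs the expansion into a single monomial: at each sum, the
interval of admissible numbers is divided between the two summands. The number of `r` that lead to a
given cycle is `den` times the weight of the cycle (`sum_finish`, `sum_sample`), so the law is
exact, without division and without further coins.

For the running time, data are binary trees written in prefix code on a stack. The class `PT` of
polynomial-time functions is closed under composition, pairing, case distinction and folds with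
polynomially bounded accumulators, so the algorithm is treated as a functional program.
`exists_machine` joins a deterministic phase, the coin flips and a second deterministic phase into
one machine. -/

/-! ### Structured stack programs -/

namespace StackProg

/-- Stack symbols: input symbols, bits and a marker. -/
inductive Sym : Type
  | inp (a : InSym)
  | bit (b : Bool)
  | mark
  deriving DecidableEq, Fintype

/-- The names of the stacks. -/
inductive Stk : Type
  | inp | out | main | a | b | cnt
  deriving DecidableEq

instance : Fintype Stk where
  elems := {.inp, .out, .main, .a, .b, .cnt}
  complete := by intro k; cases k <;> decide

/-- The register holds the symbol that was read last. -/
abbrev Reg := Option Sym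

/-- Program statements of the machine. -/
abbrev Stmt (Λ : Type) := Turing.TM2.Stmt (fun _ : Stk => Sym) Λ Reg

/-- Configurations of the machine. -/
abbrev Conf (Λ : Type) := Turing.TM2.Cfg (fun _ : Stk => Sym) Λ Reg

/-- Structured programs. -/
inductive Prog : Type
  | push (k : Stk) (s : Sym)
  | pushReg (k : Stk)
  | pop (k : Stk)
  | coin
  | seq (P Q : Prog)
  | ite (c : Reg → Bool) (P Q : Prog)
  | loop (c : Reg → Bool) (P : Prog)

namespace Prog

/-- The control states of a program. -/
def Label : Prog → Type
  | push _ _ => Unit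
  | pushReg _ => Unit
  | pop _ => Unit
  | coin => Unit
  | seq P Q => P.Label ⊕ Q.Label
  | ite _ P Q => Unit ⊕ (P.Label ⊕ Q.Label)
  | loop _ P => Unit ⊕ P.Label

instance instFintypeLabel : (P : Prog) → Fintype P.Label
  | push _ _ => inferInstanceAs (Fintype Unit)
  | pushReg _ => inferInstanceAs (Fintype Unit)
  | pop _ => inferInstanceAs (Fintype Unit)
  | coin => inferInstanceAs (Fintype Unit)
  | seq P Q =>
    letI := instFintypeLabel P
    letI := instFintypeLabel Q
    inferInstanceAs (Fintype (P.Label ⊕ Q.Label))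
  | ite _ P Q =>
    letI := instFintypeLabel P
    letI := instFintypeLabel Q
    inferInstanceAs (Fintype (Unit ⊕ (P.Label ⊕ Q.Label)))
  | loop _ P =>
    letI := instFintypeLabel P
    inferInstanceAs (Fintype (Unit ⊕ P.Label))

/-- The control state in which a program starts. -/
def entry : (P : Prog) → P.Label
  | push _ _ => ()
  | pushReg _ => ()
  | pop _ => ()
  | coin => ()
  | seq P _ => Sum.inl P.entry
  | ite _ _ _ => Sum.inl ()
  | loop _ _ => Sum.inl ()

/-- The machine code of a program whose control states are placed by `ι` and which exits to `e`. -/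
def code : (P : Prog) → {Λ : Type} → (P.Label → Λ) → Λ → Bool → P.Label → Stmt Λ
  | push k s, _, _, e, _, _ => .push k (fun _ => s) (.goto fun _ => e)
  | pushReg k, _, _, e, _, _ => .push k (fun r => r.getD .mark) (.goto fun _ => e)
  | pop k, _, _, e, _, _ => .pop k (fun _ s => s) (.goto fun _ => e)
  | coin, _, _, e, b, _ => .load (fun _ => some (.bit b)) (.goto fun _ => e)
  | seq P Q, _, ι, e, b, l => match l with
    | .inl l => P.code (fun x => ι (.inl x)) (ι (.inr Q.entry)) b l
    | .inr l => Q.code (fun x => ι (.inr x)) e b l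
  | ite c P Q, _, ι, e, b, l => match l with
    | .inl _ => .branch c (.goto fun _ => ι (.inr (.inl P.entry)))
        (.goto fun _ => ι (.inr (.inr Q.entry)))
    | .inr (.inl l) => P.code (fun x => ι (.inr (.inl x))) e b l
    | .inr (.inr l) => Q.code (fun x => ι (.inr (.inr x))) e b l
  | loop c P, _, ι, e, b, l => match l with
    | .inl _ => .branch c (.goto fun _ => ι (.inr P.entry)) (.goto fun _ => e)
    | .inr l => P.code (fun x => ι (.inr x)) (ι (.inl ())) b l

end Prog

/-- The machine with given control states and transition functions. -/
def mach (Λ : Type) [Fintype Λ] (main : Λ) (prog : Bool → Λ → Stmt Λ) : ProbTM InSym Bool where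
  K := Stk
  Γ := fun _ => Sym
  kin := .inp
  kout := .out
  inSym := .inp
  outSym := fun s => decide (s = .bit true)
  Λ := Λ
  main := main
  σ := Reg
  start := none
  accept := fun r => decide (r = some .mark)
  prog := prog

/-! ### States, configurations and the law of a run. -/

/-- Register and stacks. -/
structure State where
  reg : Reg
  main : List Sym
  a : List Sym
  b : List Sym
  cnt : List Sym
  inp : List Sym
  out : List Sym

namespace State

def get (s : State) : Stk → List Sym
  | .main => s.main
  | .a => s.a
  | .b => s.b
  | .cnt => s.cnt
  | .inp => s.inp
  | .out => s.out

def set (s : State) : Stk → List Sym → State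
  | .main, l => { s with main := l }
  | .a, l => { s with a := l }
  | .b, l => { s with b := l }
  | .cnt, l => { s with cnt := l }
  | .inp, l => { s with inp := l }
  | .out, l => { s with out := l }

theorem get_set (s : State) (k : Stk) (l : List Sym) :
    (s.set k l).get = Function.update s.get k l := by
  funext j
  cases k <;> cases j <;> rfl

theorem reg_set (s : State) (k : Stk) (l : List Sym) : (s.set k l).reg = s.reg := by
  cases k <;> rfl

/-- The configuration with control state `l`. -/
def cfg {Λ : Type} (l : Option Λ) (s : State) : Turing.TM2.Cfg (fun _ : Stk => Sym) Λ Reg :=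
  ⟨l, s.reg, s.get⟩

end State

/-- One step with coin `b`. -/
def stepC {Λ : Type} (prog : Bool → Λ → Stmt Λ) (b : Bool) (c : Conf Λ) : Conf Λ :=
  (Turing.TM2.step (prog b) c).getD c

theorem stepC_some {Λ : Type} (prog : Bool → Λ → Stmt Λ) (b : Bool) (l : Λ) (s : State) :
    stepC prog b (State.cfg (some l) s) = Turing.TM2.stepAux (prog b l) s.reg s.get := rfl

/-- The law of the configuration after `t` steps. -/
noncomputable def runC {Λ : Type} (prog : Bool → Λ → Stmt Λ) : ℕ → Conf Λ → PMF (Conf Λ)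
  | 0, c => PMF.pure c
  | t + 1, c => (PMF.uniformOfFintype Bool).bind fun b => runC prog t (stepC prog b c)

/-- `runC` needs no finiteness of the set of control states, so `ExP` can range over all embeddings
of a program into larger machines; only the finished machine has to be a `ProbTM`. -/
theorem mach_run {Λ : Type} [Fintype Λ] (main : Λ) (prog : Bool → Λ → Stmt Λ) (t : ℕ)
    (c : Conf Λ) : (mach Λ main prog).run t (c : (mach Λ main prog).Cfg) = runC prog t c := by
  induction t generalizing c with
  | zero => rfl
  | succ t ih =>
    change (PMF.uniformOfFintype Bool).bind (fun b => (mach Λ main prog).run t (stepC prog b c)) =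
      (PMF.uniformOfFintype Bool).bind _
    congr 1
    funext b
    exact ih _

theorem runC_add {Λ : Type} (prog : Bool → Λ → Stmt Λ) (s t : ℕ) (c : Conf Λ) :
    runC prog (s + t) c = (runC prog s c).bind (runC prog t) := by
  induction s generalizing c with
  | zero => simp [runC]
  | succ s ih =>
    rw [Nat.succ_add]
    simp only [runC, ih, PMF.bind_bind]

theorem runC_one {Λ : Type} (prog : Bool → Λ → Stmt Λ) (c c' : Conf Λ)
    (h : ∀ b, stepC prog b c = c') : runC prog 1 c = PMF.pure c' := by
  simp [runC, h]

theorem runC_halted {Λ : Type} (prog : Bool → Λ → Stmt Λ) (t : ℕ) (s : State) :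
    runC prog t (State.cfg none s) = PMF.pure (State.cfg none s) := by
  have hs : ∀ b, stepC prog b (State.cfg none s) = State.cfg none s := fun b => rfl
  induction t with
  | zero => rfl
  | succ t ih => simp [runC, hs, ih]

/-! ### Composition rules for the execution of structured programs. -/

/-- In any machine that contains `P`, the program `P` started in `s` exits after exactly `t` steps
in a state with law `μ`. -/
def ExP (P : Prog) (t : ℕ) (s : State) (μ : PMF State) : Prop :=
  ∀ (Λ : Type) (prog : Bool → Λ → Stmt Λ) (ι : P.Label → Λ) (e : Λ),
    (∀ b l, prog b (ι l) = P.code ι e b l) →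
    runC prog t (State.cfg (some (ι P.entry)) s) = μ.map (State.cfg (some e))

/-- Deterministic execution in exactly `t` steps. -/
def Ex (P : Prog) (t : ℕ) (s s' : State) : Prop := ExP P t s (PMF.pure s')

theorem ExP.of_step {P : Prog} {s s' : State}
    (h : ∀ (Λ : Type) (ι : P.Label → Λ) (e : Λ) (b : Bool),
      Turing.TM2.stepAux (P.code ι e b P.entry) s.reg s.get = State.cfg (some e) s') :
    Ex P 1 s s' := by
  intro Λ prog ι e hp
  rw [PMF.pure_map]
  refine runC_one _ _ _ fun b => ?_
  rw [stepC_some, hp, h]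

theorem Ex.push (k : Stk) (x : Sym) (s : State) : Ex (.push k x) 1 s (s.set k (x :: s.get k)) := by
  refine ExP.of_step fun Λ ι e b => ?_
  simp [Prog.code, State.cfg, State.get_set, State.reg_set]

theorem Ex.pushReg (k : Stk) (s : State) :
    Ex (.pushReg k) 1 s (s.set k (s.reg.getD .mark :: s.get k)) := by
  refine ExP.of_step fun Λ ι e b => ?_
  simp [Prog.code, State.cfg, State.get_set, State.reg_set]

theorem Ex.pop (k : Stk) (s : State) :
    Ex (.pop k) 1 s { s.set k (s.get k).tail with reg := (s.get k).head? } := by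
  refine ExP.of_step fun Λ ι e b => ?_
  simp only [Prog.code, State.cfg, Turing.TM2.stepAux]
  congr 1
  rw [← State.get_set]
  rfl

theorem ExP.coin (s : State) :
    ExP .coin 1 s ((PMF.uniformOfFintype Bool).map fun b => { s with reg := some (.bit b) }) := by
  intro Λ prog ι e hp
  rw [PMF.map_comp, PMF.map]
  simp only [runC]
  congr 1
  funext b
  rw [stepC_some, hp]
  rfl

/-- The type `α` indexes the random outcomes of `P`. The time `t'` has to be the same for all of
them, because the law is taken after exactly `t + t'` steps. -/
theorem ExP.seq {α : Type} {P Q : Prog} {t t' : ℕ} {s : State} {m : PMF α} {f : α → State}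
    {ν : α → PMF State} (h : ExP P t s (m.map f)) (h' : ∀ i, ExP Q t' (f i) (ν i)) :
    ExP (.seq P Q) (t + t') s (m.bind ν) := by
  intro Λ prog ι e hp
  rw [runC_add]
  have h1 := h Λ prog (fun x => ι (.inl x)) (ι (.inr Q.entry)) (fun b l => hp b (.inl l))
  have h2 := fun i => h' i Λ prog (fun x => ι (.inr x)) e (fun b l => hp b (.inr l))
  change (runC prog t (State.cfg (some (ι (.inl P.entry))) s)).bind _ = _
  rw [h1, PMF.map_bind, PMF.map_comp, PMF.bind_map]
  congr 1
  funext i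
  exact h2 i

theorem Ex.seqP {P Q : Prog} {t t' : ℕ} {s s' : State} {ν : PMF State} (h : Ex P t s s')
    (h' : ExP Q t' s' ν) : ExP (.seq P Q) (t + t') s ν := by
  have := ExP.seq (m := PMF.pure ()) (f := fun _ => s') (ν := fun _ => ν)
    (by rw [PMF.pure_map]; exact h) (fun _ => h')
  simpa using this

theorem Ex.seq {P Q : Prog} {t t' : ℕ} {s s' s'' : State} (h : Ex P t s s') (h' : Ex Q t' s' s'') :
    Ex (.seq P Q) (t + t') s s'' := h.seqP h'

theorem run_branch {Λ : Type} {prog : Bool → Λ → Stmt Λ} {l : Λ}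
    {c : Reg → Bool} {x y : Λ}
    (h : ∀ b, prog b l = .branch c (.goto fun _ => x) (.goto fun _ => y)) (s : State) :
    runC prog 1 (State.cfg (some l) s)
      = PMF.pure (State.cfg (some (if c s.reg then x else y)) s) := by
  refine runC_one _ _ _ fun b => ?_
  rw [stepC_some, h]
  cases hc : c s.reg <;> simp [State.cfg, hc]

theorem Ex.ite_true {c : Reg → Bool} {P Q : Prog} {t : ℕ} {s s' : State} (hc : c s.reg = true)
    (h : Ex P t s s') : Ex (.ite c P Q) (1 + t) s s' := by
  intro Λ prog ι e hp
  rw [runC_add]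
  change (runC prog 1 (State.cfg (some (ι (.inl ()))) s)).bind _ = _
  rw [run_branch (fun b => hp b (.inl ())), hc, PMF.pure_bind]
  exact h Λ prog (fun x => ι (.inr (.inl x))) e (fun b l => hp b (.inr (.inl l)))

theorem Ex.ite_false {c : Reg → Bool} {P Q : Prog} {t : ℕ} {s s' : State} (hc : c s.reg = false)
    (h : Ex Q t s s') : Ex (.ite c P Q) (1 + t) s s' := by
  intro Λ prog ι e hp
  rw [runC_add]
  change (runC prog 1 (State.cfg (some (ι (.inl ()))) s)).bind _ = _
  rw [run_branch (fun b => hp b (.inl ())), hc, PMF.pure_bind]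
  exact h Λ prog (fun x => ι (.inr (.inr x))) e (fun b l => hp b (.inr (.inr l)))

theorem Ex.loop_false {c : Reg → Bool} {P : Prog} {s : State} (hc : c s.reg = false) :
    Ex (.loop c P) 1 s s := by
  intro Λ prog ι e hp
  change runC prog 1 (State.cfg (some (ι (.inl ()))) s) = _
  rw [run_branch (fun b => hp b (.inl ())), hc, PMF.pure_map]
  rfl

theorem ExP.loop_true {α : Type} {c : Reg → Bool} {P : Prog} {t t' : ℕ} {s : State} {m : PMF α}
    {f : α → State} {ν : α → PMF State} (hc : c s.reg = true) (h : ExP P t s (m.map f))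
    (h' : ∀ i, ExP (.loop c P) t' (f i) (ν i)) :
    ExP (.loop c P) (1 + t + t') s (m.bind ν) := by
  intro Λ prog ι e hp
  rw [runC_add, runC_add]
  have h1 := h Λ prog (fun x => ι (.inr x)) (ι (.inl ())) (fun b l => hp b (.inr l))
  have h2 := fun i => h' i Λ prog ι e hp
  change ((runC prog 1 (State.cfg (some (ι (.inl ()))) s)).bind _).bind _ = _
  rw [run_branch (fun b => hp b (.inl ())), hc, PMF.pure_bind]
  simp only [if_true]
  rw [h1, PMF.map_bind, PMF.map_comp, PMF.bind_map]
  congr 1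
  funext i
  exact h2 i

theorem Ex.loop_true {c : Reg → Bool} {P : Prog} {t t' : ℕ} {s s' s'' : State}
    (hc : c s.reg = true) (h : Ex P t s s') (h' : Ex (.loop c P) t' s' s'') :
    Ex (.loop c P) (1 + t + t') s s'' := by
  have := ExP.loop_true (m := PMF.pure ()) (f := fun _ => s') (ν := fun _ => PMF.pure s'') hc
    (by rw [PMF.pure_map]; exact h) (fun _ => h')
  simpa [Ex] using this

/-- The transition functions of the machine that runs `P` and halts. -/
def Prog.haltCode (P : Prog) : Bool → Option P.Label → Stmt (Option P.Label) := fun b l =>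
  match l with
  | none => .halt
  | some l => P.code some none b l

/-- The machine that runs `P` and halts. -/
def Prog.machine (P : Prog) : ProbTM InSym Bool :=
  mach (Option P.Label) (some P.entry) P.haltCode

end StackProg
namespace StackProg

/-! ### Trees on the main stack -/

/-- Binary trees, the universal data type. -/
inductive Data : Type
  | nil
  | cons (x y : Data)

namespace Data

/-- Prefix code. -/
def enc : Data → List Sym
  | nil => [.bit false]
  | cons x y => .bit true :: (x.enc ++ y.enc)

/-- The length of the prefix code. -/
def size : Data → ℕ
  | nil => 1
  | cons x y => x.size + y.size + 1

theorem length_enc (x : Data) : x.enc.length = x.size := by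
  induction x with
  | nil => rfl
  | cons x y hx hy => simp [enc, size, hx, hy]

theorem mark_notMem_enc (x : Data) : Sym.mark ∉ x.enc := by
  induction x with
  | nil => simp [enc]
  | cons x y hx hy => simp [enc, hx, hy]

end Data

theorem Ex.cast {P : Prog} {t t' : ℕ} {s s' : State} (h : Ex P t s s') (e : t = t') :
    Ex P t' s s' := e ▸ h

namespace Prog

/-- One of the two auxiliary stacks. -/
def aux : Bool → Stk
  | true => .a
  | false => .b

/-- Move one symbol of a tree to an auxiliary stack; the counter stack, together with the register,
holds one mark for each subtree that is still to be read. -/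
def scanBody (p : Bool) : Prog :=
  .seq (.pop .main) (.seq (.pushReg (aux p)) (.ite (fun r => decide (r = some (.bit true)))
    (.seq (.push .cnt .mark) (.seq (.push .cnt .mark) (.pop .cnt))) (.pop .cnt)))

/-- Move the top tree to an auxiliary stack, on top of a mark. -/
def toAux (p : Bool) : Prog :=
  .seq (.push (aux p) .mark) (.seq (.push .cnt .mark) (.seq (.pop .cnt)
    (.loop Option.isSome (scanBody p))))

/-- Pop symbols from `k` up to the first mark, and apply `T` after each of them. -/
def transfer (k : Stk) (T : Prog) : Prog :=
  .seq (.pop k) (.loop (fun r => decide (r ≠ some .mark)) (.seq T (.pop k)))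

/-- Move everything above the mark of an auxiliary stack back to the main stack. -/
def fromAux (p : Bool) : Prog := transfer (aux p) (.pushReg .main)

def skip : Prog := .pop .cnt

def swap : Prog := .seq (toAux true) (.seq (toAux false) (.seq (fromAux true) (fromAux false)))

def dup : Prog :=
  .seq (toAux true) (.seq (.push .b .mark) (.seq
    (transfer .a (.seq (.pushReg .main) (.pushReg .b)))
    (.seq (.push .a .mark) (.seq (transfer .b (.pushReg .a)) (fromAux true)))))

def drop : Prog := .seq (toAux true) (transfer .a skip)

/-- Run `P` below the top tree. -/
def dip (P : Prog) : Prog := .seq (toAux true) (.seq P (fromAux true))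

end Prog

/-- A state given by the chosen auxiliary stack `x` and the other one `y`. -/
def auxState (p : Bool) (r : Reg) (m x y c i o : List Sym) : State :=
  match p with
  | true => ⟨r, m, x, y, c, i, o⟩
  | false => ⟨r, m, y, x, c, i, o⟩

/-- The number of steps that `scanBody` takes for the symbols of a tree. -/
def scanTime : Data → ℕ
  | .nil => 5
  | .cons x y => 7 + (scanTime x + scanTime y)

theorem scanTime_le (x : Data) : scanTime x ≤ 7 * x.size := by
  induction x with
  | nil => simp [scanTime, Data.size]
  | cons x y hx hy => simp only [scanTime, Data.size]; omega

/-- The rest of the loop is a hypothesis, so that at a node the two subtrees can be chained. The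
mark in the register stands for the tree being read and `c` for those still due: a node symbol
trades one mark for two, a leaf symbol uses one up, and the loop ends when popping `cnt` yields no
mark. -/
theorem scan_loop (p : Bool) (x : Data) : ∀ (m l y c i o : List Sym) (T : ℕ) (s : State),
    Ex (.loop Option.isSome (Prog.scanBody p)) T
      (auxState p c.head? m (x.enc.reverse ++ l) y c.tail i o) s →
    Ex (.loop Option.isSome (Prog.scanBody p)) (scanTime x + T)
      (auxState p (some .mark) (x.enc ++ m) l y c i o) s := by
  induction x with
  | nil =>
    intro m l y c i o T s h
    refine (Ex.loop_true (t := 4) ?_ ?_ h).cast (by rfl)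
    · cases p <;> rfl
    · cases p <;>
      exact ((Ex.pop .main _).seq ((Ex.pushReg _ _).seq (Ex.ite_false rfl (Ex.pop .cnt _))))
  | cons x1 x2 h1 h2 =>
    intro m l y c i o T s h
    refine (Ex.loop_true (t := 6) (s' := auxState p (some .mark) (x1.enc ++ (x2.enc ++ m))
      (.bit true :: l) y (.mark :: c) i o) ?_ ?_ (h1 _ _ _ _ _ _ (scanTime x2 + T) _
      (h2 _ _ _ _ _ _ T _ ?_))).cast ?_
    · cases p <;> rfl
    · have e : (Data.cons x1 x2).enc ++ m = .bit true :: (x1.enc ++ (x2.enc ++ m)) := by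
        simp [Data.enc]
      rw [e]
      cases p <;>
      exact ((Ex.pop .main _).seq ((Ex.pushReg _ _).seq (Ex.ite_true rfl
        ((Ex.push .cnt _ _).seq ((Ex.push .cnt _ _).seq (Ex.pop .cnt _))))))
    · simpa [Data.enc] using h
    · simp only [scanTime]; omega

theorem toAux_ex (p : Bool) (x : Data) (r : Reg) (m l y i o : List Sym) :
    Ex (Prog.toAux p) (scanTime x + 4) (auxState p r (x.enc ++ m) l y [] i o)
      (auxState p none m (x.enc.reverse ++ .mark :: l) y [] i o) := by
  have h := scan_loop p x m (.mark :: l) y [] i o 1 _ (Ex.loop_false (by cases p <;> rfl))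
  have h' : Ex (Prog.toAux p) (1 + (1 + (1 + (scanTime x + 1))))
      (auxState p r (x.enc ++ m) l y [] i o)
      (auxState p none m (x.enc.reverse ++ .mark :: l) y [] i o) := by
    cases p <;>
    exact (Ex.push _ _ _).seq ((Ex.push .cnt _ _).seq ((Ex.pop .cnt _).seq h))
  exact h'.cast (by omega)

/-- The function `f` describes a state by its register, the source stack and the symbols taken so
far. Ignoring the last argument gives the loop of `Prog.drop`, using it on two stacks gives the one
of `Prog.dup`. Codes contain no mark, so the first mark is the one pushed before the code. -/
theorem transfer_ex {k : Stk} {T : Prog} {tT : ℕ} (f : Reg → List Sym → List Sym → State)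
    (hreg : ∀ r l l', (f r l l').reg = r)
    (hT : ∀ x l l', ∃ r', Ex T tT (f (some x) l l') (f r' l (x :: l')))
    (hpop : ∀ r l l', Ex (.pop k) 1 (f r l l') (f l.head? l.tail l')) (r : Reg)
    (l base l' : List Sym) (hl : Sym.mark ∉ l) :
    Ex (Prog.transfer k T) ((tT + 2) * l.length + 2) (f r (l ++ .mark :: base) l')
      (f (some .mark) base (l.reverse ++ l')) := by
  have key : ∀ (l l' : List Sym), Sym.mark ∉ l →
      Ex (.loop (fun r => decide (r ≠ some .mark)) (.seq T (.pop k)))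
        ((tT + 2) * l.length + 1) (f (l ++ .mark :: base).head? (l ++ .mark :: base).tail l')
        (f (some .mark) base (l.reverse ++ l')) := by
    intro l
    induction l with
    | nil =>
      intro l' _
      exact (Ex.loop_false (by simp [hreg])).cast (by simp)
    | cons x l ih =>
      intro l' hl
      simp only [List.mem_cons, not_or] at hl
      obtain ⟨r', hT⟩ := hT x (l ++ .mark :: base) l'
      have h := Ex.loop_true (c := fun r => decide (r ≠ some .mark))
        (by simp [hreg, Ne.symm hl.1]) (hT.seq (hpop _ _ _))
        (ih (x :: l') hl.2)
      have h' := h.cast (t' := (tT + 2) * (x :: l).length + 1) (by simp; ring)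
      simpa using h'
  exact ((hpop _ _ _).seq (key l l' hl)).cast (by omega)

theorem fromAux_ex (p : Bool) (x : Data) (r : Reg) (m l y i o : List Sym) :
    Ex (Prog.fromAux p) (3 * x.size + 2)
      (auxState p r m (x.enc.reverse ++ .mark :: l) y [] i o)
      (auxState p (some .mark) (x.enc ++ m) l y [] i o) := by
  have h := transfer_ex (k := Prog.aux p) (T := .pushReg .main) (tT := 1)
    (fun r l l' => auxState p r l' l y [] i o)
    (by intros; cases p <;> rfl) (by intro x _ _; cases p <;> exact ⟨some x, Ex.pushReg _ _⟩)
    (by intros; cases p <;> exact Ex.pop _ _) r x.enc.reverse l m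
    (by simpa using x.mark_notMem_enc)
  simpa [x.length_enc, Prog.fromAux] using h

/-! ### Programs that act on the top of the main stack. -/

/-- `P` replaces the prefix `u` of the main stack by `v` within `T` steps and leaves everything
else as it is. -/
def W (P : Prog) (u v : List Sym) (T : ℕ) : Prop :=
  ∀ (r : Reg) (m a b i o : List Sym), ∃ t ≤ T, ∃ r' : Reg,
    Ex P t ⟨r, u ++ m, a, b, [], i, o⟩ ⟨r', v ++ m, a, b, [], i, o⟩

namespace W

variable {P Q : Prog} {u v w : List Sym} {S T : ℕ}

theorem mono (h : W P u v T) (hT : T ≤ S) : W P u v S := by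
  intro r m a b i o
  obtain ⟨t, ht, r', h⟩ := h r m a b i o
  exact ⟨t, ht.trans hT, r', h⟩

theorem seq (h : W P u v S) (h' : W Q v w T) : W (.seq P Q) u w (S + T) := by
  intro r m a b i o
  obtain ⟨t, ht, r', h⟩ := h r m a b i o
  obtain ⟨t', ht', r'', h'⟩ := h' r' m a b i o
  exact ⟨t + t', by omega, r'', h.seq h'⟩

theorem frame (h : W P u v T) (x : List Sym) : W P (u ++ x) (v ++ x) T := by
  intro r m a b i o
  simpa using h r (x ++ m) a b i o

theorem skip (u : List Sym) : W Prog.skip u u 1 := fun _ _ _ _ _ _ =>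
  ⟨1, le_rfl, none, Ex.pop _ _⟩

theorem push (x : Sym) (u : List Sym) : W (.push .main x) u (x :: u) 1 := fun r _ _ _ _ _ =>
  ⟨1, le_rfl, r, Ex.push _ _ _⟩

theorem pop (x : Sym) (u : List Sym) : W (.pop .main) (x :: u) u 1 := fun _ _ _ _ _ _ =>
  ⟨1, le_rfl, some x, Ex.pop _ _⟩

theorem swap (x y : Data) :
    W Prog.swap (x.enc ++ y.enc) (y.enc ++ x.enc) (10 * (x.size + y.size) + 12) := by
  intro r m a b i o
  have h1 := toAux_ex true x r (y.enc ++ m) a b i o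
  have h2 := toAux_ex false y none m b (x.enc.reverse ++ .mark :: a) i o
  have h3 := fromAux_ex true x none m a (y.enc.reverse ++ .mark :: b) i o
  have h4 := fromAux_ex false y (some .mark) (x.enc ++ m) b a i o
  have hx := scanTime_le x
  have hy := scanTime_le y
  have h := h1.seq (h2.seq (h3.seq h4))
  refine ⟨_, ?_, some .mark, by simpa [auxState, Prog.swap, Prog.dup, Prog.dip] using h⟩
  omega

theorem dup (x : Data) : W Prog.dup x.enc (x.enc ++ x.enc) (17 * x.size + 12) := by
  intro r m a b i o
  have h1 := toAux_ex true x r m a b i o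
  have h2 := transfer_ex (k := .a) (T := .seq (.pushReg .main) (.pushReg .b)) (tT := 2)
    (fun r l l' => ⟨r, l' ++ m, l, l' ++ .mark :: b, [], i, o⟩) (fun _ _ _ => rfl)
    (fun x l l' => ⟨some x, (Ex.pushReg .main _).seq (Ex.pushReg .b _)⟩) (fun r l l' => Ex.pop .a _)
    none x.enc.reverse a [] (by simpa using x.mark_notMem_enc)
  -- The copy on `b` has its first symbol on top, so popping it straight onto the main stack would
  -- reverse it; the detour over `a` restores the order.
  have h3 := transfer_ex (k := .b) (T := .pushReg .a) (tT := 1)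
    (fun r l l' => ⟨r, x.enc ++ m, l' ++ .mark :: a, l, [], i, o⟩) (fun _ _ _ => rfl)
    (fun x l l' => ⟨some x, Ex.pushReg .a _⟩) (fun r l l' => Ex.pop .b _)
    (some .mark) x.enc b [] x.mark_notMem_enc
  have h4 := fromAux_ex true x (some .mark) (x.enc ++ m) a b i o
  simp only [List.reverse_reverse, List.append_nil, List.length_reverse, x.length_enc] at h2 h3
  have h := h1.seq ((Ex.push .b .mark _).seq (h2.seq ((Ex.push .a .mark _).seq (h3.seq h4))))
  have hx := scanTime_le x
  refine ⟨_, ?_, some .mark, by simpa [auxState, Prog.swap, Prog.dup, Prog.dip] using h⟩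
  omega

theorem drop (x : Data) : W Prog.drop x.enc [] (10 * x.size + 7) := by
  intro r m a b i o
  have h1 := toAux_ex true x r m a b i o
  have h2 := transfer_ex (k := .a) (T := Prog.skip) (tT := 1)
    (fun r l _ => ⟨r, m, l, b, [], i, o⟩) (fun _ _ _ => rfl)
    (fun x l l' => ⟨none, Ex.pop .cnt _⟩) (fun r l l' => Ex.pop .a _)
    none x.enc.reverse a [] (by simpa using x.mark_notMem_enc)
  simp only [List.length_reverse, x.length_enc] at h2
  have hx := scanTime_le x
  refine ⟨_, ?_, some .mark, h1.seq h2⟩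
  omega

theorem dip (x : Data) (h : W P u v T) :
    W (Prog.dip P) (x.enc ++ u) (x.enc ++ v) (10 * x.size + 6 + T) := by
  intro r m a b i o
  have h1 := toAux_ex true x r (u ++ m) a b i o
  obtain ⟨t, ht, r', h2⟩ := h none m (x.enc.reverse ++ .mark :: a) b i o
  have h3 := fromAux_ex true x r' (v ++ m) a b i o
  have hx := scanTime_le x
  have h := h1.seq (h2.seq h3)
  refine ⟨_, ?_, some .mark, by simpa [auxState, Prog.swap, Prog.dup, Prog.dip] using h⟩
  omega

end W

end StackProg
namespace StackProg

/-! ### Functions computable in polynomial time -/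

/-- Types whose elements are coded by trees. -/
class Coded (α : Type) where
  code : α → Data

/-- The code of an element. -/
def code {α : Type} [Coded α] (a : α) : Data := Coded.code a

/-- The length of the code of an element. -/
def len {α : Type} [Coded α] (a : α) : ℕ := (code a).size

/-- The code of a list. -/
def codeList {α : Type} [Coded α] : List α → Data
  | [] => .nil
  | x :: l => .cons (code x) (codeList l)

instance : Coded Unit := ⟨fun _ => .nil⟩
instance : Coded Bool := ⟨fun b => bif b then .cons .nil .nil else .nil⟩
instance {α β : Type} [Coded α] [Coded β] : Coded (α × β) := ⟨fun p => .cons (code p.1) (code p.2)⟩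
instance {α : Type} [Coded α] : Coded (List α) := ⟨codeList⟩
-- A digit is stored together with its negation so that both digits have codes of the same length.
-- The length of the code then depends on the number of digits only and is monotone in `n`
-- (`len_nat`, `len_nat_mono`).
instance : Coded ℕ := ⟨fun n => code (n.bits.map fun b => (b, !b))⟩
instance {α : Type} [Coded α] : Coded (Option α) := ⟨fun o => code o.toList⟩
instance {α β : Type} [Coded α] [Coded β] : Coded (α ⊕ β) :=
  ⟨fun s => s.elim (fun a => code (false, a)) (fun b => code (true, b))⟩

section Codes

variable {α β : Type} [Coded α] [Coded β]

theorem code_pair (a : α) (b : β) : code (a, b) = .cons (code a) (code b) := rfl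
theorem code_cons (a : α) (l : List α) : code (a :: l) = .cons (code a) (code l) := rfl
theorem code_nat (n : ℕ) : code n = code (n.bits.map fun b => (b, !b)) := rfl
theorem code_inl (a : α) : code (.inl a : α ⊕ β) = code (false, a) := rfl
theorem code_inr (b : β) : code (.inr b : α ⊕ β) = code (true, b) := rfl

theorem len_pos (a : α) : 1 ≤ len a := by
  unfold len
  cases code a <;> simp [Data.size]

theorem len_pair (a : α) (b : β) : len (a, b) = len a + len b + 1 := rfl
theorem len_nil : len ([] : List α) = 1 := rfl
theorem len_cons (a : α) (l : List α) : len (a :: l) = len a + len l + 1 := rfl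
theorem len_unit (u : Unit) : len u = 1 := rfl
theorem len_false : len false = 1 := rfl
theorem len_true : len true = 3 := rfl
theorem len_bool_le (b : Bool) : len b ≤ 3 := by cases b <;> simp [len_false, len_true]

theorem length_le_len (l : List α) : l.length ≤ len l := by
  induction l with
  | nil => simp
  | cons a l ih => simp only [List.length_cons, len_cons]; omega

theorem len_le_of_mem {a : α} {l : List α} (h : a ∈ l) : len a ≤ len l := by
  induction l with
  | nil => simp at h
  | cons b l ih =>
    rw [len_cons]
    rcases List.mem_cons.mp h with rfl | h
    · omega
    · have := ih h
      omega

theorem len_append (l l' : List α) : len (l ++ l') + 1 = len l + len l' := by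
  induction l with
  | nil => simp [len_nil]; omega
  | cons a l ih => simp only [List.cons_append, len_cons]; omega

end Codes

theorem eval_mono (p : Polynomial ℕ) {a b : ℕ} (h : a ≤ b) : p.eval a ≤ p.eval b := by
  rw [Polynomial.eval_eq_sum, Polynomial.eval_eq_sum]
  exact Finset.sum_le_sum fun i _ => Nat.mul_le_mul_left _ (Nat.pow_le_pow_left h i)

namespace W

variable {P Q : Prog} {u v w : List Sym} {S T : ℕ}

theorem cast {u' v' : List Sym} (h : W P u v T) (hu : u = u') (hv : v = v') : W P u' v' T :=
  hu ▸ hv ▸ h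

theorem popIte (b : Bool) (hP : b = true → W P u v T) (hQ : b = false → W Q u v T) :
    W (.seq (.pop .main) (.ite (fun r => decide (r = some (.bit true))) P Q)) (.bit b :: u) v
      (T + 2) := by
  intro r m x y i o
  cases b with
  | true =>
    obtain ⟨t, ht, r', h⟩ := hP rfl (some (.bit true)) m x y i o
    exact ⟨1 + (1 + t), by omega, r', (Ex.pop .main _).seq (Ex.ite_true rfl h)⟩
  | false =>
    obtain ⟨t, ht, r', h⟩ := hQ rfl (some (.bit false)) m x y i o
    exact ⟨1 + (1 + t), by omega, r', (Ex.pop .main _).seq (Ex.ite_false rfl h)⟩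

end W

/-- Push a fixed word on the main stack. -/
def Prog.pushList : List Sym → Prog
  | [] => .skip
  | x :: l => .seq (pushList l) (.push .main x)

theorem W.pushList (l : List Sym) : W (.pushList l) [] l (l.length + 1) := by
  induction l with
  | nil => exact W.skip []
  | cons x l ih => exact ih.seq (W.push x l)

/-- `f` is computable in polynomial time. -/
@[fun_prop]
def PT {α β : Type} [Coded α] [Coded β] (f : α → β) : Prop :=
  ∃ (P : Prog) (p : Polynomial ℕ), ∀ a,
    W P (code a).enc (code (f a)).enc (p.eval (len a)) ∧ len (f a) ≤ p.eval (len a)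

namespace PT

variable {α β γ δ : Type} [Coded α] [Coded β] [Coded γ] [Coded δ]

theorem of_code {f : α → β} (h : ∀ a, code (f a) = code a) : PT f := by
  refine ⟨.skip, Polynomial.X + 1, fun a => ?_⟩
  simp only [Polynomial.eval_add, Polynomial.eval_X, Polynomial.eval_one, h, len]
  exact ⟨(W.skip _).mono (by omega), by omega⟩

@[fun_prop]
theorem id : PT (fun a : α => a) := of_code fun _ => rfl

@[fun_prop]
theorem const (b : β) : PT (fun _ : α => b) := by
  refine ⟨.seq .drop (.pushList (code b).enc),
    Polynomial.C 10 * Polynomial.X + Polynomial.C (8 + len b), fun a => ?_⟩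
  simp only [Polynomial.eval_add, Polynomial.eval_X, Polynomial.eval_C, Polynomial.eval_mul]
  refine ⟨((W.drop (code a)).seq (W.pushList _)).mono ?_, by omega⟩
  simp only [Data.length_enc, len]
  omega

@[fun_prop]
theorem comp {g : β → γ} {f : α → β} (hg : PT g) (hf : PT f) : PT (fun a => g (f a)) := by
  obtain ⟨P, p, hp⟩ := hf
  obtain ⟨Q, q, hq⟩ := hg
  refine ⟨.seq P Q, p + q.comp p, fun a => ?_⟩
  simp only [Polynomial.eval_add, Polynomial.eval_comp]
  have h := eval_mono q (hp a).2
  exact ⟨((hp a).1.seq (hq (f a)).1).mono (by omega), by have := (hq (f a)).2; omega⟩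

@[fun_prop]
theorem prodMk {f : α → β} {g : α → γ} (hf : PT f) (hg : PT g) : PT (fun a => (f a, g a)) := by
  obtain ⟨P, p, hp⟩ := hf
  obtain ⟨Q, q, hq⟩ := hg
  -- `Q` acts on the upper copy of the argument and `P`, after a swap, on the lower one; the symbol
  -- pushed at the end makes a pair of the two results.
  refine ⟨.seq .dup (.seq Q (.seq .swap (.seq P (.push .main (.bit true))))),
    Polynomial.C 27 * Polynomial.X + Polynomial.C 26 + Polynomial.C 11 * q + p, fun a => ?_⟩
  simp only [Polynomial.eval_add, Polynomial.eval_X, Polynomial.eval_C, Polynomial.eval_mul]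
  obtain ⟨h1, h1'⟩ := hp a
  obtain ⟨h2, h2'⟩ := hq a
  have h := (W.dup (code a)).seq ((h2.frame (code a).enc).seq
    ((W.swap (code (g a)) (code a)).seq ((h1.frame (code (g a)).enc).seq (W.push (.bit true) _))))
  refine ⟨h.mono ?_, ?_⟩
  · simp only [len] at *
    omega
  · rw [len_pair]
    omega

theorem fst' : PT (fun p : α × β => p.1) := by
  refine ⟨.seq (.pop .main) (.seq .swap .drop), Polynomial.C 20 * Polynomial.X + Polynomial.C 20,
    fun a => ?_⟩
  simp only [Polynomial.eval_add, Polynomial.eval_X, Polynomial.eval_C, Polynomial.eval_mul]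
  obtain ⟨a, b⟩ := a
  rw [len_pair]
  refine ⟨((W.pop (.bit true) _).seq ((W.swap (code a) (code b)).seq
    ((W.drop (code b)).frame (code a).enc))).mono ?_, by dsimp only; omega⟩
  simp only [len]
  omega

theorem snd' : PT (fun p : α × β => p.2) := by
  refine ⟨.seq (.pop .main) .drop, Polynomial.C 10 * Polynomial.X + Polynomial.C 20,
    fun a => ?_⟩
  simp only [Polynomial.eval_add, Polynomial.eval_X, Polynomial.eval_C, Polynomial.eval_mul]
  obtain ⟨a, b⟩ := a
  rw [len_pair]
  refine ⟨((W.pop (.bit true) _).seq ((W.drop (code a)).frame (code b).enc)).mono ?_, by dsimp only; omega⟩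
  simp only [len]
  omega

@[fun_prop]
theorem fst {f : α → β × γ} (hf : PT f) : PT (fun a => (f a).1) := fst'.comp hf

@[fun_prop]
theorem snd {f : α → β × γ} (hf : PT f) : PT (fun a => (f a).2) := snd'.comp hf

@[fun_prop]
theorem cons {f : α → β} {g : α → List β} (hf : PT f) (hg : PT g) : PT (fun a => f a :: g a) :=
  (of_code (f := fun p : β × List β => p.1 :: p.2) fun _ => rfl).comp (hf.prodMk hg)

/-- Case distinction on whether the code of `f a` is a leaf. -/
theorem codeCases {f : α → β} (hf : PT f) {g : α → δ} (hg : PT g) {h : γ → δ} (hh : PT h)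
    {F : α → δ} (H : ∀ a, (code (f a) = .nil ∧ F a = g a) ∨
      ∃ x y k, code (f a) = .cons x y ∧ code k = .cons (.cons x y) (code a) ∧ F a = h k) :
    PT F := by
  obtain ⟨P, p, hp⟩ := hf.prodMk (id (α := α))
  obtain ⟨G, g', hg⟩ := hg
  obtain ⟨H', h', hh⟩ := hh
  -- The first symbol popped belongs to the pair `(f a, a)`, the second is the first symbol of `code
  -- (f a)` and decides the case. For a leaf exactly `code a` remains; for a node, pushing both
  -- symbols back restores the code of `k`.
  refine ⟨.seq P (.seq (.pop .main) (.seq (.pop .main)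
    (.ite (fun r => decide (r = some (.bit true)))
      (.seq (.push .main (.bit true)) (.seq (.push .main (.bit true)) H')) G))),
    p + g' + h'.comp p + 5, fun a => ?_⟩
  simp only [Polynomial.eval_add, Polynomial.eval_comp]
  have e5 : Polynomial.eval (len a) (5 : Polynomial ℕ) = 5 := by simp
  rw [e5]
  obtain ⟨h1, h1'⟩ := hp a
  obtain ⟨h2, h2'⟩ := hg a
  rcases H a with ⟨hc, hF⟩ | ⟨x, y, k, hc, hk, hF⟩
  · rw [hF]
    refine ⟨(h1.seq ((W.pop (.bit true) _).seq ((W.popIte (u := (code a).enc) false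
      (fun h => by cases h) fun _ => h2).cast ?_ rfl))).mono (T := _) ?_, by omega⟩
    · simp [hc, Data.enc]
    · omega
  · obtain ⟨h3, h3'⟩ := hh k
    have hlen : len k = len (f a, a) := by
      rw [len_pair]
      simp only [len, hk, hc, Data.size]
    rw [hlen] at h3 h3'
    have h4 : h'.eval (len (f a, a)) ≤ h'.eval (p.eval (len a)) := eval_mono h' h1'
    rw [hF]
    have h5 := (W.push (.bit true) (x.enc ++ (y.enc ++ (code a).enc))).seq
      ((W.push (.bit true) _).seq (h3.cast (u' := .bit true :: .bit true ::
        (x.enc ++ (y.enc ++ (code a).enc))) (by simp [hk, Data.enc]) rfl))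
    refine ⟨(h1.seq ((W.pop (.bit true) _).seq ((W.popIte true (fun _ => h5)
      (fun h => by cases h)).cast ?_ rfl))).mono ?_, by omega⟩
    · simp [hc, Data.enc]
    · omega

theorem listCases {f : α → List β} (hf : PT f) {g : α → δ} (hg : PT g)
    {h : (β × List β) × α → δ} (hh : PT h) :
    PT (fun a => match f a with
      | [] => g a
      | x :: l => h ((x, l), a)) := by
  refine codeCases hf hg hh fun a => ?_
  cases hf : f a with
  | nil => exact .inl ⟨rfl, rfl⟩
  | cons x l => exact .inr ⟨_, _, ((x, l), a), code_cons x l, rfl, rfl⟩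

@[fun_prop]
theorem cond {f : α → Bool} {g h : α → β} (hf : PT f) (hg : PT g) (hh : PT h) :
    PT (fun a => bif f a then g a else h a) := by
  refine codeCases (γ := (Unit × Unit) × α) (h := fun p => g p.2) hf hh (by fun_prop)
    fun a => ?_
  cases hf : f a with
  | false => exact .inl ⟨rfl, rfl⟩
  | true => exact .inr ⟨_, _, (((), ()), a), rfl, rfl, rfl⟩

theorem congr {f g : α → β} (h : PT f) (e : ∀ a, g a = f a) : PT g := funext e ▸ h

theorem optionCases {f : α → Option β} (hf : PT f) {g : α → δ} (hg : PT g)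
    {h : β × α → δ} (hh : PT h) :
    PT (fun a => match f a with
      | none => g a
      | some x => h (x, a)) := by
  refine codeCases (γ := (β × Unit) × α) (h := fun p => h (p.1.1, p.2)) hf hg (by fun_prop)
    fun a => ?_
  cases hf : f a with
  | none => exact .inl ⟨rfl, rfl⟩
  | some x => exact .inr ⟨_, _, ((x, ()), a), code_cons x [], rfl, rfl⟩

theorem sumCases {f : α → β ⊕ γ} (hf : PT f) {g : β × α → δ} (hg : PT g)
    {h : γ × α → δ} (hh : PT h) :
    PT (fun a => match f a with
      | .inl x => g (x, a)
      | .inr x => h (x, a)) := by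
  obtain ⟨P, p, hp⟩ := hf.prodMk (id (α := α))
  obtain ⟨G, g', hg⟩ := hg
  obtain ⟨H', h', hh⟩ := hh
  -- The third symbol is the first one of the tag. The tag `true` has two more symbols, which are
  -- dropped; the symbol pushed afterwards makes a pair of the content and `a`.
  refine ⟨.seq P (.seq (.pop .main) (.seq (.pop .main) (.seq (.pop .main)
    (.ite (fun r => decide (r = some (.bit true)))
      (.seq (.pop .main) (.seq (.pop .main) (.seq (.push .main (.bit true)) H')))
      (.seq (.push .main (.bit true)) G))))),
    p + g'.comp p + h'.comp p + Polynomial.C 10, fun a => ?_⟩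
  simp only [Polynomial.eval_add, Polynomial.eval_comp, Polynomial.eval_C]
  obtain ⟨h1, h1'⟩ := hp a
  cases hx : f a with
  | inl x =>
    have hlen : len (x, a) ≤ p.eval (len a) := by
      refine le_trans ?_ h1'
      simp only [hx, len, code_inl, code_pair, Data.size]
      omega
    obtain ⟨h2, h2'⟩ := hg (x, a)
    have h4 := eval_mono g' hlen
    have e : (code (f a, a)).enc = .bit true :: .bit true :: .bit false ::
        ((code x).enc ++ (code a).enc) := by rw [hx]; rfl
    refine ⟨((h1.cast rfl e).seq ((W.pop (.bit true) _).seq ((W.pop (.bit true) _).seq ((W.popIte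
      false (fun h => by cases h) fun _ => (W.push (.bit true) _).seq h2))))).mono ?_,
      by dsimp only; omega⟩
    omega
  | inr x =>
    have hlen : len (x, a) ≤ p.eval (len a) := by
      refine le_trans ?_ h1'
      simp only [hx, len, code_inr, code_pair, Data.size]
      omega
    obtain ⟨h2, h2'⟩ := hh (x, a)
    have h4 := eval_mono h' hlen
    have e : (code (f a, a)).enc = .bit true :: .bit true :: .bit true :: .bit false ::
        .bit false :: ((code x).enc ++ (code a).enc) := by rw [hx]; rfl
    refine ⟨((h1.cast rfl e).seq ((W.pop (.bit true) _).seq ((W.pop (.bit true) _).seq ((W.popIte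
      true (fun _ => (W.pop _ _).seq ((W.pop _ _).seq ((W.push (.bit true) _).seq h2)))
      (fun h => by cases h)))))).mono ?_, by dsimp only; omega⟩
    omega

end PT

/-! ### Folding over lists -/

/-- One round of a fold: the main stack holds the head of the list, its tail and the
accumulator. -/
def Prog.foldBody (P : Prog) : Prog :=
  .seq (.dip .swap) (.seq (.push .main (.bit true)) (.seq P .swap))

def Prog.fold (P : Prog) : Prog :=
  .seq (.pop .main) (.loop (fun r => decide (r = some (.bit true))) (.seq P.foldBody (.pop .main)))

section Fold

variable {α β γ : Type} [Coded α] [Coded β] [Coded γ]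

theorem W.foldBody {P : Prog} {step : γ → β → γ} {T : ℕ} {x : β} {c : γ} (l : List β)
    (h : W P (code (x, c)).enc (code (step c x)).enc T) :
    W P.foldBody ((code x).enc ++ ((code l).enc ++ (code c).enc))
      ((code l).enc ++ (code (step c x)).enc)
      (T + 10 * (len x + len l + len c) + 10 * (len l + len (step c x)) + 40) := by
  have h1 := (W.dip (code x) (W.swap (code l) (code c))).seq ((W.push (.bit true) _).seq
    ((h.frame (code l).enc).cast (u' := .bit true :: ((code x).enc ++ ((code c).enc ++
      (code l).enc))) (by simp [code_pair, Data.enc]) rfl |>.seq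
      (W.swap (code (step c x)) (code l))))
  refine h1.mono ?_
  simp only [len]
  omega

/-- The hypothesis on prefixes bounds every intermediate accumulator by `N`. Such a bound has to be
given in advance, since iterating a polynomial-time step may let sizes explode. -/
theorem fold_loop {P : Prog} {step : γ → β → γ} {q : Polynomial ℕ} {N : ℕ}
    (hs : ∀ x c, W P (code (x, c)).enc (code (step c x)).enc (q.eval (len (x, c))))
    (l : List β) : ∀ (c : γ), (∀ l', l' <+: l → len (l'.foldl step c) ≤ N) → len l ≤ N →
    ∀ (m a b i o : List Sym), ∃ t ≤ l.length * (q.eval (2 * N + 1) + 50 * N + 50) + 1, ∃ r' : Reg,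
      Ex (.loop (fun r => decide (r = some (.bit true))) (.seq P.foldBody (.pop .main))) t
        ⟨((code l).enc ++ ((code c).enc ++ m)).head?, ((code l).enc ++ ((code c).enc ++ m)).tail,
          a, b, [], i, o⟩
        ⟨r', (code (l.foldl step c)).enc ++ m, a, b, [], i, o⟩ := by
  induction l with
  | nil =>
    intro c _ _ m a b i o
    exact ⟨1, by omega, some (.bit false), Ex.loop_false rfl⟩
  | cons x l ih =>
    intro c hc hl m a b i o
    rw [len_cons] at hl
    have hc0 : len c ≤ N := hc [] (List.nil_prefix)
    have hc1 : len (step c x) ≤ N := hc [x] (by simp)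
    obtain ⟨t, ht, r, h⟩ := ih (step c x)
      (fun l' hl' => hc (x :: l') ((List.prefix_cons_inj x).2 hl')) (by omega) m a b i o
    obtain ⟨t1, ht1, r1, h1⟩ := W.foldBody (step := step) l (hs x c) (some (.bit true)) m a b i o
    have hq : q.eval (len (x, c)) ≤ q.eval (2 * N + 1) :=
      eval_mono q (by rw [len_pair]; omega)
    refine ⟨1 + (t1 + 1) + t, ?_, r, Ex.loop_true rfl (Ex.seq (s' := ⟨r1,
      (code l).enc ++ ((code (step c x)).enc ++ m), a, b, [], i, o⟩) ?_ (Ex.pop .main _)) h⟩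
    · rw [List.length_cons, Nat.add_mul]
      omega
    · simpa [code_cons, Data.enc] using h1

namespace PT

theorem foldlAux {l : α → List β} {i : α → γ} {step : γ → β → γ} (hl : PT l) (hi : PT i)
    (hs : PT (fun p : β × γ => step p.2 p.1))
    (hb : ∃ q : Polynomial ℕ, ∀ a l', l' <+: l a → len (l'.foldl step (i a)) ≤ q.eval (len a)) :
    PT (fun a => (l a).foldl step (i a)) := by
  obtain ⟨P, p, hp⟩ := hl.prodMk hi
  obtain ⟨S, s, hs⟩ := hs
  obtain ⟨q, hq⟩ := hb
  set N : Polynomial ℕ := p + q with hN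
  refine ⟨.seq (.seq P (.pop .main)) S.fold, p + 1 + 1 + N *
    (s.comp (Polynomial.C 2 * N + 1) + Polynomial.C 50 * N + Polynomial.C 50) + 1 + q,
    fun a => ?_⟩
  simp only [Polynomial.eval_add, Polynomial.eval_comp, Polynomial.eval_C, Polynomial.eval_mul,
    Polynomial.eval_one]
  obtain ⟨h1, h1'⟩ := hp a
  rw [len_pair] at h1'
  have hNp : p.eval (len a) + q.eval (len a) = N.eval (len a) := by simp [hN]
  have hlen := length_le_len (l a)
  constructor
  · intro r m x y i' o
    have h2 := (h1.seq (W.pop (.bit true) ((code (l a)).enc ++ (code (i a)).enc)))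
    obtain ⟨t, ht, r1, h3⟩ := h2 r m x y i' o
    obtain ⟨t', ht', r2, h4⟩ := fold_loop (fun x c => (hs (x, c)).1) (N := N.eval (len a)) (l a)
      (i a) (fun l' hl' => (hq a l' hl').trans (by omega)) (by omega) m x y i' o
    have h5 := (Ex.pop .main ⟨r1, (code (l a)).enc ++ ((code (i a)).enc ++ m), x, y, [], i', o⟩).seq
      h4
    refine ⟨t + (1 + t'), ?_, r2, Ex.seq h3 ?_⟩
    · have : (l a).length * (s.eval (2 * N.eval (len a) + 1) + 50 * N.eval (len a) + 50) ≤
          N.eval (len a) * (s.eval (2 * N.eval (len a) + 1) + 50 * N.eval (len a) + 50) :=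
        Nat.mul_le_mul_right _ (by omega)
      omega
    · simpa [Prog.fold] using h5
  · have := hq a (l a) List.prefix_rfl
    omega

theorem foldl {l : α → List β} {i : α → γ} {step : α → γ → β → γ} (hl : PT l) (hi : PT i)
    (hs : PT (fun p : β × (γ × α) => step p.2.2 p.2.1 p.1))
    (hb : ∃ q : Polynomial ℕ, ∀ a l', l' <+: l a →
      len (l'.foldl (step a) (i a)) ≤ q.eval (len a)) :
    PT (fun a => (l a).foldl (step a) (i a)) := by
  -- To let the step depend on `a`, the accumulator carries a copy of `a` along.
  have key : ∀ a (l' : List β) c,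
      l'.foldl (fun (p : γ × α) b => (step p.2 p.1 b, p.2)) (c, a) = (l'.foldl (step a) c, a) := by
    intro a l'
    induction l' with
    | nil => intro c; rfl
    | cons x l' ih => intro c; exact ih _
  have h := foldlAux (step := fun (p : γ × α) b => (step p.2 p.1 b, p.2)) hl
    (hi.prodMk (id (α := α))) (hs.prodMk (by fun_prop)) (by
      obtain ⟨q, hq⟩ := hb
      refine ⟨q + Polynomial.X + 1, fun a l' hl' => ?_⟩
      rw [key, len_pair]
      simp only [Polynomial.eval_add, Polynomial.eval_X, Polynomial.eval_one]
      have := hq a l' hl'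
      omega)
  exact h.fst.congr fun a => by rw [key]

end PT

end Fold

end StackProg
namespace StackProg

/-- Comparison of numbers, as a function to `Bool`. -/
def ltB (m n : ℕ) : Bool := decide (m < n)

/-- Equality of numbers, as a function to `Bool`. -/
def eqB (m n : ℕ) : Bool := decide (m = n)

namespace PT

/-! ### Lists -/

section Lists

variable {α β γ δ : Type} [Coded α] [Coded β] [Coded γ] [Coded δ]

/-- Passing between types with the same codes costs nothing. This serves options and lists, numbers
and their digits, and expressions and their views. -/
theorem recode {f : α → β} {g : α → γ} (h : PT f) (e : ∀ a, code (g a) = code (f a)) : PT g := by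
  obtain ⟨P, p, hp⟩ := h
  refine ⟨P, p, fun a => ?_⟩
  simp only [len, e]
  exact hp a

/-- The size of the value is polynomially bounded. -/
theorem size_bound {f : α → β} (h : PT f) : ∃ q : Polynomial ℕ, ∀ a, len (f a) ≤ q.eval (len a) := by
  obtain ⟨P, p, hp⟩ := h
  exact ⟨p, fun a => (hp a).2⟩

/-- A fold whose steps increase the size of the accumulator by bounded amounts. -/
theorem foldl_growth {l : α → List β} {i : α → γ} {step : α → γ → β → γ} (hl : PT l) (hi : PT i)
    (hs : PT (fun p : β × (γ × α) => step p.2.2 p.2.1 p.1))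
    (hg : ∃ q : Polynomial ℕ, ∀ a b c, len (step a c b) ≤ len c + q.eval (len b + len a)) :
    PT (fun a => (l a).foldl (step a) (i a)) := by
  refine foldl hl hi hs ?_
  obtain ⟨q, hq⟩ := hg
  obtain ⟨pl, hpl⟩ := hl.size_bound
  obtain ⟨pi, hpi⟩ := hi.size_bound
  refine ⟨pi + pl * q.comp (pl + Polynomial.X), fun a l' hl' => ?_⟩
  simp only [Polynomial.eval_add, Polynomial.eval_comp, Polynomial.eval_X, Polynomial.eval_mul]
  set N := q.eval (pl.eval (len a) + len a) with hN
  have key : ∀ (l' : List β) c, (∀ x ∈ l', x ∈ l a) →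
      len (l'.foldl (step a) c) ≤ len c + l'.length * N := by
    intro l'
    induction l' with
    | nil => simp
    | cons x l' ih =>
      intro c hx
      have h1 := ih (step a c x) fun y hy => hx y (List.mem_cons_of_mem _ hy)
      have h2 := hq a x c
      have h3 : q.eval (len x + len a) ≤ N := eval_mono q (by
        have := len_le_of_mem (hx x List.mem_cons_self)
        have := hpl a
        omega)
      simp only [List.foldl_cons, List.length_cons, Nat.add_mul]
      omega
  have h1 := key l' (i a) fun x hx => hl'.subset hx
  have h2 : l'.length * N ≤ pl.eval (len a) * N := Nat.mul_le_mul_right _ (by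
    have := hl'.length_le
    have := length_le_len (l a)
    have := hpl a
    omega)
  have := hpi a
  omega

@[fun_prop]
theorem reverse {l : α → List β} (hl : PT l) : PT (fun a => (l a).reverse) := by
  have h := foldl_growth (i := fun _ => []) (step := fun _ c b => b :: c) hl (const [])
    (by fun_prop) ⟨Polynomial.X + 1, fun a b c => by
      simp only [Polynomial.eval_add, Polynomial.eval_X, Polynomial.eval_one, len_cons]
      omega⟩
  refine h.congr fun a => ?_
  simp

/-- A right fold whose steps increase the size of the accumulator by bounded amounts. -/
theorem foldr_growth {l : α → List β} {i : α → γ} {step : α → β → γ → γ} (hl : PT l) (hi : PT i)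
    (hs : PT (fun p : β × (γ × α) => step p.2.2 p.1 p.2.1))
    (hg : ∃ q : Polynomial ℕ, ∀ a b c, len (step a b c) ≤ len c + q.eval (len b + len a)) :
    PT (fun a => (l a).foldr (step a) (i a)) :=
  (foldl_growth (step := fun a c b => step a b c) hl.reverse hi hs hg).congr fun a => by
    rw [List.foldl_reverse]

@[fun_prop]
theorem append {l l' : α → List β} (hl : PT l) (hl' : PT l') : PT (fun a => l a ++ l' a) := by
  have h := foldr_growth (i := l') (step := fun _ b c => b :: c) hl hl'
    (by fun_prop) ⟨Polynomial.X + 1, fun a b c => by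
      simp only [Polynomial.eval_add, Polynomial.eval_X, Polynomial.eval_one, len_cons]
      omega⟩
  refine h.congr fun a => ?_
  simp

theorem flatMap {l : α → List β} {f : α → β → List γ} (hl : PT l)
    (hf : PT (fun p : β × α => f p.2 p.1)) : PT (fun a => (l a).flatMap (f a)) := by
  obtain ⟨q, hq⟩ := hf.size_bound
  have h := foldr_growth (i := fun _ => []) (step := fun a b c => f a b ++ c) hl (const [])
    (append (hf.comp (f := fun p : β × (List γ × α) => (p.1, p.2.2)) (by fun_prop)) (by fun_prop))
    ⟨q.comp (Polynomial.X + 1), fun a b c => by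
      simp only [Polynomial.eval_add, Polynomial.eval_X, Polynomial.eval_one, Polynomial.eval_comp]
      have h1 := hq (b, a)
      have h2 := len_append (f a b) c
      rw [len_pair] at h1
      dsimp only at h1
      omega⟩
  refine h.congr fun a => ?_
  induction l a with
  | nil => rfl
  | cons x l ih => simp [ih]

theorem map {l : α → List β} {f : α → β → γ} (hl : PT l)
    (hf : PT (fun p : β × α => f p.2 p.1)) : PT (fun a => (l a).map (f a)) := by
  refine (flatMap (f := fun a b => [f a b]) hl (hf.cons (const []))).congr fun a => ?_
  rw [List.map_eq_flatMap]

theorem filter {l : α → List β} {f : α → β → Bool} (hl : PT l)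
    (hf : PT (fun p : β × α => f p.2 p.1)) : PT (fun a => (l a).filter (f a)) := by
  refine (flatMap (f := fun a b => bif f a b then [b] else []) hl
    (cond hf (by fun_prop) (by fun_prop))).congr fun a => ?_
  induction l a with
  | nil => rfl
  | cons x l ih => cases h : f a x <;> simp [h, ih]

theorem filterMap {l : α → List β} {f : α → β → Option γ} (hl : PT l)
    (hf : PT (fun p : β × α => f p.2 p.1)) : PT (fun a => (l a).filterMap (f a)) := by
  refine (flatMap (f := fun a b => (f a b).toList) hl (hf.recode fun _ => rfl)).congr fun a => ?_
  induction l a with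
  | nil => rfl
  | cons x l ih => cases h : f a x <;> simp [h, ih]

@[fun_prop]
theorem not {f : α → Bool} (hf : PT f) : PT (fun a => !(f a)) :=
  (cond hf (const false) (const true)).congr fun a => by cases f a <;> rfl

@[fun_prop]
theorem and {f g : α → Bool} (hf : PT f) (hg : PT g) : PT (fun a => f a && g a) :=
  (cond hf hg (const false)).congr fun a => by cases f a <;> rfl

@[fun_prop]
theorem or {f g : α → Bool} (hf : PT f) (hg : PT g) : PT (fun a => f a || g a) :=
  (cond hf (const true) hg).congr fun a => by cases f a <;> rfl

@[fun_prop]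
theorem xor {f g : α → Bool} (hf : PT f) (hg : PT g) : PT (fun a => f a ^^ g a) :=
  (cond hf hg.not hg).congr fun a => by cases f a <;> simp

@[fun_prop]
theorem some {f : α → β} (hf : PT f) : PT (fun a => Option.some (f a)) :=
  (hf.cons (const [])).recode fun _ => rfl

theorem any {l : α → List β} {f : α → β → Bool} (hl : PT l)
    (hf : PT (fun p : β × α => f p.2 p.1)) : PT (fun a => (l a).any (f a)) := by
  refine (listCases (filter hl hf) (const false) (const true)).congr fun a => ?_
  cases h : (l a).filter (f a) with
  | nil =>
    rw [List.filter_eq_nil_iff] at h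
    simpa using h
  | cons x m =>
    have : x ∈ (l a).filter (f a) := by simp [h]
    rw [List.mem_filter] at this
    simpa using ⟨x, this⟩

@[fun_prop]
theorem isEmpty {l : α → List β} (hl : PT l) : PT (fun a => (l a).isEmpty) := by
  refine (listCases hl (const true) (const false)).congr fun a => ?_
  cases l a <;> rfl

end Lists

/-! ### Arithmetic of binary numbers -/

section Arith

variable {α : Type} [Coded α]

theorem _root_.StackProg.len_nat (n : ℕ) : len n = 6 * n.size + 1 := by
  rw [← Nat.size_eq_bits_len]
  unfold len
  rw [code_nat]
  change len _ = _
  induction n.bits with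
  | nil => rfl
  | cons b l ih =>
    rw [List.map_cons, len_cons, ih, len_pair]
    cases b <;> simp [len_true, len_false] <;> ring

theorem _root_.StackProg.len_nat_mono {m n : ℕ} (h : m ≤ n) : len m ≤ len n := by
  rw [len_nat, len_nat]
  have := Nat.size_le_size h
  omega

theorem bits {f : α → ℕ} (hf : PT f) : PT (fun a => (f a).bits) := by
  have h : PT (fun a => (f a).bits.map fun b => (b, !b)) := hf.recode fun _ => rfl
  refine (map (f := fun _ (p : Bool × Bool) => p.1) h (by fun_prop)).congr fun a => ?_
  simp [Function.comp_def]

theorem of_bits {f : α → ℕ} (hf : PT (fun a => (f a).bits)) : PT f :=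
  (map (f := fun _ (b : Bool) => (b, !b)) hf (by fun_prop)).recode fun _ => rfl

@[fun_prop]
theorem bit {b : α → Bool} {f : α → ℕ} (hb : PT b) (hf : PT f) :
    PT (fun a => Nat.bit (b a) (f a)) := by
  refine of_bits ?_
  have h : PT (fun a => (b a, f a)) := hb.prodMk hf
  -- `Nat.bits` has no leading zeros, so the digit `false` must vanish when the remaining number is
  -- `0`.
  refine (listCases (h := fun p : (Bool × List Bool) × α => b p.2 :: (p.1.1 :: p.1.2))
    (bits hf) (cond hb (const [true]) (const [])) (by fun_prop)).congr fun a => ?_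
  rcases Nat.eq_zero_or_pos (f a) with h0 | h0
  · rw [h0]
    cases b a <;> simp
  · rw [Nat.bits_append_bit _ _ (by omega)]
    cases hb : (f a).bits with
    | nil =>
      have := congrArg List.length hb
      rw [Nat.size_eq_bits_len] at this
      have := Nat.size_pos.mpr h0
      simp_all
    | cons x l => rfl

@[fun_prop]
theorem bodd {f : α → ℕ} (hf : PT f) : PT (fun a => (f a).bodd) := by
  refine (listCases (h := fun p : (Bool × List Bool) × α => p.1.1)
    (bits hf) (const false) (by fun_prop)).congr fun a => ?_
  induction f a using Nat.binaryRec' with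
  | zero => simp
  | bit b n h _ => simp [Nat.bits_append_bit _ _ h]

@[fun_prop]
theorem div2 {f : α → ℕ} (hf : PT f) : PT (fun a => (f a).div2) := by
  refine of_bits ((listCases (h := fun p : (Bool × List Bool) × α => p.1.2)
    (bits hf) (const []) (by fun_prop)).congr fun a => ?_)
  induction f a using Nat.binaryRec' with
  | zero => simp
  | bit b n h _ => simp [Nat.bits_append_bit _ _ h]

/-- One step of binary addition: the two remaining numbers, the carry and the digits found so far,
the most significant one first. -/
def addStep (s : (ℕ × ℕ) × Bool × List Bool) : (ℕ × ℕ) × Bool × List Bool :=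
  ((s.1.1.div2, s.1.2.div2),
    (s.1.1.bodd && s.1.2.bodd) || (s.2.1 && (s.1.1.bodd || s.1.2.bodd)),
    ((s.1.1.bodd ^^ s.1.2.bodd) ^^ s.2.1) :: s.2.2)

/-- One step of binary subtraction, with a borrow instead of a carry. -/
def subStep (s : (ℕ × ℕ) × Bool × List Bool) : (ℕ × ℕ) × Bool × List Bool :=
  ((s.1.1.div2, s.1.2.div2),
    (!s.1.1.bodd && s.1.2.bodd) || (s.2.1 && (!s.1.1.bodd || s.1.2.bodd)),
    ((s.1.1.bodd ^^ s.1.2.bodd) ^^ s.2.1) :: s.2.2)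

/-- The number with given binary digits, the most significant one first. -/
def ofDigits (l : List Bool) (n : ℕ) : ℕ := l.foldl (fun n b => Nat.bit b n) n

/-- Each step splits the lowest digit off the sum of the two remaining numbers and the carry. Digits
already found are less significant than the rest, hence the invariant `ofDigits l (x + y +
c.toNat)`; after `k` steps nothing below `2 ^ k` is left. -/
theorem addStep_spec (k : ℕ) : ∀ (x y : ℕ) (c : Bool) (l : List Bool), x + y + c.toNat < 2 ^ k →
    ofDigits (addStep^[k] ((x, y), c, l)).2.2 0 = ofDigits l (x + y + c.toNat) := by
  induction k with
  | zero =>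
    intro x y c l h
    have h1 : x + y + c.toNat = 0 := by simpa using h
    rw [h1]
    rfl
  | succ k ih =>
    intro x y c l h
    have key : x + y + c.toNat = Nat.bit ((x.bodd ^^ y.bodd) ^^ c)
        (x.div2 + y.div2 + ((x.bodd && y.bodd) || (c && (x.bodd || y.bodd))).toNat) := by
      have hx := Nat.bodd_add_div2 x
      have hy := Nat.bodd_add_div2 y
      rw [Nat.bit_val]
      cases hb : x.bodd <;> cases hb' : y.bodd <;> cases c <;> simp [hb, hb'] at * <;> omega
    rw [Function.iterate_succ_apply, addStep, ih]
    · simp only [ofDigits, List.foldl_cons]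
      rw [key]
    · rw [key, Nat.bit_val] at h
      rw [pow_succ] at h
      dsimp only
      omega

/-- The final borrow tells whether the difference is negative; if it is not, the digits found are
those of the difference, by the same invariant as for addition. -/
theorem subStep_spec (k : ℕ) : ∀ (x y : ℕ) (c : Bool) (l : List Bool), x < 2 ^ k → y < 2 ^ k →
    (bif (subStep^[k] ((x, y), c, l)).2.1 then y + c.toNat > x else
      y + c.toNat ≤ x ∧ ofDigits (subStep^[k] ((x, y), c, l)).2.2 0
        = ofDigits l (x - (y + c.toNat))) := by
  induction k with
  | zero =>
    intro x y c l hx hy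
    have hx : x = 0 := by simpa using hx
    have hy : y = 0 := by simpa using hy
    subst hx hy
    cases c <;> simp [ofDigits]
  | succ k ih =>
    intro x y c l h h'
    have hx := Nat.bodd_add_div2 x
    have hy := Nat.bodd_add_div2 y
    rw [pow_succ] at h h'
    have := ih x.div2 y.div2 ((!x.bodd && y.bodd) || (c && (!x.bodd || y.bodd)))
      (((x.bodd ^^ y.bodd) ^^ c) :: l) (by omega) (by omega)
    rw [Function.iterate_succ_apply, show subStep ((x, y), c, l) = ((x.div2, y.div2),
      ((!x.bodd && y.bodd) || (c && (!x.bodd || y.bodd))),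
      ((x.bodd ^^ y.bodd) ^^ c) :: l) from rfl]
    cases hr : (subStep^[k] ((x.div2, y.div2), (!x.bodd && y.bodd) || (c && (!x.bodd || y.bodd)),
        ((x.bodd ^^ y.bodd) ^^ c) :: l)).2.1 with
    | true =>
      rw [hr] at this
      simp only [cond_true] at this ⊢
      cases hb : x.bodd <;> cases hb' : y.bodd <;> cases c <;> simp [hb, hb'] at * <;> omega
    | false =>
      rw [hr] at this
      simp only [cond_false] at this ⊢
      rw [this.2]
      have h1 := this.1
      have key : y + c.toNat ≤ x ∧ x - (y + c.toNat) = Nat.bit ((x.bodd ^^ y.bodd) ^^ c)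
          (x.div2 - (y.div2 + ((!x.bodd && y.bodd) || (c && (!x.bodd || y.bodd))).toNat)) := by
        rw [Nat.bit_val]
        clear hr this ih
        cases hb : x.bodd <;> cases hb' : y.bodd <;> cases c <;> simp [hb, hb'] at * <;> omega
      refine ⟨key.1, ?_⟩
      rw [key.2]
      rfl

theorem foldl_const_step {γ : Type} (f : γ → γ) (l : List Bool) (c : γ) :
    l.foldl (fun c _ => f c) c = f^[l.length] c := by
  induction l generalizing c with
  | nil => rfl
  | cons x l ih => exact ih _

@[fun_prop]
theorem ofDigits_zero {l : α → List Bool} (hl : PT l) : PT (fun a => ofDigits (l a) 0) := by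
  refine foldl_growth (step := fun _ n b => Nat.bit b n) hl (const 0) (by fun_prop)
    ⟨Polynomial.C 6, fun a b c => ?_⟩
  rw [Polynomial.eval_C, len_nat, len_nat]
  rcases Nat.eq_zero_or_pos c with rfl | hc
  · cases b <;> simp
  · rw [Nat.size_bit (by rw [Nat.bit_val]; omega)]
    omega

theorem len_div2_le (n : ℕ) : len n.div2 ≤ len n :=
  len_nat_mono (by rw [Nat.div2_val]; omega)

/-- Clock for the digitwise algorithms. -/
theorem lt_clock (x y : ℕ) : x + y + 1 < 2 ^ (x.bits ++ y.bits ++ [true]).length ∧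
    x < 2 ^ (x.bits ++ y.bits ++ [true]).length ∧
    y < 2 ^ (x.bits ++ y.bits ++ [true]).length := by
  simp only [List.length_append, Nat.size_eq_bits_len, List.length_singleton, pow_add, pow_one]
  have hx := Nat.lt_size_self x
  have hy := Nat.lt_size_self y
  have h1 : (x + 1) * (y + 1) ≤ 2 ^ x.size * 2 ^ y.size := Nat.mul_le_mul hx hy
  have h2 : x + y + 1 ≤ (x + 1) * (y + 1) := by nlinarith [Nat.zero_le (x * y)]
  omega

@[fun_prop]
theorem add {f g : α → ℕ} (hf : PT f) (hg : PT g) : PT (fun a => f a + g a) := by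
  have h := foldl_growth (l := fun a => (f a).bits ++ (g a).bits ++ [true])
    (i := fun a => ((f a, g a), false, [])) (step := fun _ s _ => addStep s)
    (((bits hf).append (bits hg)).append (const _)) (by fun_prop) (by unfold addStep; fun_prop)
    ⟨Polynomial.C 7, fun a b c => by
      obtain ⟨⟨x, y⟩, c, l⟩ := c
      simp only [addStep, len_pair, len_cons, Polynomial.eval_C]
      have h1 := len_div2_le x
      have h2 := len_div2_le y
      have h3 := len_bool_le ((x.bodd && y.bodd) || (c && (x.bodd || y.bodd)))
      have h4 := len_bool_le ((x.bodd ^^ y.bodd) ^^ c)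
      have h5 := len_pos c
      omega⟩
  refine (ofDigits_zero (h.snd.snd)).congr fun a => ?_
  rw [foldl_const_step, addStep_spec]
  · simp [ofDigits]
  · have := (lt_clock (f a) (g a)).1
    simp only [Bool.toNat_false]
    omega

@[fun_prop]
theorem sub {f g : α → ℕ} (hf : PT f) (hg : PT g) : PT (fun a => f a - g a) := by
  have h := foldl_growth (l := fun a => (f a).bits ++ (g a).bits ++ [true])
    (i := fun a => ((f a, g a), false, [])) (step := fun _ s _ => subStep s)
    (((bits hf).append (bits hg)).append (const _)) (by fun_prop) (by unfold subStep; fun_prop)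
    ⟨Polynomial.C 7, fun a b c => by
      obtain ⟨⟨x, y⟩, c, l⟩ := c
      simp only [subStep, len_pair, len_cons, Polynomial.eval_C]
      have h1 := len_div2_le x
      have h2 := len_div2_le y
      have h3 := len_bool_le ((!x.bodd && y.bodd) || (c && (!x.bodd || y.bodd)))
      have h4 := len_bool_le ((x.bodd ^^ y.bodd) ^^ c)
      have h5 := len_pos c
      omega⟩
  -- A final borrow means `f a < g a`, where truncated subtraction gives `0`.
  refine (cond h.snd.fst (const 0) (ofDigits_zero (h.snd.snd))).congr fun a => ?_
  rw [foldl_const_step]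
  have h1 := lt_clock (f a) (g a)
  have := subStep_spec _ _ _ false [] h1.2.1 h1.2.2
  revert this
  cases (subStep^[((f a).bits ++ (g a).bits ++ [true]).length] ((f a, g a), false, [])).2.1
  · simp only [cond_false, ofDigits, List.foldl_nil, Bool.toNat_false, Nat.add_zero]
    exact fun h => h.2.symm
  · simp only [cond_true, Bool.toNat_false, Nat.add_zero]
    omega

theorem _root_.StackProg.len_add_le (x y : ℕ) : len (x + y) ≤ len x + len y + 5 := by
  rw [len_nat, len_nat, len_nat]
  have : (x + y).size ≤ x.size + y.size + 1 := by
    rw [Nat.size_le]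
    have := (lt_clock x y).1
    simp only [List.length_append, Nat.size_eq_bits_len, List.length_singleton] at this
    omega
  omega

theorem _root_.StackProg.len_mul_le (x y : ℕ) : len (x * y) ≤ len x + len y := by
  rw [len_nat, len_nat, len_nat]
  have : (x * y).size ≤ x.size + y.size := by
    rw [Nat.size_le, pow_add]
    exact Nat.mul_lt_mul'' (Nat.lt_size_self x) (Nat.lt_size_self y)
  omega

-- Horner's rule on the binary digits of `f a`: doubling and adding `g a` or `0` enlarges the
-- accumulator by an amount that does not depend on the accumulator.
@[fun_prop]
theorem mul {f g : α → ℕ} (hf : PT f) (hg : PT g) : PT (fun a => f a * g a) := by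
  obtain ⟨q, hq⟩ := hg.size_bound
  have h := foldr_growth (l := fun a => (f a).bits) (i := fun _ => 0)
    (step := fun a b n => Nat.bit false n + (bif b then g a else 0)) (bits hf) (const 0)
    (by fun_prop) ⟨Polynomial.C 20 + q, fun a b c => by
      simp only [Polynomial.eval_C, Polynomial.eval_add]
      have h1 := len_add_le (Nat.bit false c) (bif b then g a else 0)
      have h2 := len_mul_le 2 c
      have h3 : len 2 = 13 := rfl
      have h4 := hq a
      have h5 : len (bif b then g a else 0) ≤ len (g a) := by
        cases b
        · exact len_nat_mono (Nat.zero_le _)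
        · exact le_rfl
      have h6 := eval_mono q (Nat.le_add_left (len a) (len b))
      have h7 : Nat.bit false c = 2 * c := by simp [Nat.bit_val]
      rw [h7] at h1 ⊢
      omega⟩
  refine h.congr fun a => ?_
  induction f a using Nat.binaryRec' with
  | zero => simp
  | bit b n h ih =>
    rw [Nat.bits_append_bit _ _ h, List.foldr_cons, ← ih, Nat.bit_val, Nat.bit_val]
    cases b <;> simp <;> ring

theorem decideLe {f g : α → ℕ} (hf : PT f) (hg : PT g) : PT (fun a => decide (f a ≤ g a)) :=
  (isEmpty (bits (hf.sub hg))).congr fun a => by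
    rw [Bool.eq_iff_iff]
    simp only [decide_eq_true_eq, List.isEmpty_iff, ← List.length_eq_zero_iff,
      Nat.size_eq_bits_len, Nat.size_eq_zero, Nat.sub_eq_zero_iff_le]

@[fun_prop]
theorem ltB {f g : α → ℕ} (hf : PT f) (hg : PT g) : PT (fun a => ltB (f a) (g a)) :=
  ((hg.decideLe hf).not).congr fun a => by rw [Bool.eq_iff_iff]; simp [StackProg.ltB]

@[fun_prop]
theorem eqB {f g : α → ℕ} (hf : PT f) (hg : PT g) : PT (fun a => eqB (f a) (g a)) :=
  ((hf.decideLe hg).and (hg.decideLe hf)).congr fun a => by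
    rw [Bool.eq_iff_iff]; simp [StackProg.eqB, le_antisymm_iff]

end Arith

end PT

end StackProg
namespace StackProg

/-! ### Series-parallel expressions -/

/-- A leaf: the two ends of an edge, and the numerator and the denominator of its weight. -/
abbrev Leaf := (ℕ × ℕ) × (ℕ × ℕ)

/-- The denominator of the weight of a leaf; the value `0` is read as `1`. -/
def leafDen (e : Leaf) : ℕ := bif eqB e.2.2 0 then 1 else e.2.2

/-- Series-parallel expressions. -/
inductive Expr : Type
  | leaf (e : Leaf)
  | ser (x y : Expr)
  | par (x y : Expr)

namespace Expr

/-- Denominator of the weight, not in lowest terms. -/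
def den : Expr → ℕ
  | leaf e => leafDen e
  | ser x y => x.den * y.den
  | par x y => x.den * y.den

/-- Numerator of the weight, not in lowest terms. -/
def num : Expr → ℕ
  | leaf e => e.2.1
  | ser x y => x.num * y.num
  | par x y => x.num * y.den + y.num * x.den

theorem den_leaf (e : Leaf) : (leaf e).den = leafDen e := rfl
theorem den_ser (x y : Expr) : (ser x y).den = x.den * y.den := rfl
theorem den_par (x y : Expr) : (par x y).den = x.den * y.den := rfl

/-- The number of nodes, in unary. -/
def clk : Expr → List Unit
  | leaf _ => [()]
  | ser x y => () :: (x.clk ++ y.clk)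
  | par x y => () :: (x.clk ++ y.clk)

/-- The code of an expression is annotated by weights and numbers of nodes. -/
def toData : Expr → Data
  | leaf e => .cons (code ((leaf e).num, (leaf e).den, (leaf e).clk)) (.cons (code false) (code e))
  | ser x y => .cons (code ((ser x y).num, (ser x y).den, (ser x y).clk))
      (.cons (code true) (.cons (code true) (.cons x.toData y.toData)))
  | par x y => .cons (code ((par x y).num, (par x y).den, (par x y).clk))
      (.cons (code true) (.cons (code false) (.cons x.toData y.toData)))

instance : Coded Expr := ⟨toData⟩

/-- The annotation and the constructor of an expression. -/
def view (x : Expr) : (ℕ × ℕ × List Unit) × (Leaf ⊕ (Bool × Expr × Expr)) :=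
  ((x.num, x.den, x.clk), match x with
    | leaf e => .inl e
    | ser y z => .inr (true, y, z)
    | par y z => .inr (false, y, z))

/-- This is the purpose of the annotations: numerator, denominator and number of nodes are read off
the root, so no recursion over trees has to be carried out in polynomial time. -/
theorem code_view (x : Expr) : code x.view = code x := by cases x <;> rfl

end Expr

namespace PT

variable {α : Type} [Coded α]

theorem view {f : α → Expr} (hf : PT f) : PT (fun a => (f a).view) := hf.recode fun _ =>
  Expr.code_view _

@[fun_prop]
theorem num {f : α → Expr} (hf : PT f) : PT (fun a => (f a).num) := hf.view.fst.fst

@[fun_prop]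
theorem den {f : α → Expr} (hf : PT f) : PT (fun a => (f a).den) := hf.view.fst.snd.fst

@[fun_prop]
theorem clk {f : α → Expr} (hf : PT f) : PT (fun a => (f a).clk) := hf.view.fst.snd.snd

theorem inl {β γ : Type} [Coded β] [Coded γ] {f : α → β} (hf : PT f) :
    PT (fun a => (Sum.inl (f a) : β ⊕ γ)) := ((const false).prodMk hf).recode fun _ => rfl

theorem inr {β γ : Type} [Coded β] [Coded γ] {f : α → γ} (hf : PT f) :
    PT (fun a => (Sum.inr (f a) : β ⊕ γ)) := ((const true).prodMk hf).recode fun _ => rfl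

@[fun_prop]
theorem leafDen {f : α → Leaf} (hf : PT f) : PT (fun a => leafDen (f a)) := by
  unfold StackProg.leafDen
  fun_prop

@[fun_prop]
theorem leaf {f : α → Leaf} (hf : PT f) : PT (fun a => Expr.leaf (f a)) := by
  have h : PT (fun a => (((f a).2.1, StackProg.leafDen (f a), [()]),
    (Sum.inl (f a) : Leaf ⊕ (Bool × Expr × Expr)))) := prodMk (by fun_prop) (inl hf)
  exact h.recode fun a => rfl

@[fun_prop]
theorem ser {f g : α → Expr} (hf : PT f) (hg : PT g) : PT (fun a => Expr.ser (f a) (g a)) := by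
  have h : PT (fun a => (((f a).num * (g a).num, (f a).den * (g a).den,
    () :: ((f a).clk ++ (g a).clk)), (Sum.inr (true, f a, g a) : Leaf ⊕ (Bool × Expr × Expr)))) :=
    prodMk (by fun_prop) (inr (by fun_prop))
  exact h.recode fun a => rfl

@[fun_prop]
theorem par {f g : α → Expr} (hf : PT f) (hg : PT g) : PT (fun a => Expr.par (f a) (g a)) := by
  have h : PT (fun a => (((f a).num * (g a).den + (g a).num * (f a).den, (f a).den * (g a).den,
    () :: ((f a).clk ++ (g a).clk)), (Sum.inr (false, f a, g a) : Leaf ⊕ (Bool × Expr × Expr)))) :=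
    prodMk (by fun_prop) (inr (by fun_prop))
  exact h.recode fun a => rfl

end PT

/-! ### Sizes of expressions. -/

namespace Expr

/-- A bound for the sizes of numerator and denominator and for the number of nodes. -/
def mass : Expr → ℕ
  | leaf e => len e
  | ser x y => x.mass + y.mass + 1
  | par x y => x.mass + y.mass + 1

theorem one_le_mass (x : Expr) : 1 ≤ x.mass := by
  cases x with
  | leaf e => exact len_pos e
  | ser x y => exact Nat.le_add_left _ _
  | par x y => exact Nat.le_add_left _ _

/-- Products add the exponents, and the numerator of a parallel composition is a sum of two
products; the `+ 1` in `mass` pays for that factor `2`. -/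
theorem num_den_lt (x : Expr) : x.num < 2 ^ x.mass ∧ x.den < 2 ^ x.mass := by
  induction x with
  | leaf e =>
    obtain ⟨e, p, q⟩ := e
    have h : p.size ≤ mass (leaf (e, p, q)) ∧ q.size ≤ mass (leaf (e, p, q)) := by
      simp only [mass, len_pair, len_nat]
      omega
    have h1 := one_le_mass (leaf (e, p, q))
    refine ⟨Nat.size_le.mp h.1, ?_⟩
    rw [den_leaf, leafDen]
    rcases Nat.eq_zero_or_pos q with rfl | hq
    · exact Nat.one_lt_two_pow (by omega)
    · have : q ≠ 0 := by omega
      simpa [this, eqB] using Nat.size_le.mp h.2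
  | ser x y hx hy =>
    have h : 2 ^ (ser x y).mass = 2 ^ x.mass * 2 ^ y.mass * 2 := by simp [mass, pow_add]
    have h1 := Nat.mul_lt_mul'' hx.1 hy.1
    have h2 := Nat.mul_lt_mul'' hx.2 hy.2
    rw [h, den_ser, num]
    constructor <;> omega
  | par x y hx hy =>
    have h : 2 ^ (par x y).mass = 2 ^ x.mass * 2 ^ y.mass * 2 := by simp [mass, pow_add]
    have h1 := Nat.mul_lt_mul'' hx.1 hy.2
    have h2 := Nat.mul_lt_mul'' hx.2 hy.2
    have h3 := Nat.mul_lt_mul'' hx.2 hy.1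
    rw [h, den_par, num, mul_comm y.num]
    constructor <;> omega

theorem len_clk_le (x : Expr) : len x.clk ≤ 2 * x.mass + 1 := by
  induction x with
  | leaf e =>
    have := one_le_mass (leaf e)
    simp only [clk, len_cons, len_nil, len_unit]
    omega
  | ser x y hx hy | par x y hx hy =>
    have := len_append x.clk y.clk
    simp only [clk, len_cons, len_unit, mass]
    omega

theorem len_leaf (e : Leaf) :
    len (leaf e) = len ((leaf e).num, (leaf e).den, (leaf e).clk) + len e + 3 := by
  simp only [len, code, Coded.code, toData, Data.size]
  simp only [cond_false, Data.size]
  omega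

theorem len_ser (x y : Expr) : len (ser x y) =
    len ((ser x y).num, (ser x y).den, (ser x y).clk) + len x + len y + 10 := by
  simp only [len, code, Coded.code, toData, Data.size]
  simp only [cond_true, Data.size]
  omega

theorem len_par (x y : Expr) : len (par x y) =
    len ((par x y).num, (par x y).den, (par x y).clk) + len x + len y + 8 := by
  simp only [len, code, Coded.code, toData, Data.size]
  simp only [cond_true, cond_false, Data.size]
  omega

theorem len_annotation_le (x : Expr) : len (x.num, x.den, x.clk) ≤ 14 * x.mass + 5 := by
  have h1 := Nat.size_le.mpr x.num_den_lt.1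
  have h2 := Nat.size_le.mpr x.num_den_lt.2
  have h3 := x.len_clk_le
  simp only [len_pair, len_nat]
  omega

/-- The annotation of every node is linear in the mass of its subtree, so the whole code is
quadratic. Since code lengths are not additive, growth is measured by `mass` and converted only at
the end. -/
theorem len_le (x : Expr) : len x ≤ 29 * x.mass ^ 2 := by
  induction x with
  | leaf e =>
    have h1 := len_annotation_le (leaf e)
    have h2 := one_le_mass (leaf e)
    rw [len_leaf]
    have h3 : len e = (leaf e).mass := rfl
    nlinarith
  | ser x y hx hy =>
    have h1 := len_annotation_le (ser x y)
    rw [len_ser]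
    simp only [mass] at *
    nlinarith [Nat.zero_le (x.mass * y.mass)]
  | par x y hx hy =>
    have h1 := len_annotation_le (par x y)
    rw [len_par]
    simp only [mass] at *
    nlinarith [Nat.zero_le (x.mass * y.mass)]

theorem mass_le_len (x : Expr) : x.mass ≤ len x := by
  induction x with
  | leaf e => rw [len_leaf, mass]; omega
  | ser x y hx hy => rw [len_ser, mass]; omega
  | par x y hx hy => rw [len_par, mass]; omega

theorem len_den_lt (x : Expr) : len x.den < len x := by
  have h : len (x.num, x.den, x.clk) < len x := by
    cases x with
    | leaf e => rw [len_leaf]; omega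
    | ser x y => rw [len_ser]; omega
    | par x y => rw [len_par]; omega
  rw [len_pair, len_pair] at h
  omega

theorem len_num_lt (x : Expr) : len x.num < len x := by
  have h : len (x.num, x.den, x.clk) < len x := by
    cases x with
    | leaf e => rw [len_leaf]; omega
    | ser x y => rw [len_ser]; omega
    | par x y => rw [len_par]; omega
  rw [len_pair, len_pair] at h
  omega

end Expr

/-! ### Sampling from an expression -/

/-- A state of the sampling process: expressions still to be expanded, leaves found so far, the
random number and the scale. -/
abbrev SampleState := (List Expr × List Leaf) × (ℕ × ℕ)

/-- The product of the numerators. -/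
def prodNum (l : List Expr) : ℕ := l.foldr (fun x n => x.num * n) 1

/-- The product of the numerators of leaves. -/
def prodLeafNum (l : List Leaf) : ℕ := l.foldr (fun x n => x.2.1 * n) 1

/-- The state after the first expression, a parallel composition of `y` and `z`, is replaced by one
of its parts. -/
def choosePart (y z : Expr) (rest : List Expr) (st : SampleState) : SampleState :=
  bif ltB st.2.1 (y.num * z.den * (st.2.2 * prodNum rest * prodLeafNum st.1.2)) then
    ((y :: rest, st.1.2), (st.2.1, st.2.2 * z.den))
  else ((z :: rest, st.1.2),
    (st.2.1 - y.num * z.den * (st.2.2 * prodNum rest * prodLeafNum st.1.2), st.2.2 * y.den))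

/-- Expand the first expression of a state. -/
def expand (p : (Expr × List Expr) × SampleState) : SampleState :=
  match p.1.1.view.2 with
  | .inl e => ((p.1.2, e :: p.2.1.2), p.2.2)
  | .inr q => bif q.1 then ((q.2.1 :: q.2.2 :: p.1.2, p.2.1.2), p.2.2)
    else choosePart q.2.1 q.2.2 p.1.2 p.2

/-- One step of the sampling process. -/
def sampleStep (st : SampleState) : SampleState :=
  match st.1.1 with
  | [] => st
  | x :: rest => expand ((x, rest), st)

/-- The leaves chosen for the expression `x` by the random number `r`. -/
def sample (x : Expr) (r : ℕ) : List Leaf :=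
  (x.clk.foldl (fun st _ => sampleStep st) (([x], []), (r, 1))).1.2

/-- The adjacency matrix of a set of edges. -/
def outMatrix (vs : List ℕ) (l : List Leaf) : List Bool :=
  vs.flatMap fun i => vs.map fun j => l.any fun e =>
    (eqB e.1.1 i && eqB e.1.2 j) || (eqB e.1.1 j && eqB e.1.2 i)

theorem len_mul_den_le (n : ℕ) (x : Expr) : len (n * x.den) ≤ len n + len x := by
  have h1 := len_mul_le n x.den
  have h2 := x.len_den_lt
  omega

/-- Expanding a node frees its annotation, and the random number never grows. In a parallel
composition the scale is multiplied by the denominator of the discarded part, whose own code is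
longer than that denominator. -/
theorem len_sampleStep_le (st : SampleState) : len (sampleStep st) ≤ len st := by
  obtain ⟨⟨todo, l⟩, r, s⟩ := st
  cases todo with
  | nil => exact le_rfl
  | cons x rest =>
    cases x with
    | leaf e =>
      simp only [sampleStep, expand, Expr.view, len_pair, len_cons, Expr.len_leaf]
      omega
    | ser y z =>
      simp only [sampleStep, expand, Expr.view, cond_true, len_pair, len_cons, Expr.len_ser]
      omega
    | par y z =>
      have h : ∀ n, len (r - n) ≤ len r := fun n => len_nat_mono (Nat.sub_le _ _)
      have h1 := h (y.num * z.den * (s * prodNum rest * prodLeafNum l))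
      have h2 := len_mul_den_le s y
      have h3 := len_mul_den_le s z
      simp only [sampleStep, expand, Expr.view, cond_false, choosePart]
      cases ltB r (y.num * z.den * (s * prodNum rest * prodLeafNum l)) <;>
        simp only [len_pair, len_cons, Expr.len_par, cond_true, cond_false] <;> omega

/-! ### The sampling process in polynomial time. -/

namespace PT

variable {α : Type} [Coded α]

@[fun_prop]
theorem prodNum {f : α → List Expr} (hf : PT f) : PT (fun a => prodNum (f a)) := by
  refine (foldr_growth (l := f) (i := fun _ => 1) (step := fun _ x n => x.num * n) hf (const 1)
    (by fun_prop) ⟨Polynomial.X, fun a b c => ?_⟩).congr fun a => rfl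
  have h1 := len_mul_le b.num c
  have h2 := b.len_num_lt
  rw [Polynomial.eval_X]
  omega

@[fun_prop]
theorem prodLeafNum {f : α → List Leaf} (hf : PT f) : PT (fun a => prodLeafNum (f a)) := by
  refine (foldr_growth (l := f) (i := fun _ => 1) (step := fun _ x n => x.2.1 * n) hf (const 1)
    (by fun_prop) ⟨Polynomial.X, fun a b c => ?_⟩).congr fun a => rfl
  have h1 := len_mul_le b.2.1 c
  have h2 : len b = len b.1 + (len b.2.1 + len b.2.2 + 1) + 1 := rfl
  rw [Polynomial.eval_X]
  omega

@[fun_prop]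
theorem choosePart {f g : α → Expr} {l : α → List Expr} {st : α → SampleState} (hf : PT f)
    (hg : PT g) (hl : PT l) (hst : PT st) :
    PT (fun a => choosePart (f a) (g a) (l a) (st a)) := by
  unfold StackProg.choosePart
  fun_prop

theorem expand : PT expand := by
  have h : PT fun p : (Expr × List Expr) × SampleState => p.1.1.view.2 := (view (by fun_prop)).snd
  have h1 : PT fun p : Leaf × ((Expr × List Expr) × SampleState) =>
      (((p.2.1.2, p.1 :: p.2.2.1.2), p.2.2.2) : SampleState) := by fun_prop
  have h2 : PT fun p : (Bool × Expr × Expr) × ((Expr × List Expr) × SampleState) =>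
      bif p.1.1 then ((p.1.2.1 :: p.1.2.2 :: p.2.1.2, p.2.2.1.2), p.2.2.2)
      else StackProg.choosePart p.1.2.1 p.1.2.2 p.2.1.2 p.2.2 := by fun_prop
  refine (sumCases h h1 h2).congr fun p => ?_
  obtain ⟨⟨x, rest⟩, st⟩ := p
  cases x <;> rfl

theorem sampleStep : PT sampleStep :=
  (listCases (f := fun st : SampleState => st.1.1) (by fun_prop) id expand).congr fun st => by
    obtain ⟨⟨todo, l⟩, r, s⟩ := st
    cases todo <;> rfl

@[fun_prop]
theorem sample {f : α → Expr} {r : α → ℕ} (hf : PT f) (hr : PT r) :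
    PT (fun a => sample (f a) (r a)) := by
  have h := foldl_growth (l := fun a => (f a).clk) (i := fun a => (([f a], []), (r a, 1)))
    (step := fun _ st _ => StackProg.sampleStep st) (by fun_prop) (by fun_prop)
    (sampleStep.comp (by fun_prop)) ⟨0, fun a b c => by
      have := len_sampleStep_le c
      omega⟩
  exact h.fst.snd

@[fun_prop]
theorem outMatrix {f : α → List ℕ} {l : α → List Leaf} (hf : PT f) (hl : PT l) :
    PT (fun a => outMatrix (f a) (l a)) := by
  refine flatMap hf (map (l := fun p : ℕ × α => f p.2) (by fun_prop)
    (any (l := fun p : ℕ × (ℕ × α) => l p.2.2) (by fun_prop) (by fun_prop)))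

end PT

end StackProg
namespace StackProg

/-! ### Reading a weighted graph -/

/-- The code of an input symbol. -/
def flags : InSym → Bool × Bool × Bool × Bool
  | .bit b => (true, b, false, false)
  | .slash => (false, true, false, false)
  | .edge => (false, false, true, false)
  | .nonedge => (false, false, false, true)
  | .endRow => (false, false, false, false)

instance : Coded InSym := ⟨fun s => code (flags s)⟩

/-- A matrix entry: nothing, or numerator and denominator in binary. -/
abbrev Entry := Option (List Bool × List Bool)

/-- Add an entry to the first row. -/
def consHead (x : Entry) (rows : List (List Entry)) : List (List Entry) :=
  match rows with
  | [] => [[x]]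
  | r :: rs => (x :: r) :: rs

/-- The state of the parser: digits of the current number, denominator, rows. -/
abbrev ParseState := List Bool × List Bool × List (List Entry)

/-- One step of the parser, which reads the input from the right. -/
def parseStep (s : InSym) (st : ParseState) : ParseState :=
  bif (flags s).1 then ((flags s).2.1 :: st.1, st.2)
  else bif (flags s).2.1 then ([], st.1, st.2.2)
  else bif (flags s).2.2.1 then ([], [], consHead (some (st.1, st.2.1)) st.2.2)
  else bif (flags s).2.2.2 then ([], [], consHead none st.2.2)
  else ([], [], [] :: st.2.2)

/-- The weighted adjacency matrix described by a word. -/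
def parse (x : List InSym) : List (List Entry) := (x.foldr parseStep ([], [], [])).2.2

/-- The number with given binary digits, the least significant one first. -/
def bitsVal (l : List Bool) : ℕ := l.foldr Nat.bit 0

/-- Edges labelled by expressions. -/
abbrev Edge := ℕ × ℕ × Expr

/-- The edge given by a matrix entry, if it lies above the diagonal. -/
def entryEdge (i j : ℕ) (x : Entry) : Option Edge :=
  match x with
  | none => none
  | some w => bif ltB i j then some (i, j, .leaf ((i, j), (bitsVal w.1, bitsVal w.2))) else none

/-- The edges described by a matrix. -/
def edgesOf (rows : List (List Entry)) : List Edge :=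
  rows.zipIdx.flatMap fun r => r.1.zipIdx.filterMap fun x => entryEdge r.2 x.2 x.1

/-- The vertices of a matrix. -/
def vertsOf (rows : List (List Entry)) : List ℕ := rows.zipIdx.map fun r => r.2

/-! ### Eliminating vertices -/

/-- The other end of an edge at `v`, with the expression of the edge. -/
def otherEnd (v : ℕ) (e : Edge) : Option (ℕ × Expr) :=
  bif eqB e.1 v then some (e.2.1, e.2.2) else bif eqB e.2.1 v then some (e.1, e.2.2) else none

/-- The edges at `v`. -/
def incident (v : ℕ) (es : List Edge) : List (ℕ × Expr) := es.filterMap (otherEnd v)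

/-- The edges that avoid `v`. -/
def avoiding (v : ℕ) (es : List Edge) : List Edge := es.filter fun e => !eqB e.1 v && !eqB e.2.1 v

/-- Whether an edge joins `a` and `b`. -/
def joins (a b : ℕ) (e : Edge) : Bool := (eqB e.1 a && eqB e.2.1 b) || (eqB e.1 b && eqB e.2.1 a)

/-- The current graph, and the sum of the cycles found so far. -/
abbrev ElimState := List Edge × Expr

/-- The graph with a path between two vertices replaced by an edge, which is merged with the old
edge between them, if there is one. -/
def contract (x y : ℕ × Expr) (st : ElimState) : ElimState :=
  match st.1.filter (joins x.1 y.1) with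
  | [] => ((x.1, y.1, .ser x.2 y.2) :: st.1, st.2)
  | z :: _ => ((x.1, y.1, .par (.ser x.2 y.2) z.2.2) :: st.1.filter (fun e => !joins x.1 y.1 e),
      .par st.2 (.ser (.ser x.2 y.2) z.2.2))

/-- Eliminate `v` if it has degree at most `2`. -/
def elimStep (v : ℕ) (st : ElimState) : ElimState :=
  match incident v st.1 with
  | [] => st
  | x :: l => match l with
    | [] => (avoiding v st.1, st.2)
    | y :: l' => bif l'.isEmpty then contract x y (avoiding v st.1, st.2) else st

/-- The order in which vertices are tried. -/
def schedule (rows : List (List Entry)) : List ℕ := (edgesOf rows).flatMap fun _ => vertsOf rows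

/-- An expression of weight zero. -/
def zeroExpr : Expr := .leaf ((0, 0), (0, 1))

/-- Eliminate vertices until none is left. -/
def eliminate (rows : List (List Entry)) : ElimState :=
  (schedule rows).foldl (fun st v => elimStep v st) (edgesOf rows, zeroExpr)

/-! ### Sizes -/

theorem len_list_le {β : Type} [Coded β] {l : List β} {B : ℕ} (h : ∀ x ∈ l, len x ≤ B) :
    len l ≤ l.length * (B + 1) + 1 := by
  induction l with
  | nil => simp [len_nil]
  | cons x l ih =>
    have h1 := ih fun y hy => h y (List.mem_cons_of_mem _ hy)
    have h2 := h x List.mem_cons_self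
    rw [len_cons, List.length_cons, Nat.add_mul]
    omega

theorem len_nat_le (n : ℕ) : len n ≤ 6 * n + 1 := by
  have : n.size ≤ n := Nat.size_le.mpr Nat.lt_two_pow_self
  rw [len_nat]
  omega

theorem len_some {β : Type} [Coded β] (x : β) : len (some x) = len x + 2 := by
  change len [x] = _
  rw [len_cons, len_nil]

theorem len_none {β : Type} [Coded β] : len (none : Option β) = 1 := rfl

theorem len_consHead_le (x : Entry) (rows : List (List Entry)) :
    len (consHead x rows) ≤ len rows + len x + 4 := by
  cases rows with
  | nil => simp only [consHead, len_cons, len_nil]; omega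
  | cons r rs => simp only [consHead, len_cons]; omega

theorem len_parseStep_le (s : InSym) (st : ParseState) : len (parseStep s st) ≤ len st + 10 := by
  obtain ⟨cur, den, rows⟩ := st
  have h1 := len_consHead_le (some (cur, den)) rows
  have h2 := len_consHead_le none rows
  have h3 := len_pos cur
  have h4 := len_pos den
  rw [len_some, len_pair] at h1
  rw [len_none] at h2
  cases s with
  | bit b =>
    have := len_bool_le b
    simp only [parseStep, flags, cond_true, len_pair, len_cons]
    omega
  | _ =>
    simp only [parseStep, flags, cond_true, cond_false, len_pair, len_nil, len_cons]
    omega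

/-- The mass of an edge. -/
def edgeMass (e : Edge) : ℕ := len e.1 + len e.2.1 + e.2.2.mass

/-- The mass of a list of edges. -/
def edgesMass (es : List Edge) : ℕ := (es.map edgeMass).sum

theorem edgesMass_le_len (es : List Edge) : edgesMass es ≤ len es := by
  induction es with
  | nil => simp [edgesMass]
  | cons e es ih =>
    have := e.2.2.mass_le_len
    have h : len e = len e.1 + (len e.2.1 + len e.2.2 + 1) + 1 := rfl
    simp only [edgesMass, List.map_cons, List.sum_cons, len_cons, edgeMass] at *
    omega

theorem len_le_edgesMass (es : List Edge) : len es ≤ 40 * edgesMass es ^ 2 + 1 := by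
  induction es with
  | nil => simp [len_nil]
  | cons e es ih =>
    have h1 := e.2.2.len_le
    have h2 := e.2.2.one_le_mass
    have h : len e = len e.1 + (len e.2.1 + len e.2.2 + 1) + 1 := rfl
    simp only [edgesMass, List.map_cons, List.sum_cons, len_cons, edgeMass] at *
    rw [h]
    nlinarith [Nat.zero_le ((len e.1 + len e.2.1) * e.2.2.mass), Nat.zero_le (len e.1 * len e.2.1),
      Nat.zero_le ((len e.1 + len e.2.1 + e.2.2.mass) * (es.map edgeMass).sum),
      len_pos e.1, len_pos e.2.1]

theorem edgesMass_filter (p : Edge → Bool) (es : List Edge) :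
    edgesMass (es.filter p) + edgesMass (es.filter fun e => !p e) = edgesMass es := by
  induction es with
  | nil => rfl
  | cons e es ih =>
    cases h : p e <;>
    simp only [edgesMass, List.filter_cons, h, List.map_cons, List.sum_cons, Bool.not_true,
      Bool.not_false, if_true, Bool.false_eq_true, if_false] at * <;>
    omega

/-- The mass of the list of edges at a vertex. -/
def incMass (l : List (ℕ × Expr)) : ℕ := (l.map fun x => len x.1 + x.2.mass).sum

theorem incMass_add_le (v : ℕ) (es : List Edge) :
    incMass (incident v es) + edgesMass (avoiding v es) ≤ edgesMass es := by
  induction es with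
  | nil => simp [incMass, edgesMass, incident, avoiding]
  | cons e es ih =>
    cases h1 : eqB e.1 v <;> cases h2 : eqB e.2.1 v <;>
    simp only [incMass, edgesMass, incident, avoiding, otherEnd, edgeMass, List.filter_cons, h1,
      h2, List.filterMap_cons, List.map_cons, List.sum_cons, Bool.not_true, cond_true, cond_false,
      Bool.not_false, Bool.and_true, Bool.and_false, if_true, Bool.false_eq_true, if_false] at * <;>
    omega

/-- The new edge reuses the end points and expressions of the edges it replaces, so the graph gains
only two constructors. The total receives one more copy of these expressions. -/
theorem contract_mass (x y : ℕ × Expr) (st : ElimState) :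
    edgesMass (contract x y st).1 ≤
      edgesMass st.1 + len x.1 + len y.1 + x.2.mass + y.2.mass + 2 ∧
    (contract x y st).2.mass ≤ st.2.mass + edgesMass st.1 + x.2.mass + y.2.mass + 3 := by
  unfold contract
  have h := edgesMass_filter (joins x.1 y.1) st.1
  cases hf : st.1.filter (joins x.1 y.1) with
  | nil =>
    simp only [edgesMass, List.map_cons, List.sum_cons, edgeMass, Expr.mass]
    omega
  | cons z l =>
    rw [hf] at h
    simp only [edgesMass, List.map_cons, List.sum_cons, edgeMass, Expr.mass] at *
    omega

theorem elimStep_mass (v : ℕ) (st : ElimState) :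
    edgesMass (elimStep v st).1 ≤ edgesMass st.1 + 2 ∧
    (elimStep v st).2.mass ≤ st.2.mass + edgesMass st.1 + 3 := by
  have h := incMass_add_le v st.1
  unfold elimStep
  cases hi : incident v st.1 with
  | nil => dsimp only; omega
  | cons x l =>
    cases l with
    | nil => dsimp only; omega
    | cons y l =>
      cases l with
      | nil =>
        have h1 := contract_mass x y (avoiding v st.1, st.2)
        rw [hi] at h
        simp only [incMass, List.map_cons, List.sum_cons, List.isEmpty_nil, cond_true, List.map_nil,
          List.sum_nil] at *
        omega
      | cons z l =>
        simp only [List.isEmpty_cons, cond_false]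
        omega

/-- The graph grows by a constant per step and the total by at most the current mass of the graph
plus a constant. Growth is thus additive: nothing doubles, although expressions are copied. -/
theorem elim_fold_mass (l : List ℕ) : ∀ st : ElimState,
    edgesMass (l.foldl (fun st v => elimStep v st) st).1 ≤ edgesMass st.1 + 2 * l.length ∧
    (l.foldl (fun st v => elimStep v st) st).2.mass ≤
      st.2.mass + l.length * (edgesMass st.1 + 2 * l.length + 3) := by
  induction l with
  | nil => simp
  | cons v l ih =>
    intro st
    have h1 := elimStep_mass v st
    have h2 := ih (elimStep v st)
    simp only [List.foldl_cons, List.length_cons]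
    refine ⟨by omega, h2.2.trans ?_⟩
    nlinarith [h1.1, h1.2, Nat.mul_le_mul_left l.length h1.1]

/-! ### The algorithm runs in polynomial time -/

namespace PT

variable {α β : Type} [Coded α] [Coded β]

theorem zipIdx {l : α → List β} (hl : PT l) : PT (fun a => (l a).zipIdx) := by
  have key : ∀ (l' : List β) (k : ℕ) (acc : List (β × ℕ)),
      l'.foldl (fun (s : ℕ × List (β × ℕ)) b => (s.1 + 1, (b, s.1) :: s.2)) (k, acc)
        = (k + l'.length, (l'.zipIdx k).reverse ++ acc) := by
    intro l'
    induction l' with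
    | nil => intro k acc; rfl
    | cons x l' ih =>
      intro k acc
      rw [List.foldl_cons, ih]
      simp [List.zipIdx_cons]
      omega
  obtain ⟨q, hq⟩ := hl.size_bound
  have h := foldl (i := fun _ => (0, [])) (step := fun _ (s : ℕ × List (β × ℕ)) b =>
    (s.1 + 1, (b, s.1) :: s.2)) hl (const _) (by fun_prop)
    ⟨(Polynomial.C 6 * q + 1) + (q * (q + (Polynomial.C 6 * q + 1) + 1 + 1) + 1) + 1,
      fun a l' hl' => by
        rw [key, len_pair]
        simp only [Polynomial.eval_add, Polynomial.eval_mul, Polynomial.eval_C,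
          Polynomial.eval_one, Nat.zero_add, List.append_nil]
        have h0 := hq a
        have h1 := hl'.length_le
        have h2 := length_le_len (l a)
        have h3 := len_nat_le l'.length
        have h4 : len (l'.zipIdx 0).reverse ≤ (l'.zipIdx 0).reverse.length *
            (q.eval (len a) + (6 * q.eval (len a) + 1) + 1 + 1) + 1 := by
          refine len_list_le fun x hx => ?_
          rw [List.mem_reverse] at hx
          obtain ⟨x, i⟩ := x
          have hx' := List.mem_zipIdx hx
          have h5 : len x ≤ len (l a) := len_le_of_mem (hl'.subset (hx'.2.2 ▸ List.getElem_mem _))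
          have h6 := len_nat_le i
          rw [len_pair]
          omega
        have h5 : (l'.zipIdx 0).reverse.length ≤ q.eval (len a) := by simp; omega
        have h6 := Nat.mul_le_mul_right (q.eval (len a) + (6 * q.eval (len a) + 1) + 1 + 1) h5
        omega⟩
  exact h.snd.reverse.congr fun a => by simp [key]

@[fun_prop]
theorem flags {f : α → InSym} (hf : PT f) : PT (fun a => flags (f a)) := hf.recode fun _ => rfl

@[fun_prop]
theorem consHead {f : α → Entry} {g : α → List (List Entry)} (hf : PT f) (hg : PT g) :
    PT (fun a => consHead (f a) (g a)) := by
  have h : PT fun p : (List Entry × List (List Entry)) × α => (f p.2 :: p.1.1) :: p.1.2 := by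
    fun_prop
  have h' : PT fun a => [[f a]] := by fun_prop
  refine (listCases hg h' h).congr fun a => ?_
  unfold StackProg.consHead
  cases g a <;> rfl

theorem parseStep : PT (fun p : InSym × ParseState => parseStep p.1 p.2) := by
  unfold StackProg.parseStep
  fun_prop

theorem parse {f : α → List InSym} (hf : PT f) : PT (fun a => parse (f a)) := by
  have h1 : PT fun p : InSym × (ParseState × α) => StackProg.parseStep p.1 p.2.1 :=
    parseStep.comp (f := fun p : InSym × (ParseState × α) => (p.1, p.2.1)) (by fun_prop)
  have h := foldr_growth (l := f) (i := fun _ => (([], [], []) : ParseState))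
    (step := fun _ s st => StackProg.parseStep s st) hf (const ([], [], [])) h1
    ⟨Polynomial.C 10, fun a s st => by
      have := len_parseStep_le s st
      rw [Polynomial.eval_C]
      omega⟩
  exact h.snd.snd

@[fun_prop]
theorem bitsVal {f : α → List Bool} (hf : PT f) : PT (fun a => bitsVal (f a)) :=
  (ofDigits_zero hf.reverse).congr fun a => by
    simp [StackProg.bitsVal, ofDigits, List.foldl_reverse]

theorem entryEdge {i j : α → ℕ} {x : α → Entry} (hi : PT i) (hj : PT j) (hx : PT x) :
    PT (fun a => entryEdge (i a) (j a) (x a)) := by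
  have h : PT fun p : (List Bool × List Bool) × α =>
      bif StackProg.ltB (i p.2) (j p.2) then Option.some (i p.2, j p.2,
        Expr.leaf ((i p.2, j p.2), (StackProg.bitsVal p.1.1, StackProg.bitsVal p.1.2)))
      else none := by fun_prop
  have h' : PT fun _ : α => (none : Option Edge) := const none
  refine (optionCases hx h' h).congr fun a => ?_
  unfold StackProg.entryEdge
  cases x a <;> rfl

theorem edgesOf {f : α → List (List Entry)} (hf : PT f) : PT (fun a => edgesOf (f a)) := by
  have h1 : PT fun p : (List Entry × ℕ) × α => p.1.1.zipIdx := zipIdx (by fun_prop)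
  have h2 : PT fun p : (Entry × ℕ) × ((List Entry × ℕ) × α) =>
      StackProg.entryEdge p.2.1.2 p.1.2 p.1.1 :=
    entryEdge (by fun_prop) (by fun_prop) (by fun_prop)
  have h3 := filterMap (f := fun (p : (List Entry × ℕ) × α) (x : Entry × ℕ) =>
    StackProg.entryEdge p.1.2 x.2 x.1) h1 h2
  exact (flatMap (f := fun _ (r : List Entry × ℕ) => r.1.zipIdx.filterMap fun x =>
    StackProg.entryEdge r.2 x.2 x.1) (zipIdx hf) h3).congr fun _ => rfl

theorem vertsOf {f : α → List (List Entry)} (hf : PT f) : PT (fun a => vertsOf (f a)) :=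
  map (f := fun _ (r : List Entry × ℕ) => r.2) (zipIdx hf) (by fun_prop)

@[fun_prop]
theorem otherEnd {v : α → ℕ} {e : α → Edge} (hv : PT v) (he : PT e) :
    PT (fun a => otherEnd (v a) (e a)) := by
  have h : PT fun _ : α => (none : Option (ℕ × Expr)) := const none
  unfold StackProg.otherEnd
  fun_prop

theorem incident {v : α → ℕ} {f : α → List Edge} (hv : PT v) (hf : PT f) :
    PT (fun a => incident (v a) (f a)) :=
  filterMap (f := fun a e => StackProg.otherEnd (v a) e) hf (by fun_prop)

@[fun_prop]
theorem avoiding {v : α → ℕ} {f : α → List Edge} (hv : PT v) (hf : PT f) :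
    PT (fun a => avoiding (v a) (f a)) :=
  (filter (f := fun a e => !StackProg.eqB e.1 (v a) && !StackProg.eqB e.2.1 (v a)) hf
    (by fun_prop)).congr fun _ => rfl

@[fun_prop]
theorem joins {a b : α → ℕ} {e : α → Edge} (ha : PT a) (hb : PT b) (he : PT e) :
    PT (fun x => joins (a x) (b x) (e x)) := by
  unfold StackProg.joins
  fun_prop

@[fun_prop]
theorem contract {x y : α → ℕ × Expr} {st : α → ElimState} (hx : PT x) (hy : PT y)
    (hst : PT st) : PT (fun a => contract (x a) (y a) (st a)) := by
  have h1 : PT fun a => (st a).1.filter (StackProg.joins (x a).1 (y a).1) :=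
    filter (by fun_prop) (by fun_prop)
  have h2 : PT fun a => (st a).1.filter (fun e => !StackProg.joins (x a).1 (y a).1 e) :=
    filter (by fun_prop) (by fun_prop)
  have h3 := h2.comp (snd' (α := Edge × List Edge))
  have h4 : PT fun a => (((x a).1, (y a).1, Expr.ser (x a).2 (y a).2) :: (st a).1, (st a).2) := by
    fun_prop
  have h5 : PT fun p : (Edge × List Edge) × α => (((x p.2).1, (y p.2).1,
      Expr.par (.ser (x p.2).2 (y p.2).2) p.1.1.2.2) ::
        (st p.2).1.filter (fun e => !StackProg.joins (x p.2).1 (y p.2).1 e),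
      Expr.par (st p.2).2 (.ser (.ser (x p.2).2 (y p.2).2) p.1.1.2.2)) := by
    fun_prop
  refine (listCases h1 h4 h5).congr fun a => ?_
  unfold StackProg.contract
  cases (st a).1.filter (StackProg.joins (x a).1 (y a).1) <;> rfl

theorem elimStep {v : α → ℕ} {st : α → ElimState} (hv : PT v) (hst : PT st) :
    PT (fun a => elimStep (v a) (st a)) := by
  have h1 : PT fun p : ((ℕ × Expr) × List (ℕ × Expr)) × α =>
      (StackProg.avoiding (v p.2) (st p.2).1, (st p.2).2) := by fun_prop
  have h2 : PT fun q : ((ℕ × Expr) × List (ℕ × Expr)) × (((ℕ × Expr) × List (ℕ × Expr)) × α) =>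
      bif q.1.2.isEmpty then StackProg.contract q.2.1.1 q.1.1
        (StackProg.avoiding (v q.2.2) (st q.2.2).1, (st q.2.2).2) else st q.2.2 := by fun_prop
  have h3 : PT fun p : ((ℕ × Expr) × List (ℕ × Expr)) × α => p.1.2 := by fun_prop
  refine (listCases (incident hv hst.fst) hst (listCases h3 h1 h2)).congr fun a => ?_
  unfold StackProg.elimStep
  cases StackProg.incident (v a) (st a).1 with
  | nil => rfl
  | cons x l => cases l <;> rfl

theorem eliminate {f : α → List (List Entry)} (hf : PT f) : PT (fun a => eliminate (f a)) := by
  have hv : PT fun p : Edge × α => StackProg.vertsOf (f p.2) := vertsOf (by fun_prop)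
  have hs : PT fun a => schedule (f a) :=
    (flatMap (f := fun a _ => StackProg.vertsOf (f a)) (edgesOf hf) hv).congr fun _ => rfl
  obtain ⟨p, hp⟩ := hs.size_bound
  obtain ⟨q, hq⟩ := (edgesOf hf).size_bound
  refine (foldl (l := fun a => schedule (f a)) (i := fun a => (StackProg.edgesOf (f a), zeroExpr))
    (step := fun _ st v => StackProg.elimStep v st) hs ((edgesOf hf).prodMk (const zeroExpr))
    (elimStep fst' (by fun_prop))
    -- The bounds of `elim_fold_mass` for at most `p` steps and initial mass at most `q`, squared by
    -- the passage from mass to code length in `len_le_edgesMass` and `Expr.len_le`.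
    ⟨(Polynomial.C 40 * (q + Polynomial.C 2 * p) ^ 2 + 1) + (Polynomial.C 29 *
      (Polynomial.C zeroExpr.mass + p * (q + Polynomial.C 2 * p + Polynomial.C 3)) ^ 2) + 1,
      fun a l' hl' => ?_⟩).congr fun _ => rfl
  simp only [Polynomial.eval_add, Polynomial.eval_mul, Polynomial.eval_C, Polynomial.eval_one,
    Polynomial.eval_pow]
  obtain ⟨h1, h2⟩ := elim_fold_mass l' (StackProg.edgesOf (f a), zeroExpr)
  set st := l'.foldl (fun st v => StackProg.elimStep v st) (StackProg.edgesOf (f a), zeroExpr)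
  have h3 : l'.length ≤ p.eval (len a) :=
    (hl'.length_le.trans (length_le_len _)).trans (hp a)
  have h4 := (edgesMass_le_len (StackProg.edgesOf (f a))).trans (hq a)
  have h5 : len st = len st.1 + len st.2 + 1 := rfl
  have h6 := len_le_edgesMass st.1
  have h7 := st.2.len_le
  have h8 : edgesMass st.1 ^ 2 ≤ (q.eval (len a) + 2 * p.eval (len a)) ^ 2 :=
    Nat.pow_le_pow_left (by dsimp only at h1; omega) 2
  have h9 : st.2.mass ^ 2 ≤ (zeroExpr.mass + p.eval (len a) * (q.eval (len a) +
      2 * p.eval (len a) + 3)) ^ 2 :=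
    Nat.pow_le_pow_left (h2.trans (Nat.add_le_add_left (Nat.mul_le_mul h3 (by
      dsimp only; omega)) _)) 2
  rw [h5]
  omega

end PT

end StackProg
namespace StackProg

/-! ### Input, coins and output -/

/-- Execution within `T` steps. -/
def ExLe (P : Prog) (T : ℕ) (s s' : State) : Prop := ∃ t ≤ T, Ex P t s s'

theorem Ex.le {P : Prog} {t : ℕ} {s s' : State} (h : Ex P t s s') : ExLe P t s s' := ⟨t, le_rfl, h⟩

namespace ExLe

variable {P Q : Prog} {S T : ℕ} {s s' s'' : State} {c : Reg → Bool}

theorem mono (h : ExLe P S s s') (hT : S ≤ T) : ExLe P T s s' := by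
  obtain ⟨t, ht, h⟩ := h
  exact ⟨t, ht.trans hT, h⟩

theorem seq (h : ExLe P S s s') (h' : ExLe Q T s' s'') : ExLe (.seq P Q) (S + T) s s'' := by
  obtain ⟨t, ht, h⟩ := h
  obtain ⟨t', ht', h'⟩ := h'
  exact ⟨t + t', by omega, h.seq h'⟩

theorem ite_true (hc : c s.reg = true) (h : ExLe P T s s') : ExLe (.ite c P Q) (1 + T) s s' := by
  obtain ⟨t, ht, h⟩ := h
  exact ⟨1 + t, by omega, Ex.ite_true hc h⟩

theorem ite_false (hc : c s.reg = false) (h : ExLe Q T s s') : ExLe (.ite c P Q) (1 + T) s s' := by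
  obtain ⟨t, ht, h⟩ := h
  exact ⟨1 + t, by omega, Ex.ite_false hc h⟩

theorem loop_true (hc : c s.reg = true) (h : ExLe P S s s') (h' : ExLe (.loop c P) T s' s'') :
    ExLe (.loop c P) (1 + S + T) s s'' := by
  obtain ⟨t, ht, h⟩ := h
  obtain ⟨t', ht', h'⟩ := h'
  exact ⟨1 + t + t', by omega, Ex.loop_true hc h h'⟩

end ExLe

theorem W.exLe {P : Prog} {u v : List Sym} {T : ℕ} (h : W P u v T) (r : Reg)
    (m a b i o : List Sym) :
    ∃ r', ExLe P T ⟨r, u ++ m, a, b, [], i, o⟩ ⟨r', v ++ m, a, b, [], i, o⟩ := by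
  obtain ⟨t, ht, r', h⟩ := h r m a b i o
  exact ⟨r', t, ht, h⟩

/-- A loop that empties a stack, where `body` processes the symbol in the register. -/
theorem drain_loop {k : Stk} {body : Prog} {T : ℕ} {β : Type} (f : Reg → List Sym → List β → State)
    (sym : β → Sym) (hreg : ∀ r l l', (f r l l').reg = r)
    (hbody : ∀ x l l', ∃ r', ExLe body T (f (some (sym x)) l l') (f r' l (x :: l')))
    (hpop : ∀ r l l', Ex (.pop k) 1 (f r l l') (f l.head? l.tail l')) (l : List β) :
    ∀ (r : Reg) (l' : List β), ExLe (.seq (.pop k) (.loop Option.isSome (.seq body (.pop k))))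
      (l.length * (T + 2) + 2) (f r (l.map sym) l') (f none [] (l.reverse ++ l')) := by
  have key : ∀ (l l' : List β), ExLe (.loop Option.isSome (.seq body (.pop k)))
      (l.length * (T + 2) + 1) (f (l.map sym).head? (l.map sym).tail l')
      (f none [] (l.reverse ++ l')) := by
    intro l
    induction l with
    | nil => intro l'; exact (Ex.loop_false (by simp [hreg])).le.mono (by omega)
    | cons x l ih =>
      intro l'
      obtain ⟨r', h⟩ := hbody x (l.map sym) l'
      have h1 := ExLe.loop_true (c := Option.isSome) (s := f (some (sym x)) (l.map sym) l')
        (by simp [hreg]) (h.seq (hpop _ _ _).le) (ih (x :: l'))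
      rw [List.reverse_cons, List.append_assoc]
      refine h1.mono ?_
      rw [List.length_cons, Nat.add_mul]
      omega
  intro r l'
  exact ((hpop _ _ _).le.seq (key l l')).mono (by omega)

namespace Prog

/-- Push the code of an input symbol as a new head of a list. -/
def emit (s : InSym) : Prog := .seq (.pushList (StackProg.code s).enc) (.push .main (.bit true))

/-- Push the code of the input symbol in the register as a new head of a list. -/
def emitReg : List InSym → Prog
  | [] => .skip
  | s :: l => .ite (fun r => decide (r = some (.inp s))) (emit s) (emitReg l)

/-- All input symbols. -/
def inSyms : List InSym := [.bit false, .bit true, .edge, .nonedge, .slash, .endRow]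

/-- Turn the input into a coded list. -/
def read : Prog :=
  .seq (.seq (.pop .inp) (.loop Option.isSome (.seq (.pushReg .a) (.pop .inp))))
    (.seq (.push .main (.bit false))
      (.seq (.pop .a) (.loop Option.isSome (.seq (emitReg inSyms) (.pop .a)))))

/-- Replace the list on the main stack by a random word on an auxiliary stack. -/
def flip : Prog :=
  .seq (.pop .main) (.seq (.pop .main) (.loop (fun r => decide (r = some (.bit true)))
    (.seq (.pop .main) (.seq .coin (.seq (.pushReg .a) (.pop .main))))))

/-- Push the code of the bit in the register as a new head of a list. -/
def emitBit : Prog :=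
  .seq (.push .main (.bit false)) (.seq (.ite (fun r => decide (r = some (.bit true)))
    (.seq (.push .main (.bit false)) (.push .main (.bit true))) .skip) (.push .main (.bit true)))

/-- Turn the random word into a coded list. -/
def collect : Prog :=
  .seq (.push .main (.bit false))
    (.seq (.seq (.pop .a) (.loop Option.isSome (.seq emitBit (.pop .a))))
      (.push .main (.bit true)))

/-- Move the code of a bit to an auxiliary stack, as one symbol. -/
def readBit : Prog :=
  .seq (.pop .main) (.ite (fun r => decide (r = some (.bit true)))
    (.seq (.pop .main) (.seq (.pop .main) (.push .a (.bit true)))) (.push .a (.bit false)))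

/-- Write the output word, if there is one. -/
def write : Prog :=
  .seq (.pop .main) (.ite (fun r => decide (r = some (.bit true)))
    (.seq (.seq (.pop .main) (.loop (fun r => decide (r = some (.bit true)))
        (.seq readBit (.pop .main))))
      (.seq (.seq (.pop .a) (.loop Option.isSome (.seq (.pushReg .out) (.pop .a))))
        (.seq (.push .cnt .mark) (.pop .cnt)))) .skip)

end Prog

theorem emitReg_ex (s : InSym) (m a b i o : List Sym) : ∀ l : List InSym, s ∈ l →
    ∃ r', ExLe (Prog.emitReg l) (l.length + len s + 2) ⟨some (.inp s), m, a, b, [], i, o⟩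
      ⟨r', .bit true :: ((code s).enc ++ m), a, b, [], i, o⟩ := by
  intro l
  induction l with
  | nil => simp
  | cons s' l ih =>
    intro hs
    by_cases h : s = s'
    · subst h
      obtain ⟨r', h⟩ := ((W.pushList (code s).enc).seq (W.push (.bit true) _)).exLe
        (some (.inp s)) m a b i o
      refine ⟨r', (ExLe.ite_true (by simp) h).mono ?_⟩
      rw [Data.length_enc, List.length_cons, len]
      omega
    · obtain ⟨r', h'⟩ := ih ((List.mem_cons.mp hs).resolve_left h)
      exact ⟨r', (ExLe.ite_false (by simp [h]) h').mono (by simp only [List.length_cons]; omega)⟩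

theorem mem_inSyms (s : InSym) : s ∈ Prog.inSyms := by
  cases s with
  | bit b => cases b <;> simp [Prog.inSyms]
  | _ => simp [Prog.inSyms]

theorem len_inSym_le (s : InSym) : len s ≤ 12 := by
  cases s with
  | bit b => cases b <;> decide
  | _ => decide

theorem enc_list_cons {β : Type} [Coded β] (x : β) (l : List β) :
    (code (x :: l)).enc = .bit true :: ((code x).enc ++ (code l).enc) := rfl

/-- The code of a list is built starting from its last element, so the input is first reversed onto
`a`. -/
theorem read_ex (x : List InSym) : ExLe Prog.read (x.length * 30 + 10)
    ⟨none, [], [], [], [], x.map .inp, []⟩ ⟨none, (code x).enc, [], [], [], [], []⟩ := by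
  have h1 := drain_loop (k := .inp) (body := .pushReg .a) (T := 1) (sym := Sym.inp)
    (fun r l l' => ⟨r, [], l'.map .inp, [], [], l, []⟩) (fun _ _ _ => rfl)
    (fun x l l' => ⟨_, (Ex.pushReg .a _).le⟩) (fun _ _ _ => Ex.pop .inp _) x none []
  have h2 := drain_loop (k := .a) (body := Prog.emitReg Prog.inSyms) (T := 20) (sym := Sym.inp)
    (fun r l l' => ⟨r, (code l').enc, l, [], [], [], []⟩) (fun _ _ _ => rfl)
    (fun x l l' => by
      obtain ⟨r', h⟩ := emitReg_ex x (code l').enc l [] [] [] Prog.inSyms (mem_inSyms x)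
      refine ⟨r', h.mono ?_⟩
      have := len_inSym_le x
      simp only [Prog.inSyms, List.length_cons, List.length_nil]
      omega)
    (fun _ _ _ => Ex.pop .a _) x.reverse none []
  simp only [List.append_nil, List.reverse_reverse, List.length_reverse] at h1 h2
  exact (h1.seq ((Ex.push .main (.bit false) _).le.seq h2)).mono (by omega)

/-- The law of `k` independent fair bits. -/
noncomputable def coinList : ℕ → PMF (List Bool)
  | 0 => PMF.pure []
  | k + 1 => (PMF.uniformOfFintype Bool).bind fun b => (coinList k).map (b :: ·)

/-- Every round takes five steps whatever the coin shows, so all outcomes leave the loop at the same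
time, as `ExP` demands. -/
theorem flip_loop (m : List Sym) (l : List Unit) : ∀ (a : List Sym),
    ExP (.loop (fun r => decide (r = some (.bit true)))
      (.seq (.pop .main) (.seq .coin (.seq (.pushReg .a) (.pop .main))))) (5 * l.length + 1)
      ⟨((code l).enc ++ m).head?, ((code l).enc ++ m).tail, a, [], [], [], []⟩
      ((coinList l.length).map fun bs =>
        ⟨some (.bit false), m, (bs.map .bit).reverse ++ a, [], [], [], []⟩) := by
  induction l with
  | nil =>
    intro a
    rw [List.length_nil, coinList, PMF.pure_map]
    exact Ex.loop_false rfl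
  | cons u l ih =>
    intro a
    have e : ((PMF.uniformOfFintype Bool).bind fun b =>
        (coinList l.length).map fun bs => (⟨some (.bit false), m, (bs.map .bit).reverse ++
          (.bit b :: a), [], [], [], []⟩ : State)) =
        (coinList (u :: l).length).map fun bs =>
          ⟨some (.bit false), m, (bs.map .bit).reverse ++ a, [], [], [], []⟩ := by
      rw [List.length_cons, coinList, PMF.map_bind]
      congr 1
      funext b
      rw [PMF.map_comp]
      congr 1
      funext bs
      simp
    rw [← e]
    have hb : ExP (.seq (.pop .main) (.seq .coin (.seq (.pushReg .a) (.pop .main)))) 4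
        ⟨some (.bit true), .bit false :: ((code l).enc ++ m), a, [], [], [], []⟩
        ((PMF.uniformOfFintype Bool).map fun b => ⟨((code l).enc ++ m).head?,
          ((code l).enc ++ m).tail, .bit b :: a, [], [], [], []⟩) :=
      Ex.seqP (t := 1) (t' := 3) (Ex.pop .main _) (ExP.seq (t := 1) (t' := 2) (ExP.coin _)
        (ν := fun b => PMF.pure ⟨((code l).enc ++ m).head?,
          ((code l).enc ++ m).tail, .bit b :: a, [], [], [], []⟩)
        fun b => Ex.seq (t := 1) (t' := 1) (Ex.pushReg .a _) (Ex.pop .main _))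
    have h := ExP.loop_true (c := fun r => decide (r = some (.bit true))) rfl hb
      fun b => ih (.bit b :: a)
    have ht : 1 + 4 + (5 * l.length + 1) = 5 * (u :: l).length + 1 := by
      rw [List.length_cons]; ring
    rw [ht] at h
    exact h

theorem flip_ex {γ : Type} [Coded γ] (r : Reg) (l : List Unit) (g : γ) :
    ExP Prog.flip (5 * l.length + 3) ⟨r, (code (l, g)).enc, [], [], [], [], []⟩
      ((coinList l.length).map fun bs =>
        ⟨some (.bit false), (code g).enc, (bs.map .bit).reverse, [], [], [], []⟩) := by
  have h := flip_loop (code g).enc l []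
  simp only [List.append_nil] at h
  have h' := Ex.seqP (Ex.pop .main ⟨r, (code (l, g)).enc, [], [], [], [], []⟩)
    (Ex.seqP (Ex.pop .main ⟨_, (code l).enc ++ (code g).enc, [], [], [], [], []⟩) h)
  have ht : 1 + (1 + (5 * l.length + 1)) = 5 * l.length + 3 := by ring
  rw [ht] at h'
  exact h'

theorem emitBit_ex (x : Bool) (m a : List Sym) : ∃ r', ExLe Prog.emitBit 6
    ⟨some (.bit x), m, a, [], [], [], []⟩
    ⟨r', .bit true :: ((code x).enc ++ m), a, [], [], [], []⟩ := by
  cases x with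
  | true =>
    exact ⟨_, ((Ex.push .main (.bit false) _).le.seq ((ExLe.ite_true rfl
      ((Ex.push .main (.bit false) _).le.seq (Ex.push .main (.bit true) _).le)).seq
      (Ex.push .main (.bit true) _).le)).mono (by omega)⟩
  | false =>
    exact ⟨_, ((Ex.push .main (.bit false) _).le.seq ((ExLe.ite_false rfl
      (Ex.pop .cnt _).le).seq (Ex.push .main (.bit true) _).le)).mono (by omega)⟩

theorem collect_ex {γ : Type} [Coded γ] (r : Reg) (bs : List Bool) (g : γ) :
    ∃ r', ExLe Prog.collect (bs.length * 8 + 4)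
      ⟨r, (code g).enc, (bs.map .bit).reverse, [], [], [], []⟩
      ⟨r', (code (bs, g)).enc, [], [], [], [], []⟩ := by
  have h := drain_loop (k := .a) (body := Prog.emitBit) (T := 6) (sym := Sym.bit)
    (fun r l l' => ⟨r, (code l').enc ++ (code g).enc, l, [], [], [], []⟩) (fun _ _ _ => rfl)
    (fun x l l' => by
      obtain ⟨r', h⟩ := emitBit_ex x ((code l').enc ++ (code g).enc) l
      refine ⟨r', ?_⟩
      simpa [enc_list_cons] using h)
    (fun _ _ _ => Ex.pop .a _) bs.reverse r []
  simp only [List.append_nil, List.reverse_reverse, List.length_reverse, List.map_reverse] at h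
  exact ⟨none, ((Ex.push .main (.bit false) _).le.seq (h.seq
    (Ex.push .main (.bit true) _).le)).mono (by omega)⟩

theorem readBit_ex (x : Bool) (r : Reg) (m a : List Sym) : ∃ r', ExLe Prog.readBit 5
    ⟨r, (code x).enc ++ m, a, [], [], [], []⟩ ⟨r', m, .bit x :: a, [], [], [], []⟩ := by
  cases x with
  | true =>
    exact ⟨_, ((Ex.pop .main _).le.seq (ExLe.ite_true rfl ((Ex.pop .main _).le.seq
      ((Ex.pop .main _).le.seq (Ex.push .a (.bit true) _).le)))).mono (by omega)⟩
  | false =>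
    exact ⟨_, ((Ex.pop .main _).le.seq (ExLe.ite_false rfl
      (Ex.push .a (.bit false) _).le)).mono (by omega)⟩

theorem readBits_loop (m : List Sym) (l : List Bool) : ∀ a : List Sym,
    ExLe (.loop (fun r => decide (r = some (.bit true))) (.seq Prog.readBit (.pop .main)))
      (l.length * 7 + 1) ⟨((code l).enc ++ m).head?, ((code l).enc ++ m).tail, a, [], [], [], []⟩
      ⟨some (.bit false), m, (l.reverse.map .bit) ++ a, [], [], [], []⟩ := by
  induction l with
  | nil => intro a; exact (Ex.loop_false rfl).le.mono (by omega)
  | cons x l ih =>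
    intro a
    obtain ⟨r', h⟩ := readBit_ex x (some (.bit true)) ((code l).enc ++ m) a
    have h1 := ExLe.loop_true (c := fun r => decide (r = some (.bit true))) rfl
      (h.seq (Ex.pop .main _).le) (ih (.bit x :: a))
    have e1 : (code (x :: l)).enc ++ m = .bit true :: ((code x).enc ++ ((code l).enc ++ m)) := by
      simp [enc_list_cons]
    have e2 : (x :: l).reverse.map Sym.bit ++ a = l.reverse.map Sym.bit ++ (.bit x :: a) := by simp
    rw [e1, e2]
    refine h1.mono ?_
    rw [List.length_cons]
    omega

/-- A halted state with the given result. -/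
def Shows (s : State) (o : Option (List Bool)) : Prop :=
  match o with
  | none => s.reg ≠ some .mark
  | some l => s.reg = some .mark ∧ s.out = l.map .bit

/-- Acceptance is signalled through the register: a mark pushed on `cnt` and popped again ends up
there, whereas popping the empty `cnt` leaves `none`. -/
theorem write_ex (o : Option (List Bool)) (r : Reg) : ∃ s, Shows s o ∧
    ExLe Prog.write (len o * 10 + 10) ⟨r, (code o).enc, [], [], [], [], []⟩ s := by
  cases o with
  | none =>
    refine ⟨_, ?_, ((Ex.pop .main _).le.seq (ExLe.ite_false rfl (Ex.pop .cnt _).le)).mono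
      (by omega)⟩
    exact fun h => by cases h
  | some l =>
    have h1 := (Ex.pop .main ⟨some (.bit true), (code l).enc ++ [.bit false], [], [], [], [], []⟩).le.seq
      (readBits_loop [.bit false] l [])
    have h2 := drain_loop (k := .a) (body := .pushReg .out) (T := 1) (sym := Sym.bit)
      (fun r a l' => ⟨r, [.bit false], a, [], [], [], l'.map .bit⟩) (fun _ _ _ => rfl)
      (fun x l l' => ⟨_, (Ex.pushReg .out _).le⟩) (fun _ _ _ => Ex.pop .a _) l.reverse
      (some (.bit false)) []
    simp only [List.append_nil, List.reverse_reverse, List.length_reverse] at h1 h2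
    have h3 := (Ex.pop .main ⟨r, (code (some l)).enc, [], [], [], [], []⟩).le.seq
      (ExLe.ite_true (Q := .skip) (c := fun r => decide (r = some (.bit true))) rfl
        (h1.seq (h2.seq ((Ex.push .cnt .mark _).le.seq (Ex.pop .cnt _).le))))
    refine ⟨_, ?_, h3.mono ?_⟩
    · exact ⟨rfl, rfl⟩
    · have := length_le_len l
      rw [len_some]
      omega

/-! ### The sampling machine -/

/-- The random part `A` takes the same time for all outcomes. The time of the deterministic part `B`
may depend on the outcome, because halted configurations no longer change and absorb the
differences. -/
theorem runC_haltCode_seq {ι : Type} {A B : Prog} {tA TB T : ℕ} {s : State} {m : PMF ι}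
    {f g : ι → State} (hA : ExP A tA s (m.map f))
    (hB : ∀ i ∈ m.support, ExLe B TB (f i) (g i)) (hT : tA + TB + 1 ≤ T) :
    runC (Prog.seq A B).haltCode T (State.cfg (some (some (Sum.inl A.entry))) s)
      = m.map fun i => State.cfg none (g i) := by
  obtain ⟨R, rfl⟩ := Nat.exists_eq_add_of_le hT
  have h1 := hA _ (Prog.seq A B).haltCode (fun l => some (Sum.inl l)) (some (Sum.inr B.entry))
    (fun b l => rfl)
  rw [show tA + TB + 1 + R = tA + (TB + 1 + R) by ring, runC_add]
  rw [h1, PMF.map_comp, PMF.bind_map, PMF.map]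
  refine PMF.ext fun c => ?_
  rw [PMF.bind_apply, PMF.bind_apply]
  refine tsum_congr fun i => ?_
  by_cases hi : m i = 0
  · rw [hi, zero_mul, zero_mul]
  congr 1
  obtain ⟨t, ht, h2⟩ := hB i ((PMF.mem_support_iff m i).mpr hi)
  obtain ⟨R', hR'⟩ := Nat.exists_eq_add_of_le (show t + 1 ≤ TB + 1 + R by omega)
  have h3 := h2 _ (Prog.seq A B).haltCode (fun l => some (Sum.inr l)) none (fun b l => rfl)
  simp only [Function.comp_apply]
  rw [hR', runC_add, runC_add, h3, PMF.pure_map, PMF.pure_bind]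
  rw [runC_one _ _ (State.cfg none (g i)) fun b => rfl, PMF.pure_bind, runC_halted]

theorem ProbTM.outcomeLaw_of_run {Γin Γout : Type} (M : ProbTM Γin Γout) {ι : Type} {m : PMF ι}
    {h : ι → M.Cfg} {o : ι → Option (List Γout)} {x : List Γin} {T : ℕ}
    (hrun : M.run T (M.initCfg x) = m.map h) (hl : ∀ i, (h i).l = none)
    (ho : ∀ i, M.outcome (h i) = o i) :
    M.HaltsWithin x T ∧ M.outcomeLaw x T = m.map o := by
  constructor
  · intro c hc
    rw [hrun, PMF.mem_support_map_iff] at hc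
    obtain ⟨i, _, rfl⟩ := hc
    exact hl i
  · rw [ProbTM.outcomeLaw, hrun, PMF.map_comp]
    congr 1
    funext i
    exact ho i

theorem Prog.machine_initCfg (P : Prog) (x : List InSym) :
    P.machine.initCfg x
      = State.cfg (some (some P.entry)) ⟨none, [], [], [], [], x.map .inp, []⟩ := by
  have h : (Function.update (fun _ => []) Stk.inp (x.map Sym.inp) : Stk → List Sym)
      = (State.get ⟨none, [], [], [], [], x.map .inp, []⟩) := by
    funext k
    cases k <;> rfl
  unfold State.cfg
  rw [← h]
  rfl

theorem Prog.machine_outcome (P : Prog) {s : State} {o : Option (List Bool)} (h : Shows s o) :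
    P.machine.outcome (State.cfg none s) = o := by
  cases o with
  | none =>
    have h' : s.reg ≠ some .mark := h
    change (if decide (s.reg = some .mark) = true then _ else _) = _
    simp [h']
  | some l =>
    obtain ⟨h1, h2⟩ := h
    change (if decide (s.reg = some .mark) = true then
      some ((s.out).map fun s => decide (s = .bit true)) else _) = _
    simp [h1, h2, Function.comp_def]

theorem length_le_of_mem_coinList (k : ℕ) : ∀ bs ∈ (coinList k).support, bs.length = k := by
  induction k with
  | zero => simp [coinList]
  | succ k ih =>
    intro bs hbs
    simp only [coinList, PMF.mem_support_bind_iff, PMF.mem_support_map_iff] at hbs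
    obtain ⟨b, _, l, hl, rfl⟩ := hbs
    simp [ih l hl]

theorem len_boolList_le (l : List Bool) : len l ≤ 4 * l.length + 1 := by
  have := len_list_le (l := l) (B := 3) fun b _ => len_bool_le b
  omega

/-- A deterministic computation, a sequence of coin flips and a second deterministic computation
are performed by a machine that runs in polynomial time. -/
theorem exists_machine {γ : Type} [Coded γ] {F₁ : List InSym → List Unit × γ}
    {F₂ : List Bool × γ → Option (List Bool)} (h₁ : PT F₁) (h₂ : PT F₂) :
    ∃ (M : ProbTM InSym Bool) (p : Polynomial ℕ), ∀ x : List InSym,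
      M.HaltsWithin x (p.eval x.length) ∧
      M.outcomeLaw x (p.eval x.length) =
        (coinList (F₁ x).1.length).map fun bs => F₂ (bs, (F₁ x).2) := by
  obtain ⟨P, p, hP⟩ := h₁
  obtain ⟨Q, q, hQ⟩ := h₂
  set A : Prog := .seq (.seq .read P) .flip with hA
  set B : Prog := .seq (.seq .collect Q) .write with hB
  -- Input symbols have codes of length at most `12`, so a word of length `n` has a code of length
  -- at most `13 * n + 1`. `N` bounds the number of coins and the data kept for later; a list of `k`
  -- bits has code length at most `4 * k + 1`, which with the data and the pair symbol gives `5 * N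
  -- + 2`.
  set N : Polynomial ℕ := p.comp (Polynomial.C 13 * Polynomial.X + 1) with hN
  set R : Polynomial ℕ := q.comp (Polynomial.C 5 * N + Polynomial.C 2) with hR
  refine ⟨(Prog.seq A B).machine, (Polynomial.X * Polynomial.C 30 + Polynomial.C 10) + N +
    (Polynomial.C 5 * N + Polynomial.C 3) + ((N * Polynomial.C 8 + Polynomial.C 4) + R +
    (R * Polynomial.C 10 + Polynomial.C 10)) + 1, fun x => ?_⟩
  simp only [Polynomial.eval_add, Polynomial.eval_mul, Polynomial.eval_C, Polynomial.eval_X,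
    Polynomial.eval_one]
  set n := x.length with hn
  have hx : len x ≤ 13 * n + 1 := by
    have := len_list_le (l := x) (B := 12) fun s _ => len_inSym_le s
    omega
  have hp : p.eval (len x) ≤ N.eval n := by
    rw [hN, Polynomial.eval_comp]
    refine eval_mono p ?_
    simpa using hx
  obtain ⟨hW, hlen⟩ := hP x
  set k := (F₁ x).1.length with hk
  set g := (F₁ x).2 with hg
  have hlen' : len (F₁ x).1 + len g + 1 ≤ N.eval n := hlen.trans hp
  have hkN : k ≤ N.eval n := by
    have := length_le_len (F₁ x).1
    omega
  obtain ⟨r1, h1⟩ := hW.exLe none [] [] [] [] []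
  simp only [List.append_nil] at h1
  obtain ⟨tA, htA, hExA⟩ := (read_ex x).seq h1
  have hA' : ExP A (tA + (5 * k + 3)) ⟨none, [], [], [], [], x.map .inp, []⟩
      ((coinList k).map fun bs =>
        ⟨some (.bit false), (code g).enc, (bs.map .bit).reverse, [], [], [], []⟩) :=
    hExA.seqP (flip_ex r1 (F₁ x).1 g)
  have hB' : ∀ bs : List Bool, ∃ s, Shows s (F₂ (bs, g)) ∧ (bs.length = k →
      ExLe B ((N.eval n * 8 + 4) + R.eval n + (R.eval n * 10 + 10))
        ⟨some (.bit false), (code g).enc, (bs.map .bit).reverse, [], [], [], []⟩ s) := by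
    intro bs
    obtain ⟨r2, h2⟩ := collect_ex (some (.bit false)) bs g
    obtain ⟨hW2, hlen2⟩ := hQ (bs, g)
    obtain ⟨r3, h3⟩ := hW2.exLe r2 [] [] [] [] []
    obtain ⟨s, hs, h4⟩ := write_ex (F₂ (bs, g)) r3
    simp only [List.append_nil] at h3
    refine ⟨s, hs, fun hbs => ((h2.seq h3).seq h4).mono ?_⟩
    have h5 : q.eval (len (bs, g)) ≤ R.eval n := by
      rw [hR, Polynomial.eval_comp]
      refine eval_mono q ?_
      have := len_boolList_le bs
      rw [len_pair]
      simp only [Polynomial.eval_add, Polynomial.eval_mul, Polynomial.eval_C]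
      omega
    omega
  choose g' hg' hB' using hB'
  set TB := (N.eval n * 8 + 4) + R.eval n + (R.eval n * 10 + 10) with hTB
  have key : ∀ T, tA + (5 * k + 3) + TB + 1 ≤ T →
      runC (Prog.seq A B).haltCode T (State.cfg (some (some (Sum.inl A.entry)))
        ⟨none, [], [], [], [], x.map .inp, []⟩)
      = (coinList k).map fun bs => State.cfg none (g' bs) := fun T hT =>
    runC_haltCode_seq hA' (fun bs hbs => hB' bs (length_le_of_mem_coinList k bs hbs)) hT
  have hrun := key (n * 30 + 10 + N.eval n + (5 * N.eval n + 3) + TB + 1) (by omega)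
  refine ProbTM.outcomeLaw_of_run (Prog.seq A B).machine
    (h := fun bs => (State.cfg none (g' bs) : (Prog.seq A B).machine.Cfg)) ?_ (fun _ => rfl)
    fun bs => Prog.machine_outcome _ (hg' bs)
  rw [Prog.machine_initCfg]
  exact (mach_run _ _ _ _).trans hrun

end StackProg
namespace StackProg

/-! ### The sampling algorithm -/

/-- Everything that is computed before coins are flipped: the number of coins in unary, the
vertices, and an expression for the sum of all cycles. -/
def prepare (x : List InSym) : List Unit × (List ℕ × Expr) :=
  ((eliminate (parse x)).2.num.bits.map fun _ => (), (vertsOf (parse x), (eliminate (parse x)).2))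

/-- The answer, computed from the coins. -/
def answer (p : List Bool × (List ℕ × Expr)) : Option (List Bool) :=
  bif ltB (bitsVal p.1) p.2.2.num then some (outMatrix p.2.1 (sample p.2.2 (bitsVal p.1)))
  else none

theorem PT.prepare : PT prepare := by
  have h1 : PT fun x => StackProg.parse x := PT.parse PT.id
  have h2 : PT fun x => StackProg.eliminate (StackProg.parse x) := PT.eliminate h1
  have h3 : PT fun x => (StackProg.eliminate (StackProg.parse x)).2 := h2.snd
  have h4 : PT fun x => (StackProg.eliminate (StackProg.parse x)).2.num.bits := (h3.num).bits
  have h5 : PT fun x => (StackProg.eliminate (StackProg.parse x)).2.num.bits.map fun _ => () :=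
    PT.map (f := fun _ _ => ()) h4 (PT.const ())
  exact (h5.prodMk ((PT.vertsOf h1).prodMk h3)).congr fun _ => rfl

theorem PT.answer : PT answer := by
  have h : PT fun p : List Bool × (List ℕ × Expr) =>
      bif StackProg.ltB (StackProg.bitsVal p.1) p.2.2.num then
        Option.some (StackProg.outMatrix p.2.1 (StackProg.sample p.2.2 (StackProg.bitsVal p.1)))
      else none := by
    have h' : PT fun _ : List Bool × (List ℕ × Expr) => (none : Option (List Bool)) := PT.const none
    fun_prop
  exact h.congr fun _ => rfl

/-- The sampling algorithm is performed by a machine that runs in polynomial time. -/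
theorem exists_sampler : ∃ (M : ProbTM InSym Bool) (p : Polynomial ℕ), ∀ x : List InSym,
    M.HaltsWithin x (p.eval x.length) ∧
    M.outcomeLaw x (p.eval x.length) = (coinList (eliminate (parse x)).2.num.size).map fun bs =>
      answer (bs, (vertsOf (parse x), (eliminate (parse x)).2)) := by
  obtain ⟨M, p, h⟩ := exists_machine PT.prepare PT.answer
  refine ⟨M, p, fun x => ?_⟩
  have hx : (prepare x).1.length = (eliminate (parse x)).2.num.size := by
    simp [prepare, Nat.size_eq_bits_len]
  rw [← hx]
  exact h x

end StackProg
namespace StackProg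

/-! ### The law of the sampled leaves -/

/-- Formal sums of multisets of leaves. -/
abbrev Poly := AddMonoidAlgebra ℕ (Multiset Leaf)

/-- The formal sum of the multisets of leaves described by an expression. -/
noncomputable def Expr.poly : Expr → Poly
  | leaf e => AddMonoidAlgebra.single {e} 1
  | ser x y => x.poly * y.poly
  | par x y => x.poly + y.poly

/-- The weight of a leaf. -/
def leafWeight (e : Leaf) : ℚ≥0 := e.2.1 / leafDen e

/-- The weighted sum of a function on multisets of leaves. -/
noncomputable def weighted (g : Multiset Leaf → ℚ≥0) : Poly →+ ℚ≥0 :=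
  AddMonoidAlgebra.liftNC (Nat.castAddMonoidHom ℚ≥0) fun D =>
    g D.toAdd * (D.toAdd.map leafWeight).prod

theorem weighted_single (g : Multiset Leaf → ℚ≥0) (D : Multiset Leaf) :
    weighted g (AddMonoidAlgebra.single D 1) = g D * (D.map leafWeight).prod := by
  rw [weighted, AddMonoidAlgebra.liftNC_single]
  simp

theorem leafDen_pos (e : Leaf) : 0 < leafDen e := by
  unfold leafDen eqB
  rcases Nat.eq_zero_or_pos e.2.2 with h | h
  · simp [h]
  · simp [h.ne', h]

/-- The leaves that result from a state of the sampling process. -/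
def finish (l : List Unit) (st : SampleState) : List Leaf :=
  (l.foldl (fun st _ => sampleStep st) st).1.2

theorem prodLeafNum_eq (l : List Leaf) : (prodLeafNum l : ℚ≥0) =
    ((l.map leafDen).prod : ℕ) * ((l : Multiset Leaf).map leafWeight).prod := by
  induction l with
  | nil => simp [prodLeafNum]
  | cons e l ih =>
    have h : (leafDen e : ℚ≥0) ≠ 0 := by exact_mod_cast (leafDen_pos e).ne'
    have h1 : prodLeafNum (e :: l) = e.2.1 * prodLeafNum l := rfl
    rw [h1, Nat.cast_mul, ih]
    simp only [List.map_cons, List.prod_cons, Multiset.map_coe, Multiset.prod_coe, leafWeight,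
      Nat.cast_mul]
    field_simp

/-- Counting the random numbers that lead to a given result. -/
theorem sum_finish (g : Multiset Leaf → ℚ≥0) (l : List Unit) :
    ∀ (todo : List Expr) (found : List Leaf) (s : ℕ),
    (todo.map fun x => x.clk.length).sum ≤ l.length →
    ∑ r ∈ Finset.range (s * prodNum todo * prodLeafNum found),
        g (finish l ((todo, found), (r, s)) : Multiset Leaf) =
      (s * (todo.map Expr.den).prod * (found.map leafDen).prod : ℕ) *
        weighted g ((todo.map Expr.poly).prod * AddMonoidAlgebra.single (found : Multiset Leaf) 1)
    := by
  -- With nothing left to expand, every random number yields `found`, so the number of terms is all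
  -- that counts.
  have base : ∀ (l : List Unit) (found : List Leaf) (s : ℕ),
      ∑ r ∈ Finset.range (s * prodNum [] * prodLeafNum found),
        g (finish l (([], found), (r, s)) : Multiset Leaf) =
      (s * (([] : List Expr).map Expr.den).prod * (found.map leafDen).prod : ℕ) *
        weighted g ((([] : List Expr).map Expr.poly).prod *
          AddMonoidAlgebra.single (found : Multiset Leaf) 1) := by
    intro l found s
    have h1 : ∀ r, finish l (([], found), (r, s)) = found := fun r => by
      induction l with
      | nil => rfl
      | cons u l ih => exact ih
    have h2 : prodNum [] = 1 := rfl
    simp only [h1, Finset.sum_const, Finset.card_range, nsmul_eq_mul, List.map_nil,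
      List.prod_nil, one_mul, weighted_single, h2, mul_one]
    rw [Nat.cast_mul, prodLeafNum_eq, Nat.cast_mul]
    ring
  induction l with
  | nil =>
    intro todo found s h
    cases todo with
    | nil => exact base [] found s
    | cons x todo =>
      exfalso
      cases x <;> simp [Expr.clk] at h
  | cons u l ih =>
    intro todo found s h
    cases todo with
    | nil => exact base _ found s
    | cons x rest =>
      have hp : ∀ y, prodNum (y :: rest) = y.num * prodNum rest := fun y => rfl
      cases x with
      | leaf e =>
        -- The numerator of the leaf moves from `prodNum` to `prodLeafNum`, so the range of the
        -- random number stays the same.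
        have h1 := ih rest (e :: found) s (by simp [Expr.clk] at h; omega)
        have h2 : ∀ r, finish (u :: l) ((.leaf e :: rest, found), (r, s)) =
            finish l ((rest, e :: found), (r, s)) := fun r => rfl
        have h3 : prodLeafNum (e :: found) = e.2.1 * prodLeafNum found := rfl
        have h4 : (AddMonoidAlgebra.single (((e :: found : List Leaf)) : Multiset Leaf) 1 : Poly) =
            (Expr.leaf e).poly * AddMonoidAlgebra.single (found : Multiset Leaf) 1 := by
          rw [Expr.poly, AddMonoidAlgebra.single_mul_single, Multiset.singleton_add,
            Multiset.cons_coe, mul_one]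
        have h5 : (Expr.leaf e).num = e.2.1 := rfl
        simp only [h2, hp, h5]
        rw [h3, h4] at h1
        rw [show s * (e.2.1 * prodNum rest) * prodLeafNum found =
          s * prodNum rest * (e.2.1 * prodLeafNum found) by ring, h1]
        simp only [List.map_cons, List.prod_cons, Expr.den_leaf]
        congr 2
        · ring
        · ring
      | ser y z =>
        have h1 := ih (y :: z :: rest) found s (by simp [Expr.clk] at h ⊢; omega)
        have h2 : ∀ r, finish (u :: l) ((.ser y z :: rest, found), (r, s)) =
            finish l ((y :: z :: rest, found), (r, s)) := fun r => rfl
        have h3 : prodNum (y :: z :: rest) = y.num * (z.num * prodNum rest) := rfl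
        have h5 : (Expr.ser y z).num = y.num * z.num := rfl
        simp only [h2, hp, h5]
        rw [h3] at h1
        rw [show s * (y.num * z.num * prodNum rest) = s * (y.num * (z.num * prodNum rest)) by ring,
          h1]
        simp only [List.map_cons, List.prod_cons, Expr.den_ser, Expr.poly, mul_assoc]
      | par y z =>
        have h1 := ih (y :: rest) found (s * z.den) (by simp [Expr.clk] at h ⊢; omega)
        have h2 := ih (z :: rest) found (s * y.den) (by simp [Expr.clk] at h ⊢; omega)
        have h3 : (Expr.par y z).num = y.num * z.den + z.num * y.den := rfl
        -- The range is cut into an initial segment for `y` and a final one for `z`.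
        -- Cross-multiplication of the denominators appears as the factors `z.den` and `y.den` of
        -- the new scales, and the final segment is shifted back to `0`.
        have h4 : s * prodNum (.par y z :: rest) * prodLeafNum found =
            s * z.den * prodNum (y :: rest) * prodLeafNum found +
            s * y.den * prodNum (z :: rest) * prodLeafNum found := by
          rw [hp, hp, hp, h3]
          ring
        have h5 : y.num * z.den * (s * prodNum rest * prodLeafNum found) =
            s * z.den * prodNum (y :: rest) * prodLeafNum found := by
          rw [hp]
          ring
        have h6 : ∀ r, finish (u :: l) ((.par y z :: rest, found), (r, s)) =
            finish l (choosePart y z rest ((.par y z :: rest, found), (r, s))) := fun r => rfl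
        have h7 : ∀ r < s * z.den * prodNum (y :: rest) * prodLeafNum found,
            finish (u :: l) ((.par y z :: rest, found), (r, s)) =
            finish l ((y :: rest, found), (r, s * z.den)) := fun r hr => by
          rw [h6, choosePart, h5, ltB, decide_eq_true hr, cond_true]
        have h8 : ∀ r, finish (u :: l) ((.par y z :: rest, found),
            (s * z.den * prodNum (y :: rest) * prodLeafNum found + r, s)) =
            finish l ((z :: rest, found), (r, s * y.den)) := fun r => by
          rw [h6, choosePart, h5, ltB, decide_eq_false (by simp), cond_false, Nat.add_sub_cancel_left]
        have h9 := Finset.sum_congr rfl fun r (hr : r ∈ Finset.range _) =>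
          congrArg (fun D : List Leaf => g D) (h7 r (Finset.mem_range.mp hr))
        rw [h4, Finset.sum_range_add, h9]
        simp only [h8]
        rw [h1, h2]
        simp only [List.map_cons, List.prod_cons, Expr.den_par, Expr.poly, add_mul, map_add]
        push_cast
        ring

/-- With `g = 1` this identifies `num / den` as the total weight; with `g` an indicator function it
counts the random numbers that lead to a given result. -/
theorem sum_sample (g : Multiset Leaf → ℚ≥0) (x : Expr) :
    ∑ r ∈ Finset.range x.num, g (sample x r : Multiset Leaf) = x.den * weighted g x.poly := by
  have h := sum_finish g x.clk [x] [] 1 (by simp)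
  have h1 : 1 * prodNum [x] * prodLeafNum [] = x.num := by simp [prodNum, prodLeafNum]
  have h2 : (AddMonoidAlgebra.single ((([] : List Leaf)) : Multiset Leaf) 1 : Poly) = 1 := rfl
  rw [h1, h2] at h
  rw [List.map_singleton, List.prod_singleton, List.map_singleton, List.prod_singleton, mul_one,
    List.map_nil, List.prod_nil, mul_one, one_mul] at h
  exact h

end StackProg

/-! ### Simple cycles and paths -/

section CycleSums

open SimpleGraph

variable {V : Type} [Fintype V] [DecidableEq V]

theorem mem_simpleCycles {G : SimpleGraph V} {C : Finset (Sym2 V)} :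
    C ∈ simpleCycles G ↔ ∃ (v : V) (p : G.Walk v v), p.IsCycle ∧ p.edges.toFinset = C := by
  simp [simpleCycles]

/-- This allows all sums to run over the cycles of the complete graph, with weight zero off `G`,
while the graph changes during elimination. -/
theorem mem_simpleCycles_iff_top {G : SimpleGraph V} {C : Finset (Sym2 V)} :
    C ∈ simpleCycles G ↔ C ∈ simpleCycles (⊤ : SimpleGraph V) ∧ ∀ e ∈ C, e ∈ G.edgeSet := by
  rw [mem_simpleCycles, mem_simpleCycles]
  constructor
  · rintro ⟨v, p, hp, rfl⟩
    refine ⟨⟨v, p.mapLe le_top, hp.mapLe le_top, by simp⟩, fun e he => ?_⟩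
    exact p.edges_subset_edgeSet (List.mem_toFinset.mp he)
  · rintro ⟨⟨v, p, hp, rfl⟩, h⟩
    have h' : ∀ e ∈ p.edges, e ∈ G.edgeSet := fun e he => h e (List.mem_toFinset.mpr he)
    exact ⟨v, p.transfer G h', hp.transfer h', by rw [Walk.edges_transfer]⟩

theorem ne_empty_of_mem_simpleCycles {G : SimpleGraph V} {C : Finset (Sym2 V)}
    (h : C ∈ simpleCycles G) : C.Nonempty := by
  obtain ⟨v, p, hp, rfl⟩ := mem_simpleCycles.mp h
  cases p with
  | nil => exact absurd hp Walk.not_isCycle_nil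
  | cons h p => exact ⟨_, List.mem_toFinset.mpr List.mem_cons_self⟩

open Classical in
/-- The edge sets of the paths from `a` to `b` in the complete graph that avoid `v`. -/
noncomputable def pathEdges (v a b : V) : Finset (Finset (Sym2 V)) :=
  Finset.univ.filter fun S => ∃ p : (⊤ : SimpleGraph V).Walk a b,
    p.IsPath ∧ v ∉ p.support ∧ p.edges.toFinset = S

theorem mem_pathEdges {v a b : V} {S : Finset (Sym2 V)} : S ∈ pathEdges v a b ↔
    ∃ p : (⊤ : SimpleGraph V).Walk a b, p.IsPath ∧ v ∉ p.support ∧ p.edges.toFinset = S := by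
  simp [pathEdges]

theorem pathEdges_comm (v a b : V) : pathEdges v a b = pathEdges v b a := by
  have h : ∀ a b : V, pathEdges v a b ⊆ pathEdges v b a := by
    intro a b S hS
    obtain ⟨p, hp, hv, rfl⟩ := mem_pathEdges.mp hS
    exact mem_pathEdges.mpr ⟨p.reverse, hp.reverse, by simpa using hv, by simp⟩
  exact (h a b).antisymm (h b a)

theorem notMem_of_mem_pathEdges {v a b : V} {S : Finset (Sym2 V)} (hS : S ∈ pathEdges v a b)
    {e : Sym2 V} (he : e ∈ S) : v ∉ e := by
  obtain ⟨p, hp, hv, rfl⟩ := mem_pathEdges.mp hS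
  intro h
  obtain ⟨x, rfl⟩ := Sym2.mem_iff_exists.mp h
  exact hv (p.fst_mem_support_of_mem_edges (List.mem_toFinset.mp he))

/-- A cycle through `v` consists of two edges at `v` and a path that avoids `v`. -/
theorem exists_pathEdges_of_mem {C : Finset (Sym2 V)} (hC : C ∈ simpleCycles (⊤ : SimpleGraph V))
    {v : V} {e : Sym2 V} (he : e ∈ C) (hv : v ∈ e) : ∃ y z, y ≠ z ∧ y ≠ v ∧ z ≠ v ∧
      ∃ S ∈ pathEdges v y z, C = insert s(v, y) (insert s(v, z) S) := by
  obtain ⟨u, c, hc, rfl⟩ := mem_simpleCycles.mp hC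
  have hvc : v ∈ c.support := by
    obtain ⟨x, rfl⟩ := Sym2.mem_iff_exists.mp hv
    exact c.fst_mem_support_of_mem_edges (List.mem_toFinset.mp he)
  have hc' := hc.rotate hvc
  have hE : (c.rotate v hvc).edges.toFinset = c.edges.toFinset :=
    List.toFinset_eq_of_perm _ _ (c.rotate_edges v hvc).perm
  rw [← hE]
  generalize c.rotate v hvc = d at hc'
  cases d with
  | nil => exact absurd hc' Walk.not_isCycle_nil
  | @cons _ y _ h p =>
    rw [Walk.cons_isCycle_iff] at hc'
    obtain ⟨hp, hvy⟩ := hc'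
    -- The cycle has been rotated to start at `v`, and its first edge leads to `y`. Reversing the
    -- remainder exposes its last edge, between `v` and `z`; `y = z` would repeat an edge.
    obtain ⟨q, hq⟩ : ∃ q, p.reverse = q := ⟨_, rfl⟩
    have hqp : q.IsPath := hq ▸ hp.reverse
    have hqe : p.edges.toFinset = q.edges.toFinset := by rw [← hq]; simp
    have hvy' : s(v, y) ∉ q.edges := by rw [← hq]; simpa using hvy
    cases q with
    | nil => exact absurd rfl h.ne
    | @cons _ z _ h' q =>
      rw [Walk.cons_isPath_iff] at hqp
      refine ⟨y, z, ?_, h.ne.symm, h'.ne.symm, q.edges.toFinset, ?_, ?_⟩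
      · rintro rfl
        simp at hvy'
      · rw [pathEdges_comm]
        exact mem_pathEdges.mpr ⟨q, hqp.1, hqp.2, rfl⟩
      · simp only [Walk.edges_cons, List.toFinset_cons] at hqe ⊢
        rw [hqe]

theorem insert_mem_simpleCycles {a b v : V} (hab : a ≠ b) (ha : a ≠ v) (hb : b ≠ v)
    {S : Finset (Sym2 V)} (hS : S ∈ pathEdges v a b) :
    insert s(v, a) (insert s(v, b) S) ∈ simpleCycles (⊤ : SimpleGraph V) := by
  obtain ⟨p, hp, hv, rfl⟩ := mem_pathEdges.mp hS
  have h1 : (⊤ : SimpleGraph V).Adj v a := ha.symm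
  have h2 : (⊤ : SimpleGraph V).Adj b v := hb
  refine mem_simpleCycles.mpr ⟨v, Walk.cons h1 (p.concat h2), ?_, ?_⟩
  · rw [Walk.cons_isCycle_iff]
    refine ⟨hp.concat hv h2, ?_⟩
    rw [Walk.edges_concat, List.concat_eq_append, List.mem_append, List.mem_singleton]
    rintro (h | h)
    · exact hv (p.fst_mem_support_of_mem_edges h)
    · rw [Sym2.eq_swap, Sym2.congr_left] at h
      exact hab h
  · ext e
    simp [Walk.edges_concat, Sym2.eq_swap (a := b)]

/-- A path from `a` that contains the edge from `a` to `b` must use it as its first edge; having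
reached its end `b`, it cannot continue. -/
theorem eq_singleton_of_mem_pathEdges {a b v : V} {S : Finset (Sym2 V)}
    (hS : S ∈ pathEdges v a b) (h : s(a, b) ∈ S) : S = {s(a, b)} := by
  obtain ⟨p, hp, hv, rfl⟩ := mem_pathEdges.mp hS
  have h' := List.mem_toFinset.mp h
  cases p with
  | nil => simp at h'
  | cons h1 q =>
    have h2 := hp.eq_snd_of_mem_edges h'
    simp only [Walk.snd_cons] at h2
    subst h2
    have h3 := (Walk.cons_isPath_iff _ _).mp hp
    rw [Walk.isPath_iff_nil] at h3
    rw [h3.1.eq_nil]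
    simp

theorem singleton_mem_pathEdges {a b v : V} (hab : a ≠ b) (ha : a ≠ v) (hb : b ≠ v) :
    {s(a, b)} ∈ pathEdges v a b := by
  have h : (⊤ : SimpleGraph V).Adj a b := hab
  refine mem_pathEdges.mpr ⟨h.toWalk, Walk.IsPath.of_adj h, ?_, ?_⟩
  · simp [ha.symm, hb.symm]
  · simp

/-- The cycle is decomposed at `a`: one of the two edges there is the given one, and the other one
followed by the remaining path leads from `a` to `b`. -/
theorem exists_pathEdges_of_avoids {C : Finset (Sym2 V)}
    (hC : C ∈ simpleCycles (⊤ : SimpleGraph V)) {a b v : V} (hv : ∀ e ∈ C, v ∉ e)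
    (hab : s(a, b) ∈ C) : ∃ S ∈ pathEdges v a b, s(a, b) ∉ S ∧ C = insert s(a, b) S := by
  have ha : a ≠ v := by
    rintro rfl
    exact hv _ hab (Sym2.mem_mk_left _ _)
  have key : ∀ z, b ≠ z → z ≠ a → ∀ S ∈ pathEdges a b z, C = insert s(a, b) (insert s(a, z) S) →
      ∃ S ∈ pathEdges v a b, s(a, b) ∉ S ∧ C = insert s(a, b) S := by
    intro z hbz hza S hS hCS
    rw [pathEdges_comm] at hS
    refine ⟨insert s(a, z) S, ?_, ?_, hCS⟩
    · obtain ⟨q, hq, haq, rfl⟩ := mem_pathEdges.mp hS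
      have h : (⊤ : SimpleGraph V).Adj a z := hza.symm
      refine mem_pathEdges.mpr ⟨Walk.cons h q, hq.cons haq, ?_, by simp⟩
      rw [Walk.support_cons, List.mem_cons]
      rintro (h | h)
      · exact ha h.symm
      · have hva : ∃ e ∈ q.edges, v ∈ e := by
          have hnil : ¬ q.Nil := fun hn => hbz hn.eq.symm
          exact (Walk.mem_support_iff_exists_mem_edges_of_not_nil hnil).mp h
        obtain ⟨e, he, hve⟩ := hva
        exact hv e (hCS ▸ by simp [he]) hve
    · rw [Finset.mem_insert]
      rintro (h | h)
      · exact hbz (Sym2.congr_right.mp h)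
      · exact notMem_of_mem_pathEdges hS h (Sym2.mem_mk_left _ _)
  obtain ⟨y, z, hyz, hya, hza, S, hS, hCS⟩ := exists_pathEdges_of_mem hC hab (Sym2.mem_mk_left a b)
  rw [hCS, Finset.mem_insert, Finset.mem_insert] at hab
  rcases hab with h | h | h
  · have : b = y := Sym2.congr_right.mp h
    subst this
    exact key z hyz hza S hS hCS
  · have : b = z := Sym2.congr_right.mp h
    subst this
    exact key y hyz.symm hya S (by rwa [pathEdges_comm]) (by rw [hCS, Finset.insert_comm])
  · exact absurd (Sym2.mem_mk_left _ _) (notMem_of_mem_pathEdges hS h)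

/-- The condition `s(a, b) ∉ S` excludes the degenerate closed walk that goes along one edge and
back. -/
theorem insert_mem_simpleCycles_of_avoids {a b v : V} (hab : a ≠ b) {S : Finset (Sym2 V)}
    (hS : S ∈ pathEdges v a b) (h : s(a, b) ∉ S) :
    insert s(a, b) S ∈ simpleCycles (⊤ : SimpleGraph V) := by
  obtain ⟨p, hp, hv, rfl⟩ := mem_pathEdges.mp hS
  have h1 : (⊤ : SimpleGraph V).Adj b a := hab.symm
  refine mem_simpleCycles.mpr ⟨b, Walk.cons h1 p, ?_, ?_⟩
  · rw [Walk.cons_isCycle_iff]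
    exact ⟨hp, by rw [Sym2.eq_swap]; simpa using h⟩
  · simp [Sym2.eq_swap (a := b)]

end CycleSums

/-! ### Sums over cycles and elimination of a vertex -/

section CycleSums

open SimpleGraph

variable {V : Type} [Fintype V] [DecidableEq V] {R : Type} [CommSemiring R]

/-- The sum over all cycles of the products of the weights of the edges. -/
noncomputable def cycleSum (w : Sym2 V → R) : R :=
  ∑ C ∈ simpleCycles (⊤ : SimpleGraph V), ∏ e ∈ C, w e

theorem cycleSum_eq (G : SimpleGraph V) (w : Sym2 V → R) (h : ∀ e ∉ G.edgeSet, w e = 0) :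
    cycleSum w = ∑ C ∈ simpleCycles G, ∏ e ∈ C, w e := by
  refine (Finset.sum_subset (fun C hC => (mem_simpleCycles_iff_top.mp hC).1) fun C hC hG => ?_).symm
  have : ∃ e ∈ C, e ∉ G.edgeSet := by
    by_contra! hcon
    exact hG (mem_simpleCycles_iff_top.mpr ⟨hC, hcon⟩)
  obtain ⟨e, he, heG⟩ := this
  exact Finset.prod_eq_zero he (h e heG)

theorem cycleSum_zero : cycleSum (fun _ : Sym2 V => (0 : R)) = 0 :=
  Finset.sum_eq_zero fun _ hC =>
    let ⟨_, he⟩ := ne_empty_of_mem_simpleCycles hC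
    Finset.prod_eq_zero he rfl

/-- Weights after a vertex is deleted. -/
def deleteWeight (v : V) (w : Sym2 V → R) (e : Sym2 V) : R := if v ∈ e then 0 else w e

/-- Weights after the path from `a` over `v` to `b` is replaced by an edge. -/
def contractWeight (v a b : V) (w : Sym2 V → R) (e : Sym2 V) : R :=
  if v ∈ e then 0 else if e = s(a, b) then w e + w s(v, a) * w s(v, b) else w e

/-- Under `deleteWeight v w` cycles through `v` contribute zero, and all others keep their weight.
-/
theorem cycleSum_split (v : V) (w : Sym2 V → R) : cycleSum w =
    cycleSum (deleteWeight v w) +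
      ∑ C ∈ simpleCycles (⊤ : SimpleGraph V) with ∃ e ∈ C, v ∈ e, ∏ e ∈ C, w e := by
  unfold cycleSum
  rw [← Finset.sum_filter_add_sum_filter_not _ (fun C => ∃ e ∈ C, v ∈ e), add_comm,
    ← Finset.sum_filter_add_sum_filter_not (simpleCycles ⊤) (fun C => ∃ e ∈ C, v ∈ e)
      (fun C => ∏ e ∈ C, deleteWeight v w e)]
  congr 1
  rw [Finset.sum_eq_zero (s := {C ∈ simpleCycles ⊤ | ∃ e ∈ C, v ∈ e}), zero_add]
  · refine Finset.sum_congr rfl fun C hC => Finset.prod_congr rfl fun e he => ?_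
    have h := (Finset.mem_filter.mp hC).2
    rw [deleteWeight, if_neg fun hv => h ⟨e, he, hv⟩]
  · intro C hC
    obtain ⟨e, he, hv⟩ := (Finset.mem_filter.mp hC).2
    exact Finset.prod_eq_zero he (if_pos hv)

/-- Deleting a vertex with at most one neighbour does not change the sum over cycles. -/
theorem cycleSum_delete {v a : V} {w : Sym2 V → R} (h : ∀ x, x ≠ a → w s(v, x) = 0) :
    cycleSum w = cycleSum (deleteWeight v w) := by
  rw [cycleSum_split v w, Finset.sum_eq_zero, add_zero]
  intro C hC
  obtain ⟨hC, e, he, hv⟩ := Finset.mem_filter.mp hC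
  obtain ⟨y, z, hyz, -, -, S, -, rfl⟩ := exists_pathEdges_of_mem hC he hv
  -- The cycle uses two distinct neighbours of `v`, and one of them is not `a`.
  by_cases hy : y = a
  · exact Finset.prod_eq_zero (i := s(v, z)) (by simp) (h z fun hz => hyz (hy.trans hz.symm))
  · exact Finset.prod_eq_zero (i := s(v, y)) (by simp) (h y hy)

theorem filter_insert_pathEdges {v a b : V} {S : Finset (Sym2 V)} (hS : S ∈ pathEdges v a b) :
    (insert s(v, a) (insert s(v, b) S)).filter (fun e => v ∉ e) = S := by
  ext e
  simp only [Finset.mem_filter, Finset.mem_insert]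
  constructor
  · rintro ⟨rfl | rfl | h, hv⟩
    · exact absurd (Sym2.mem_mk_left _ _) hv
    · exact absurd (Sym2.mem_mk_left _ _) hv
    · exact h
  · exact fun h => ⟨Or.inr (Or.inr h), notMem_of_mem_pathEdges hS h⟩

/-- Adding the two edges at `v` maps paths bijectively onto the cycles that pass `v` via `a` and
`b`; removing all edges at `v` is the inverse. Cycles that use another vertex next to `v` have
weight zero by `h`. -/
theorem sum_cycles_through {v a b : V} (hab : a ≠ b) (ha : a ≠ v) (hb : b ≠ v) {w : Sym2 V → R}
    (h : ∀ x, x ≠ a → x ≠ b → w s(v, x) = 0) :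
    ∑ C ∈ simpleCycles (⊤ : SimpleGraph V) with ∃ e ∈ C, v ∈ e, ∏ e ∈ C, w e =
      w s(v, a) * w s(v, b) * ∑ S ∈ pathEdges v a b, ∏ e ∈ S, w e := by
  have hinj : Set.InjOn (fun S => insert s(v, a) (insert s(v, b) S))
      (pathEdges v a b : Set (Finset (Sym2 V))) := by
    intro S hS S' hS' hSS
    have := congrArg (Finset.filter fun e => v ∉ e) hSS
    rwa [filter_insert_pathEdges hS, filter_insert_pathEdges hS'] at this
  have hprod : ∀ S ∈ pathEdges v a b, ∏ e ∈ insert s(v, a) (insert s(v, b) S), w e =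
      w s(v, a) * w s(v, b) * ∏ e ∈ S, w e := by
    intro S hS
    rw [Finset.prod_insert, Finset.prod_insert, mul_assoc]
    · exact fun h => notMem_of_mem_pathEdges hS h (Sym2.mem_mk_left _ _)
    · rw [Finset.mem_insert]
      rintro (h | h)
      · exact hab (Sym2.congr_right.mp h)
      · exact notMem_of_mem_pathEdges hS h (Sym2.mem_mk_left _ _)
  rw [Finset.mul_sum, ← Finset.sum_congr rfl hprod,
    ← Finset.sum_image (f := fun C => ∏ e ∈ C, w e) hinj]
  refine (Finset.sum_subset ?_ ?_).symm
  · intro C hC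
    obtain ⟨S, hS, rfl⟩ := Finset.mem_image.mp hC
    exact Finset.mem_filter.mpr ⟨insert_mem_simpleCycles hab ha hb hS, s(v, a), by simp, by simp⟩
  · intro C hC hC'
    obtain ⟨hC, e, he, hv⟩ := Finset.mem_filter.mp hC
    obtain ⟨y, z, hyz, -, -, S, hS, rfl⟩ := exists_pathEdges_of_mem hC he hv
    by_cases hy : y ≠ a ∧ y ≠ b
    · exact Finset.prod_eq_zero (i := s(v, y)) (by simp) (h y hy.1 hy.2)
    by_cases hz : z ≠ a ∧ z ≠ b
    · exact Finset.prod_eq_zero (i := s(v, z)) (by simp) (h z hz.1 hz.2)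
    exfalso
    apply hC'
    rw [Finset.mem_image]
    have hcases : (y = a ∧ z = b) ∨ (y = b ∧ z = a) := by
      rw [not_and_or, not_not, not_not] at hy hz
      grind
    rcases hcases with ⟨rfl, rfl⟩ | ⟨rfl, rfl⟩
    · exact ⟨S, hS, rfl⟩
    · exact ⟨S, by rwa [pathEdges_comm], Finset.insert_comm _ _ _⟩

theorem sum_pathEdges {v a b : V} (hab : a ≠ b) (ha : a ≠ v) (hb : b ≠ v) (w : Sym2 V → R) :
    ∑ S ∈ pathEdges v a b, ∏ e ∈ S, w e =
      w s(a, b) + ∑ S ∈ pathEdges v a b with s(a, b) ∉ S, ∏ e ∈ S, w e := by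
  rw [← Finset.sum_filter_add_sum_filter_not _ (fun S => s(a, b) ∈ S)]
  congr 1
  have : (pathEdges v a b).filter (fun S => s(a, b) ∈ S) = {{s(a, b)}} := by
    ext S
    rw [Finset.mem_filter, Finset.mem_singleton]
    constructor
    · exact fun h => eq_singleton_of_mem_pathEdges h.1 h.2
    · rintro rfl
      exact ⟨singleton_mem_pathEdges hab ha hb, by simp⟩
  rw [this, Finset.sum_singleton, Finset.prod_singleton]

/-- Cycles through `v` vanish by `h`. A remaining cycle either misses the edge between `a` and `b`,
or is that edge closed up by a path other than the edge itself. -/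
theorem sum_cycles_avoiding {v a b : V} (hab : a ≠ b) {w : Sym2 V → R}
    (h : ∀ e, v ∈ e → w e = 0) : cycleSum w =
      ∑ C ∈ simpleCycles (⊤ : SimpleGraph V) with s(a, b) ∉ C, ∏ e ∈ C, w e +
      w s(a, b) * ∑ S ∈ pathEdges v a b with s(a, b) ∉ S, ∏ e ∈ S, w e := by
  have hinj : Set.InjOn (fun S => insert s(a, b) S)
      ((pathEdges v a b).filter fun S => s(a, b) ∉ S : Set (Finset (Sym2 V))) := by
    intro S hS S' hS' hSS
    have := congrArg (Finset.erase · s(a, b)) hSS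
    simpa [(Finset.mem_filter.mp hS).2, (Finset.mem_filter.mp hS').2] using this
  have hprod : ∀ S ∈ (pathEdges v a b).filter (fun S => s(a, b) ∉ S),
      ∏ e ∈ insert s(a, b) S, w e = w s(a, b) * ∏ e ∈ S, w e := fun S hS =>
    Finset.prod_insert (Finset.mem_filter.mp hS).2
  unfold cycleSum
  rw [← Finset.sum_filter_add_sum_filter_not _ (fun C => s(a, b) ∉ C), Finset.mul_sum,
    ← Finset.sum_congr rfl hprod,
    ← Finset.sum_image (f := fun C => ∏ e ∈ C, w e) hinj]
  congr 1
  refine (Finset.sum_subset ?_ ?_).symm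
  · intro C hC
    obtain ⟨S, hS, rfl⟩ := Finset.mem_image.mp hC
    obtain ⟨hS, hS'⟩ := Finset.mem_filter.mp hS
    exact Finset.mem_filter.mpr ⟨insert_mem_simpleCycles_of_avoids hab hS hS', by simp⟩
  · intro C hC hC'
    obtain ⟨hC, hC1⟩ := Finset.mem_filter.mp hC
    rw [not_not] at hC1
    by_cases hv : ∀ e ∈ C, v ∉ e
    · obtain ⟨S, hS, hS', rfl⟩ := exists_pathEdges_of_avoids hC hv hC1
      exact absurd (Finset.mem_image.mpr ⟨S, Finset.mem_filter.mpr ⟨hS, hS'⟩, rfl⟩) hC'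
    · push Not at hv
      obtain ⟨e, he, hv⟩ := hv
      exact Finset.prod_eq_zero he (h e hv)

/-- Replacing the two edges at a vertex by one edge. -/
theorem cycleSum_contract {v a b : V} (hab : a ≠ b) (ha : a ≠ v) (hb : b ≠ v) {w : Sym2 V → R}
    (h : ∀ x, x ≠ a → x ≠ b → w s(v, x) = 0) :
    cycleSum w = cycleSum (contractWeight v a b w) + w s(v, a) * w s(v, b) * w s(a, b) := by
  have hv : v ∉ s(a, b) := by simp [ha.symm, hb.symm]
  have h1 : deleteWeight v w s(a, b) = w s(a, b) := if_neg hv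
  have h2 : contractWeight v a b w s(a, b) = w s(a, b) + w s(v, a) * w s(v, b) := by
    rw [contractWeight, if_neg hv, if_pos rfl]
  have h3 : ∀ e, e ≠ s(a, b) → contractWeight v a b w e = deleteWeight v w e := fun e he => by
    rw [contractWeight, deleteWeight, if_neg he]
  have h4 : ∑ C ∈ simpleCycles (⊤ : SimpleGraph V) with s(a, b) ∉ C,
      ∏ e ∈ C, contractWeight v a b w e =
      ∑ C ∈ simpleCycles (⊤ : SimpleGraph V) with s(a, b) ∉ C, ∏ e ∈ C, deleteWeight v w e :=
    Finset.sum_congr rfl fun C hC => Finset.prod_congr rfl fun e he =>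
      h3 e fun hE => (Finset.mem_filter.mp hC).2 (hE ▸ he)
  have h5 : ∑ S ∈ pathEdges v a b with s(a, b) ∉ S, ∏ e ∈ S, contractWeight v a b w e =
      ∑ S ∈ pathEdges v a b with s(a, b) ∉ S, ∏ e ∈ S, deleteWeight v w e :=
    Finset.sum_congr rfl fun S hS => Finset.prod_congr rfl fun e he =>
      h3 e fun hE => (Finset.mem_filter.mp hS).2 (hE ▸ he)
  have h6 : ∑ S ∈ pathEdges v a b with s(a, b) ∉ S, ∏ e ∈ S, deleteWeight v w e =
      ∑ S ∈ pathEdges v a b with s(a, b) ∉ S, ∏ e ∈ S, w e :=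
    Finset.sum_congr rfl fun S hS => Finset.prod_congr rfl fun e he =>
      if_neg (notMem_of_mem_pathEdges (Finset.mem_filter.mp hS).1 he)
  -- Let `A` be the sum over cycles without `v` and without the edge `ab`, and `P` the sum over
  -- paths from `a` to `b` avoiding `v` other than that edge. With `x` the product of the two
  -- weights at `v` and `y` the weight of `ab`, both sides equal `A + y * P + x * (y + P)`.
  rw [cycleSum_split v w, sum_cycles_through hab ha hb h, sum_pathEdges hab ha hb,
    sum_cycles_avoiding hab (w := deleteWeight v w) fun e he => if_pos he,
    sum_cycles_avoiding hab (w := contractWeight v a b w) fun e he => if_pos he,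
    h1, h2, h4, h5, h6]
  ring

end CycleSums

/-! ### Graphs of treewidth at most two -/

section Treewidth

variable {V W : Type}

/-- Delete `v` and join its neighbours to each other. -/
def elimVertex (G : SimpleGraph V) (v : V) : SimpleGraph V where
  Adj x y := x ≠ y ∧ x ≠ v ∧ y ≠ v ∧ (G.Adj x y ∨ (G.Adj x v ∧ G.Adj v y))
  symm := ⟨fun _ _ h => ⟨h.1.symm, h.2.2.1, h.2.1, h.2.2.2.imp (fun h => h.symm)
    fun h => ⟨h.2.symm, h.1.symm⟩⟩⟩
  loopless := ⟨fun _ h => h.1 rfl⟩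

theorem elimVertex_adj {G : SimpleGraph V} {v x y : V} : (elimVertex G v).Adj x y ↔
    x ≠ y ∧ x ≠ v ∧ y ≠ v ∧ (G.Adj x y ∨ (G.Adj x v ∧ G.Adj v y)) := Iff.rfl

/-- In both orders, two remaining vertices become adjacent exactly when `G` joins them by a path
whose interior vertices are among `u` and `v`. -/
theorem elimVertex_comm (G : SimpleGraph V) (u v : V) :
    elimVertex (elimVertex G u) v = elimVertex (elimVertex G v) u := by
  ext x y
  simp only [elimVertex_adj]
  have h := G.adj_comm u v
  by_cases huv : u = v
  · subst huv; rfl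
  · have huv' := Ne.symm huv
    tauto

/-- Graphs that can be reduced to an edgeless graph by eliminating vertices of degree at most
two. -/
inductive Reducible : SimpleGraph V → Prop
  | bot : Reducible ⊥
  | elim {G : SimpleGraph V} (v a b : V) (h : ∀ x, G.Adj v x → x = a ∨ x = b)
      (hG : Reducible (elimVertex G v)) : Reducible G

namespace Reducible

theorem mono {G H : SimpleGraph V} (hG : Reducible G) (h : H ≤ G) : Reducible H := by
  induction hG generalizing H with
  | bot => rw [le_bot_iff.mp h]; exact .bot
  | elim v a b hv _ ih =>
    refine .elim v a b (fun x hx => hv x (h hx)) (ih fun x y hxy => ?_)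
    rw [elimVertex_adj] at hxy ⊢
    exact ⟨hxy.1, hxy.2.1, hxy.2.2.1, hxy.2.2.2.imp (fun h' => h h') fun h' => ⟨h h'.1, h h'.2⟩⟩

/-- If `v` is adjacent to `u`, it loses the neighbour `u` and gains at most the other neighbour of
`u`; so the bound two on its degree persists. -/
theorem elimVertex_nbrs {G : SimpleGraph V} {u v a b c d : V}
    (hv : ∀ x, G.Adj v x → x = a ∨ x = b) (hu : ∀ x, G.Adj u x → x = c ∨ x = d) :
    ∃ a' b', ∀ x, (elimVertex G u).Adj v x → x = a' ∨ x = b' := by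
  by_cases h : G.Adj v u
  · have h1 : ∃ a', ∀ x, G.Adj v x → x = u ∨ x = a' := by
      rcases hv u h with rfl | rfl
      · exact ⟨b, hv⟩
      · exact ⟨a, fun x hx => (hv x hx).symm⟩
    have h2 : ∃ c', ∀ x, G.Adj u x → x = v ∨ x = c' := by
      rcases hu v h.symm with rfl | rfl
      · exact ⟨d, hu⟩
      · exact ⟨c, fun x hx => (hu x hx).symm⟩
    obtain ⟨a', h1⟩ := h1
    obtain ⟨c', h2⟩ := h2
    refine ⟨a', c', fun x hx => ?_⟩
    rw [elimVertex_adj] at hx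
    obtain ⟨hx1, _, hx2, hx3 | hx3⟩ := hx
    · exact Or.inl ((h1 x hx3).resolve_left hx2)
    · exact Or.inr ((h2 x hx3.2).resolve_left hx1.symm)
  · refine ⟨a, b, fun x hx => ?_⟩
    rw [elimVertex_adj] at hx
    exact hv x (hx.2.2.2.resolve_right fun h' => h h'.1)

/-- The order in which vertices of degree at most two are eliminated does not matter. -/
theorem elimVertex {G : SimpleGraph V} (hG : Reducible G) {u c d : V}
    (hu : ∀ x, G.Adj u x → x = c ∨ x = d) : Reducible (elimVertex G u) := by
  induction hG generalizing c d with
  | bot =>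
    refine mono .bot fun x y h => ?_
    rw [elimVertex_adj] at h
    simp at h
  | @elim G v a b hv hG ih =>
    by_cases huv : u = v
    · subst huv; exact hG
    -- Each of `u` and `v` keeps degree at most two after the other is eliminated. By induction the
    -- graph without both is reducible, and by commutation it also arises by eliminating `u` before
    -- `v`.
    obtain ⟨a', b', h1⟩ := elimVertex_nbrs hv hu
    obtain ⟨c', d', h2⟩ := elimVertex_nbrs hu hv
    have h3 := ih h2
    rw [elimVertex_comm] at h3
    exact .elim v a' b' h1 h3

/-- As long as there are edges, some vertex has degree one or two. -/
theorem exists_vertex {G : SimpleGraph V} (hG : Reducible G) (h : G ≠ ⊥) :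
    ∃ v a b, (∃ x, G.Adj v x) ∧ ∀ x, G.Adj v x → x = a ∨ x = b := by
  induction hG with
  | bot => exact absurd rfl h
  | @elim G v a b hv _ ih =>
    by_cases hx : ∃ x, G.Adj v x
    · exact ⟨v, a, b, hx, hv⟩
    -- Eliminating an isolated vertex changes nothing, so the induction hypothesis applies to `G`
    -- itself.
    · have : _root_.elimVertex G v = G := by
        push Not at hx
        ext x y
        rw [elimVertex_adj]
        constructor
        · rintro ⟨-, -, -, h | h⟩
          · exact h
          · exact absurd h.2 (hx y)
        · intro h
          refine ⟨h.ne, ?_, ?_, Or.inl h⟩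
          · rintro rfl; exact hx _ h
          · rintro rfl; exact hx _ h.symm
      rw [this] at ih
      exact ih h

/-- A vertex of degree at most two is eliminated through its preimage. If it has none, eliminating
it can only add edges to the pulled back graph, and `mono` applies. -/
theorem comap {G : SimpleGraph V} (hG : Reducible G) {f : W → V} (hf : Function.Injective f) :
    Reducible (G.comap f) := by
  induction hG with
  | bot => exact mono .bot fun x y h => h.elim
  | @elim G v a b hv _ ih =>
    by_cases hr : ∃ u, f u = v
    · obtain ⟨u, rfl⟩ := hr
      -- A neighbour outside the range of `f` is replaced by the arbitrary vertex `u`, since no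
      -- condition comes from it.
      have pre : ∀ a : V, ∃ a' : W, ∀ x, f x = a → x = a' := by
        intro a
        by_cases h : ∃ x, f x = a
        · obtain ⟨x, rfl⟩ := h
          exact ⟨x, fun y hy => hf hy⟩
        · exact ⟨u, fun x hx => absurd ⟨x, hx⟩ h⟩
      obtain ⟨a', ha⟩ := pre a
      obtain ⟨b', hb⟩ := pre b
      refine .elim u a' b' (fun x hx => (hv _ hx).imp (ha x) (hb x)) (ih.mono fun x y h => ?_)
      rw [elimVertex_adj] at h
      rw [SimpleGraph.comap_adj, elimVertex_adj]
      exact ⟨fun h' => h.1 (hf h'), fun h' => h.2.1 (hf h'), fun h' => h.2.2.1 (hf h'), h.2.2.2⟩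
    · refine ih.mono fun x y h => ?_
      push Not at hr
      rw [SimpleGraph.comap_adj, elimVertex_adj]
      exact ⟨fun h' => h.ne (hf h'), hr x, hr y, Or.inl h⟩

theorem map {G : SimpleGraph V} (hG : Reducible G) (f : V ↪ W) : Reducible (G.map f) := by
  induction hG with
  | bot =>
    refine mono .bot fun x y h => ?_
    rw [SimpleGraph.map_adj] at h
    obtain ⟨_, _, h, -⟩ := h
    exact h.elim
  | @elim G v a b hv _ ih =>
    refine .elim (f v) (f a) (f b) (fun x hx => ?_) (ih.mono fun x y h => ?_)
    · rw [SimpleGraph.map_adj] at hx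
      obtain ⟨u, u', h, hu, rfl⟩ := hx
      rw [f.injective hu] at h
      exact (hv u' h).imp (congrArg f) (congrArg f)
    · rw [elimVertex_adj, SimpleGraph.map_adj, SimpleGraph.map_adj, SimpleGraph.map_adj] at h
      obtain ⟨h1, h2, h3, ⟨u, u', h, rfl, rfl⟩ | ⟨⟨u, w, h, rfl, hw⟩, ⟨w', u', h', hw', rfl⟩⟩⟩ := h
      · rw [SimpleGraph.map_adj_apply, elimVertex_adj]
        exact ⟨h.ne, fun h' => h2 (h' ▸ rfl), fun h' => h3 (h' ▸ rfl), Or.inl h⟩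
      · rw [f.injective hw] at h
        rw [f.injective hw'] at h'
        rw [SimpleGraph.map_adj_apply, elimVertex_adj]
        exact ⟨fun h' => h1 (h' ▸ rfl), h.ne, h'.ne.symm, Or.inr ⟨h, h'⟩⟩

end Reducible

theorem reducible_top {k : ℕ} (hk : k ≤ 2) : Reducible (⊤ : SimpleGraph (Fin k)) := by
  rcases Nat.lt_or_ge k 2 with h | h
  · have : Subsingleton (Fin k) := Fin.subsingleton_iff_le_one.mpr (by omega)
    rw [Subsingleton.elim (⊤ : SimpleGraph (Fin k)) ⊥]
    exact .bot
  · obtain rfl : k = 2 := by omega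
    refine .elim 0 0 1 (fun x _ => ?_) (Reducible.mono .bot fun x y h => ?_)
    · omega
    · rw [elimVertex_adj] at h
      omega

theorem addVertex_adj_last {m : ℕ} {G : SimpleGraph (Fin m)} {Q : Finset (Fin m)}
    {x : Fin (m + 1)} (h : (addVertex G Q).Adj (Fin.last m) x) : ∃ u ∈ Q, x = u.castSucc := by
  rw [addVertex, SimpleGraph.sup_adj, SimpleGraph.map_adj, SimpleGraph.fromEdgeSet_adj] at h
  rcases h with ⟨u, u', -, h, -⟩ | ⟨⟨u, hu, h⟩, -⟩
  · exact absurd h (Fin.castSucc_lt_last u).ne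
  · refine ⟨u, hu, ?_⟩
    rw [Sym2.eq_swap] at h
    exact Sym2.congr_left.mp h

/-- The new vertex has at most two neighbours, and these form a clique; so its elimination adds no
edge and returns the old graph. -/
theorem reducible_addVertex {m k : ℕ} (hk : k ≤ 2) {G : SimpleGraph (Fin m)} (hG : Reducible G)
    {Q : Finset (Fin m)} (hQ : G.IsNClique k Q) : Reducible (addVertex G Q) := by
  have hQ2 : ∃ a b : Fin (m + 1), ∀ u ∈ Q, u.castSucc = a ∨ u.castSucc = b := by
    have hc := hQ.card_eq
    rcases Nat.lt_or_ge k 2 with h | h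
    · rcases Q.eq_empty_or_nonempty with rfl | ⟨u, hu⟩
      · exact ⟨Fin.last m, Fin.last m, by simp⟩
      · refine ⟨u.castSucc, u.castSucc, fun x hx => Or.inl ?_⟩
        rw [Finset.card_le_one.mp (by omega) x hx u hu]
    · obtain ⟨a, b, -, rfl⟩ := Finset.card_eq_two.mp (show Q.card = 2 by omega)
      exact ⟨a.castSucc, b.castSucc, by simp⟩
  obtain ⟨a, b, hab⟩ := hQ2
  refine .elim (Fin.last m) a b (fun x hx => ?_) ((hG.map Fin.castSuccEmb).mono fun x y h => ?_)
  · obtain ⟨u, hu, rfl⟩ := addVertex_adj_last hx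
    exact hab u hu
  · rw [elimVertex_adj] at h
    obtain ⟨hxy, hx, hy, h | ⟨h, h'⟩⟩ := h
    · rw [addVertex, SimpleGraph.sup_adj, SimpleGraph.fromEdgeSet_adj] at h
      rcases h with h | ⟨⟨u, -, h⟩, -⟩
      · exact h
      · have : Fin.last m ∈ s(x, y) := h ▸ Sym2.mem_mk_right _ _
        rcases Sym2.mem_iff.mp this with h | h
        · exact absurd h.symm hx
        · exact absurd h.symm hy
    · obtain ⟨u, hu, rfl⟩ := addVertex_adj_last h.symm
      obtain ⟨u', hu', rfl⟩ := addVertex_adj_last h'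
      rw [SimpleGraph.map_adj]
      exact ⟨u, u', hQ.isClique hu hu' fun h => hxy (h ▸ rfl), rfl, rfl⟩

theorem IsKTree.reducible {k m : ℕ} (hk : k ≤ 2) {T : SimpleGraph (Fin m)} (hT : IsKTree k m T) :
    Reducible T := by
  induction hT with
  | base => exact reducible_top hk
  | extend _ Q hQ ih => exact reducible_addVertex hk ih hQ

/-- Graphs of treewidth at most two are reducible. -/
theorem reducible_of_treewidth_le {G : SimpleGraph V} (h : treewidth G ≤ 2) : Reducible G := by
  have : ∃ k ≤ 2, IsPartialKTree k G := by
    by_contra! hcon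
    have h3 : (3 : ℕ∞) ≤ treewidth G := by
      refine le_iInf₂ fun k hk => ?_
      have : 3 ≤ k := by
        by_contra hlt
        exact hcon k (by omega) hk
      exact_mod_cast this
    exact absurd (h3.trans h) (by decide)
  obtain ⟨k, hk, m, T, hT, ⟨f⟩⟩ := this
  exact ((hT.reducible hk).comap f.injective).mono fun x y hxy => f.toHom.map_adj hxy

end Treewidth
namespace StackProg

/-! ### The weights of a list of edges -/

/-- The two ends of an edge. -/
def Edge.ends (x : Edge) : Sym2 ℕ := s(x.1, x.2.1)

open Classical in
/-- The formal sum of the expressions of the edges with given ends. -/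
noncomputable def weightAt (es : List Edge) (e : Sym2 ℕ) : Poly :=
  (es.map fun x => if Edge.ends x = e then x.2.2.poly else 0).sum

theorem weightAt_cons (x : Edge) (es : List Edge) (e : Sym2 ℕ) :
    weightAt (x :: es) e = weightAt es e + if Edge.ends x = e then x.2.2.poly else 0 := by
  rw [weightAt, List.map_cons, List.sum_cons, add_comm]
  rfl

theorem weightAt_cons_mk (a b : ℕ) (p : Expr) (es : List Edge) (e : Sym2 ℕ) :
    weightAt ((a, b, p) :: es) e = weightAt es e + if e = s(a, b) then p.poly else 0 := by
  rw [weightAt_cons]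
  congr 1
  exact if_congr eq_comm rfl rfl

theorem weightAt_eq_zero {es : List Edge} {e : Sym2 ℕ} (h : ∀ x ∈ es, Edge.ends x ≠ e) :
    weightAt es e = 0 := by
  induction es with
  | nil => rfl
  | cons x es ih =>
    rw [weightAt_cons, if_neg (h x List.mem_cons_self), add_zero,
      ih fun y hy => h y (List.mem_cons_of_mem _ hy)]

theorem weightAt_eq_of_mem {es : List Edge} (hn : (es.map Edge.ends).Nodup) {x : Edge}
    (hx : x ∈ es) : weightAt es (Edge.ends x) = x.2.2.poly := by
  induction es with
  | nil => simp at hx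
  | cons y es ih =>
    rw [List.map_cons, List.nodup_cons] at hn
    rw [weightAt_cons]
    rcases List.mem_cons.mp hx with rfl | hx
    · rw [if_pos rfl, weightAt_eq_zero, zero_add]
      exact fun z hz h => hn.1 (h ▸ List.mem_map_of_mem hz)
    · rw [ih hn.2 hx, if_neg, add_zero]
      exact fun h => hn.1 (h ▸ List.mem_map_of_mem hx)

theorem weightAt_filter (p : Edge → Bool) (es : List Edge) (e : Sym2 ℕ) (b : Bool)
    (h : ∀ x ∈ es, Edge.ends x = e → p x = b) :
    weightAt (es.filter p) e = if b then weightAt es e else 0 := by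
  induction es with
  | nil => simp [weightAt]
  | cons x es ih =>
    have ih := ih fun y hy => h y (List.mem_cons_of_mem _ hy)
    rw [weightAt_cons]
    by_cases hx : Edge.ends x = e
    · have hp := h x List.mem_cons_self hx
      rw [List.filter_cons, hp, if_pos hx]
      cases b with
      | true => rw [if_pos rfl, weightAt_cons, if_pos hx, ih]; rfl
      | false => rw [if_neg (by simp), ih]; rfl
    · rw [if_neg hx, add_zero, ← ih, List.filter_cons]
      split_ifs
      · rw [weightAt_cons, if_neg hx, add_zero]
      · rfl

theorem joins_iff {a b : ℕ} {x : Edge} : joins a b x = true ↔ Edge.ends x = s(a, b) := by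
  simp [joins, eqB, Edge.ends]

theorem mem_avoiding {v : ℕ} {es : List Edge} {x : Edge} :
    x ∈ avoiding v es ↔ x ∈ es ∧ v ∉ Edge.ends x := by
  simp [avoiding, eqB, Edge.ends, eq_comm (a := v)]

theorem weightAt_avoiding (v : ℕ) (es : List Edge) (e : Sym2 ℕ) :
    weightAt (avoiding v es) e = if v ∈ e then 0 else weightAt es e := by
  by_cases h : v ∈ e
  · rw [if_pos h]
    refine weightAt_eq_zero fun x hx he => ?_
    exact (mem_avoiding.mp hx).2 (he ▸ h)
  · rw [if_neg h]
    refine (weightAt_filter _ es e true fun x _ hx => ?_).trans (if_pos rfl)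
    rw [← hx] at h
    simpa [eqB, Edge.ends, eq_comm (a := v)] using h

theorem otherEnd_eq_some {v : ℕ} {x : Edge} {u : ℕ × Expr} (h : otherEnd v x = some u) :
    Edge.ends x = s(v, u.1) ∧ x.2.2 = u.2 := by
  unfold otherEnd eqB at h
  by_cases h1 : x.1 = v
  · simp only [h1, decide_true, cond_true, Option.some.injEq] at h
    simp [Edge.ends, ← h, h1]
  by_cases h2 : x.2.1 = v
  · simp only [h1, h2, decide_true, decide_false, cond_true, cond_false, Option.some.injEq] at h
    simp [Edge.ends, ← h, h2, Sym2.eq_swap]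
  · simp [h1, h2] at h

theorem otherEnd_eq_none {v : ℕ} {x : Edge} (h : otherEnd v x = none) : v ∉ Edge.ends x := by
  unfold otherEnd eqB at h
  by_cases h1 : x.1 = v
  · simp [h1] at h
  by_cases h2 : x.2.1 = v
  · simp [h1, h2] at h
  · simp [Edge.ends, Ne.symm h1, Ne.symm h2]

/-- This transfers the absence of parallel edges from the list of edges to the list of neighbours of
`v`. -/
theorem incident_ends_sublist (v : ℕ) (es : List Edge) :
    ((incident v es).map fun u => s(v, u.1)).Sublist (es.map Edge.ends) := by
  induction es with
  | nil => exact List.Sublist.refl _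
  | cons x es ih =>
    cases h : otherEnd v x with
    | none =>
      rw [incident, List.filterMap_cons_none h, List.map_cons]
      exact ih.cons _
    | some u =>
      rw [incident, List.filterMap_cons_some h, List.map_cons, List.map_cons,
        (otherEnd_eq_some h).1]
      exact ih.cons_cons _

theorem exists_incident_iff {v y : ℕ} {es : List Edge} :
    (∃ u ∈ incident v es, u.1 = y) ↔ ∃ x ∈ es, Edge.ends x = s(v, y) := by
  constructor
  · rintro ⟨u, hu, rfl⟩
    obtain ⟨x, hx, h⟩ := List.mem_filterMap.mp hu
    exact ⟨x, hx, (otherEnd_eq_some h).1⟩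
  · rintro ⟨x, hx, h⟩
    cases h' : otherEnd v x with
    | none => exact absurd (h ▸ Sym2.mem_mk_left _ _) (otherEnd_eq_none h')
    | some u =>
      refine ⟨u, List.mem_filterMap.mpr ⟨x, hx, h'⟩, ?_⟩
      have := (otherEnd_eq_some h').1
      rw [h] at this
      exact (Sym2.congr_right.mp this).symm

theorem weightAt_incident {v : ℕ} {es : List Edge} (hn : (es.map Edge.ends).Nodup) {u : ℕ × Expr}
    (hu : u ∈ incident v es) : weightAt es s(v, u.1) = u.2.poly := by
  obtain ⟨x, hx, h⟩ := List.mem_filterMap.mp hu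
  obtain ⟨h1, h2⟩ := otherEnd_eq_some h
  rw [← h1, weightAt_eq_of_mem hn hx, h2]

theorem weightAt_of_not_incident {v y : ℕ} {es : List Edge} (h : ∀ u ∈ incident v es, u.1 ≠ y) :
    weightAt es s(v, y) = 0 :=
  weightAt_eq_zero fun x hx hxy => by
    obtain ⟨u, hu, h'⟩ := exists_incident_iff.mpr ⟨x, hx, hxy⟩
    exact h u hu h'

theorem length_incident_add (v : ℕ) (es : List Edge) :
    (incident v es).length + (avoiding v es).length = es.length := by
  induction es with
  | nil => rfl
  | cons x es ih =>
    cases h1 : eqB x.1 v <;> cases h2 : eqB x.2.1 v <;>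
    simp only [incident, avoiding, otherEnd, List.filter_cons, h1, h2, List.filterMap_cons,
      List.length_cons, Bool.not_true, cond_true, cond_false, Bool.not_false, Bool.and_true,
      Bool.and_false, if_true, Bool.false_eq_true, if_false] at * <;>
    omega

/-- The effect of merging a new edge. -/
theorem contract_spec {x y : ℕ × Expr} {es : List Edge} (hn : (es.map Edge.ends).Nodup) (T : Expr) :
    (∀ e, weightAt (contract x y (es, T)).1 e =
      if e = s(x.1, y.1) then weightAt es e + x.2.poly * y.2.poly else weightAt es e) ∧
    (contract x y (es, T)).2.poly =
      T.poly + x.2.poly * y.2.poly * weightAt es s(x.1, y.1) ∧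
    (contract x y (es, T)).1.length ≤ es.length + 1 ∧
    ((contract x y (es, T)).1.map Edge.ends).Nodup ∧
    ∀ z ∈ (contract x y (es, T)).1, Edge.ends z = s(x.1, y.1) ∧ z.1 = x.1 ∧ z.2.1 = y.1 ∨ z ∈ es := by
  unfold contract
  cases hf : es.filter (joins x.1 y.1) with
  | nil =>
    have hno : ∀ z ∈ es, Edge.ends z ≠ s(x.1, y.1) := fun z hz h =>
      List.filter_eq_nil_iff.mp hf z hz (joins_iff.mpr h)
    have h0 := weightAt_eq_zero hno
    refine ⟨fun e => ?_, ?_, le_rfl, ?_, fun z hz => ?_⟩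
    · rw [weightAt_cons_mk]
      by_cases he : e = s(x.1, y.1)
      · rw [if_pos he, if_pos he]; rfl
      · rw [if_neg he, if_neg he, add_zero]
    · rw [h0, mul_zero, add_zero]
    · rw [List.map_cons, List.nodup_cons]
      refine ⟨fun h => ?_, hn⟩
      obtain ⟨z, hz, h⟩ := List.mem_map.mp h
      exact hno z hz h
    · rcases List.mem_cons.mp hz with rfl | hz
      · exact Or.inl ⟨rfl, rfl, rfl⟩
      · exact Or.inr hz
  | cons z l =>
    have hz : z ∈ es.filter (joins x.1 y.1) := hf ▸ List.mem_cons_self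
    rw [List.mem_filter, joins_iff] at hz
    have hz' : weightAt es s(x.1, y.1) = z.2.2.poly := by
      rw [← hz.2, weightAt_eq_of_mem hn hz.1]
    have hw : ∀ e, weightAt (es.filter fun e => !joins x.1 y.1 e) e =
        if e = s(x.1, y.1) then 0 else weightAt es e := fun e => by
      by_cases he : e = s(x.1, y.1)
      · rw [if_pos he]
        refine (weightAt_filter _ es e false fun w _ hw => ?_).trans (if_neg (by simp))
        simpa using joins_iff.mpr (hw.trans he)
      · rw [if_neg he]
        refine (weightAt_filter _ es e true fun w _ hw => ?_).trans (if_pos rfl)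
        have : ¬ joins x.1 y.1 w = true := fun h => he (hw ▸ joins_iff.mp h)
        simpa using this
    refine ⟨fun e => ?_, ?_, ?_, ?_, fun w hw' => ?_⟩
    · rw [weightAt_cons_mk, hw]
      by_cases he : e = s(x.1, y.1)
      · rw [if_pos he, if_pos he, if_pos he, he, hz', zero_add, add_comm]; rfl
      · rw [if_neg he, if_neg he, if_neg he, add_zero]
    · rw [hz']; rfl
    · rw [List.length_cons]
      exact Nat.succ_le_succ (List.length_filter_le _ _)
    · rw [List.map_cons, List.nodup_cons]
      refine ⟨fun h => ?_, hn.sublist (List.filter_sublist.map _)⟩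
      obtain ⟨w, hw1, hw2⟩ := List.mem_map.mp h
      have hw3 := (List.mem_filter.mp hw1).2
      rw [joins_iff.mpr hw2] at hw3
      simp at hw3
    · rcases List.mem_cons.mp hw' with rfl | hw'
      · exact Or.inl ⟨rfl, rfl, rfl⟩
      · exact Or.inr (List.mem_filter.mp hw').1

end StackProg
namespace StackProg

/-! ### Correctness of the elimination -/

/-- The weights of a list of edges on the vertices `0, …, n - 1`. -/
noncomputable def finWeight (n : ℕ) (es : List Edge) (e : Sym2 (Fin n)) : Poly :=
  weightAt es (e.map Fin.val)

/-- The graph of a list of edges. -/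
def edgeGraph (n : ℕ) (es : List Edge) : SimpleGraph (Fin n) where
  Adj x y := x ≠ y ∧ ∃ z ∈ es, Edge.ends z = s(x.val, y.val)
  symm := ⟨fun _ _ h => ⟨h.1.symm, by rw [Sym2.eq_swap]; exact h.2⟩⟩
  loopless := ⟨fun _ h => h.1 rfl⟩

theorem map_val_eq_iff {n : ℕ} {e : Sym2 (Fin n)} {a b : Fin n} :
    e.map Fin.val = s(a.val, b.val) ↔ e = s(a, b) := by
  rw [← Sym2.map_mk, (Sym2.map.injective Fin.val_injective).eq_iff]

theorem val_mem_map_iff {n : ℕ} {e : Sym2 (Fin n)} {v : Fin n} : v.val ∈ e.map Fin.val ↔ v ∈ e := by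
  rw [Sym2.mem_map]
  exact ⟨fun ⟨u, hu, h⟩ => Fin.val_injective h ▸ hu, fun h => ⟨v, h, rfl⟩⟩

/-- The state of the elimination is consistent and represents the formal sum `S`. -/
structure Represents (n : ℕ) (S : Poly) (st : ElimState) : Prop where
  lt : ∀ z ∈ st.1, z.1 < n ∧ z.2.1 < n ∧ z.1 ≠ z.2.1
  nodup : (st.1.map Edge.ends).Nodup
  reducible : Reducible (edgeGraph n st.1)
  total : st.2.poly + cycleSum (finWeight n st.1) = S

namespace Represents

variable {n : ℕ} {S : Poly} {st : ElimState}

theorem incident_lt (h : Represents n S st) {v : ℕ} {u : ℕ × Expr} (hu : u ∈ incident v st.1) :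
    v < n ∧ u.1 < n ∧ u.1 ≠ v := by
  obtain ⟨x, hx, h1⟩ := exists_incident_iff.mp ⟨u, hu, rfl⟩
  obtain ⟨h2, h3, h4⟩ := h.lt x hx
  rw [Edge.ends, Sym2.eq_iff] at h1
  omega

theorem incident_nodup (h : Represents n S st) (v : ℕ) :
    ((incident v st.1).map Prod.fst).Nodup := by
  have h1 := h.nodup.sublist (incident_ends_sublist v st.1)
  refine List.Nodup.of_map (fun y => s(v, y)) ?_
  rw [List.map_map]
  exact h1

theorem nodup_avoiding (h : Represents n S st) (v : ℕ) :
    ((avoiding v st.1).map Edge.ends).Nodup := h.nodup.sublist (List.filter_sublist.map _)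

theorem finWeight_avoiding (v : Fin n) (es : List Edge) :
    finWeight n (avoiding v es) = deleteWeight v (finWeight n es) := by
  funext e
  rw [finWeight, weightAt_avoiding, deleteWeight]
  exact if_congr val_mem_map_iff rfl rfl

theorem edgeGraph_avoiding_le (v : ℕ) (es : List Edge) :
    edgeGraph n (avoiding v es) ≤ edgeGraph n es := fun x y hxy => by
  obtain ⟨h1, z, hz, h2⟩ := hxy
  exact ⟨h1, z, (mem_avoiding.mp hz).1, h2⟩

/-- Deleting a vertex of degree one. -/
theorem avoiding (h : Represents n S st) {v : ℕ} {x : ℕ × Expr} (hv : incident v st.1 = [x]) :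
    Represents n S (avoiding v st.1, st.2) where
  lt z hz := h.lt z (mem_avoiding.mp hz).1
  nodup := h.nodup_avoiding v
  reducible := h.reducible.mono (edgeGraph_avoiding_le v st.1)
  total := by
    obtain ⟨h1, h2, -⟩ := h.incident_lt (u := x) (v := v) (by simp [hv])
    rw [← h.total]
    have h3 := finWeight_avoiding ⟨v, h1⟩ st.1
    dsimp only at h3 ⊢
    rw [h3, ← cycleSum_delete (a := ⟨x.1, h2⟩)]
    intro y hy
    refine weightAt_of_not_incident fun u hu hu' => ?_
    rw [hv, List.mem_singleton] at hu
    subst hu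
    exact hy (Fin.ext hu'.symm)

/-- Eliminating a vertex of degree two. -/
theorem contract (h : Represents n S st) {v : ℕ} {x y : ℕ × Expr}
    (hv : incident v st.1 = [x, y]) :
    Represents n S (contract x y (StackProg.avoiding v st.1, st.2)) := by
  obtain ⟨h1, hx, hxv⟩ := h.incident_lt (u := x) (v := v) (by simp [hv])
  obtain ⟨-, hy, hyv⟩ := h.incident_lt (u := y) (v := v) (by simp [hv])
  have hxy : x.1 ≠ y.1 := by
    have := h.incident_nodup v
    rw [hv] at this
    simpa using this
  obtain ⟨hw, hT, -, hnd, hmem⟩ := contract_spec (x := x) (y := y) (h.nodup_avoiding v) st.2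
  obtain ⟨V, hV⟩ : ∃ V : Fin n, V.val = v := ⟨⟨v, h1⟩, rfl⟩
  obtain ⟨a, ha⟩ : ∃ a : Fin n, a.val = x.1 := ⟨⟨x.1, hx⟩, rfl⟩
  obtain ⟨b, hb⟩ : ∃ b : Fin n, b.val = y.1 := ⟨⟨y.1, hy⟩, rfl⟩
  have hab : a ≠ b := fun h => hxy (by rw [← ha, ← hb, h])
  have haV : a ≠ V := fun h => hxv (by rw [← ha, ← hV, h])
  have hbV : b ≠ V := fun h => hyv (by rw [← hb, ← hV, h])
  have hVa : finWeight n st.1 s(V, a) = x.2.poly := by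
    rw [finWeight, Sym2.map_mk, hV, ha, weightAt_incident h.nodup (by simp [hv])]
  have hVb : finWeight n st.1 s(V, b) = y.2.poly := by
    rw [finWeight, Sym2.map_mk, hV, hb, weightAt_incident h.nodup (by simp [hv])]
  have hVc : ∀ c, c ≠ a → c ≠ b → finWeight n st.1 s(V, c) = 0 := fun c hca hcb => by
    rw [finWeight, Sym2.map_mk]
    refine weightAt_of_not_incident fun u hu hu' => ?_
    rw [hV, hv] at hu
    rcases List.mem_pair.mp hu with rfl | rfl
    · exact hca (Fin.ext (by rw [ha, hu']))
    · exact hcb (Fin.ext (by rw [hb, hu']))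
  have hva : v ∉ s(x.1, y.1) := by simp [hxv.symm, hyv.symm]
  refine ⟨fun z hz => ?_, hnd, ?_, ?_⟩
  · rcases hmem z hz with ⟨-, h3, h4⟩ | h3
    · rw [h3, h4]
      exact ⟨hx, hy, hxy⟩
    · exact h.lt z (mem_avoiding.mp h3).1
  · have hnb : ∀ c, (edgeGraph n st.1).Adj V c → c = a ∨ c = b := by
      rintro c ⟨-, hc⟩
      obtain ⟨u, hu, hu'⟩ := exists_incident_iff.mpr hc
      rw [hV, hv] at hu
      rcases List.mem_pair.mp hu with rfl | rfl
      · exact Or.inl (Fin.ext (by rw [ha, hu']))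
      · exact Or.inr (Fin.ext (by rw [hb, hu']))
    have hadj : ∀ u ∈ incident v st.1, ∀ c : Fin n, c.val = u.1 →
        (edgeGraph n st.1).Adj V c := fun u hu c hc => by
      refine ⟨fun hVc => (h.incident_lt hu).2.2 (by rw [← hc, ← hVc, hV]), ?_⟩
      rw [hV, hc]
      exact exists_incident_iff.mp ⟨u, hu, rfl⟩
    have hVa' := hadj x (by simp [hv]) a ha
    have hVb' := hadj y (by simp [hv]) b hb
    -- Old edges avoiding `V` persist under elimination, and the new edge from `a` to `b` is the one
    -- that arises from the path over `V`.
    refine (h.reducible.elimVertex hnb).mono fun c d hcd => ?_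
    obtain ⟨hcd, z, hz, hz'⟩ := hcd
    rw [elimVertex_adj]
    rcases hmem z hz with ⟨h3, -⟩ | h3
    · rw [h3, ← ha, ← hb, Sym2.eq_iff, ← Fin.ext_iff, ← Fin.ext_iff, ← Fin.ext_iff,
        ← Fin.ext_iff] at hz'
      rcases hz' with ⟨rfl, rfl⟩ | ⟨rfl, rfl⟩
      · exact ⟨hcd, haV, hbV, Or.inr ⟨hVa'.symm, hVb'⟩⟩
      · exact ⟨hcd, hbV, haV, Or.inr ⟨hVb'.symm, hVa'⟩⟩
    · obtain ⟨h4, h5⟩ := mem_avoiding.mp h3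
      rw [hz', ← hV, Sym2.mem_iff, not_or, ← Fin.ext_iff, ← Fin.ext_iff] at h5
      exact ⟨hcd, Ne.symm h5.1, Ne.symm h5.2, Or.inl ⟨hcd, z, h4, hz'⟩⟩
  · have hE : finWeight n (StackProg.contract x y (StackProg.avoiding v st.1, st.2)).1 =
        contractWeight V a b (finWeight n st.1) := by
      funext e
      have h6 : e.map Fin.val = s(x.1, y.1) ↔ e = s(a, b) := by
        rw [← ha, ← hb, map_val_eq_iff]
      rw [finWeight, hw, weightAt_avoiding, contractWeight, hVa, hVb]
      by_cases he : e = s(a, b)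
      · rw [if_pos (h6.mpr he), if_neg (by rw [h6.mpr he]; exact hva), if_pos he, he,
          if_neg (by simp [haV.symm, hbV.symm])]
        rfl
      · rw [if_neg fun h => he (h6.mp h), if_neg he]
        refine if_congr ?_ rfl rfl
        rw [← hV, val_mem_map_iff]
    -- The product added to the total is the triangle term of `cycleSum_contract`; it is zero if `a`
    -- and `b` were not adjacent.
    rw [hE, hT, ← h.total, cycleSum_contract hab haV hbV hVc, hVa, hVb, weightAt_avoiding,
      if_neg hva]
    have : finWeight n st.1 s(a, b) = weightAt st.1 s(x.1, y.1) := by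
      rw [finWeight, Sym2.map_mk, ha, hb]
    rw [this]
    ring

/-- One step of the elimination. -/
theorem elimStep (h : Represents n S st) (v : ℕ) : Represents n S (elimStep v st) ∧
    (elimStep v st = st ∨ (elimStep v st).1.length < st.1.length) ∧
    (1 ≤ (incident v st.1).length → (incident v st.1).length ≤ 2 →
      (elimStep v st).1.length < st.1.length) := by
  have hl := length_incident_add v st.1
  unfold StackProg.elimStep
  cases hi : incident v st.1 with
  | nil => exact ⟨h, Or.inl rfl, fun h => absurd h (by simp)⟩
  | cons x l =>
    cases l with
    | nil =>
      rw [hi, List.length_singleton] at hl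
      have hlt : (StackProg.avoiding v st.1).length < st.1.length := by omega
      exact ⟨h.avoiding hi, Or.inr hlt, fun _ _ => hlt⟩
    | cons y l =>
      cases l with
      | nil =>
        rw [hi, List.length_cons, List.length_singleton] at hl
        have hlt : (StackProg.contract x y (StackProg.avoiding v st.1, st.2)).1.length <
            st.1.length := by
          have := (contract_spec (x := x) (y := y) (h.nodup_avoiding v) st.2).2.2.1
          omega
        exact ⟨h.contract hi, Or.inr hlt, fun _ _ => hlt⟩
      | cons z l => exact ⟨h, Or.inl rfl, fun _ h => absurd h (by simp)⟩

theorem exists_vertex (h : Represents n S st) (hne : st.1 ≠ []) :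
    ∃ v < n, 1 ≤ (incident v st.1).length ∧ (incident v st.1).length ≤ 2 := by
  have hbot : edgeGraph n st.1 ≠ ⊥ := by
    intro hbot
    obtain ⟨z, l, hz⟩ := List.exists_cons_of_ne_nil hne
    have hz' : z ∈ st.1 := by rw [hz]; exact List.mem_cons_self
    obtain ⟨h1, h2, h3⟩ := h.lt z hz'
    have : (edgeGraph n st.1).Adj ⟨z.1, h1⟩ ⟨z.2.1, h2⟩ :=
      ⟨fun h => h3 (Fin.ext_iff.mp h), z, hz', rfl⟩
    rw [hbot] at this
    exact this.elim
  obtain ⟨v, a, b, ⟨x, hx⟩, hab⟩ := h.reducible.exists_vertex hbot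
  refine ⟨v, v.isLt, ?_, ?_⟩
  · obtain ⟨u, hu, -⟩ := exists_incident_iff.mpr hx.2
    exact List.length_pos_of_mem hu
  · have hsub : (incident v st.1).map Prod.fst ⊆ [a.val, b.val] := by
      intro y hy
      obtain ⟨u, hu, rfl⟩ := List.mem_map.mp hy
      obtain ⟨h1, h2, h3⟩ := h.incident_lt hu
      have := hab ⟨u.1, h2⟩ ⟨fun h' => h3 (Fin.ext_iff.mp h').symm,
        exists_incident_iff.mp ⟨u, hu, rfl⟩⟩
      rw [Fin.ext_iff, Fin.ext_iff] at this
      exact List.mem_pair.mpr this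
    -- No neighbour is listed twice, so the length of the list is at most the number of possible
    -- neighbours.
    have := ((h.incident_nodup v).subperm hsub).length_le
    simpa using this

/-- A vertex that can be eliminated at the start stays so until the state changes, and any change of
state has already lowered the number of edges. -/
theorem foldl (h : Represents n S st) (l : List ℕ) :
    Represents n S (l.foldl (fun st v => StackProg.elimStep v st) st) ∧
    (l.foldl (fun st v => StackProg.elimStep v st) st).1.length ≤ st.1.length ∧
    ((∃ v ∈ l, 1 ≤ (incident v st.1).length ∧ (incident v st.1).length ≤ 2) →
      (l.foldl (fun st v => StackProg.elimStep v st) st).1.length < st.1.length) := by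
  induction l generalizing st with
  | nil => exact ⟨h, le_rfl, by simp⟩
  | cons v l ih =>
    obtain ⟨h1, h2, h3⟩ := h.elimStep v
    obtain ⟨h4, h5, h6⟩ := ih h1
    rw [List.foldl_cons]
    refine ⟨h4, ?_, ?_⟩
    · rcases h2 with h2 | h2
      · rw [h2] at h5 ⊢; exact h5
      · omega
    · rintro ⟨w, hw, h7, h8⟩
      rcases h2 with h2 | h2
      · rcases List.mem_cons.mp hw with rfl | hw
        · have := h3 h7 h8
          omega
        · rw [h2] at h6 ⊢
          exact h6 ⟨w, hw, h7, h8⟩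
      · omega

/-- A sweep over all vertices loses at least one edge as long as there are any, so as many sweeps as
there are edges suffice. -/
theorem foldl_sweeps {β : Type} (h : Represents n S st) {vs : List ℕ} (hvs : ∀ v < n, v ∈ vs)
    (l : List β) :
    Represents n S ((l.flatMap fun _ => vs).foldl (fun st v => StackProg.elimStep v st) st) ∧
    ((l.flatMap fun _ => vs).foldl (fun st v => StackProg.elimStep v st) st).1.length ≤
      st.1.length - l.length := by
  induction l generalizing st with
  | nil => exact ⟨h, le_rfl⟩
  | cons b l ih =>
    obtain ⟨h1, h2, h3⟩ := h.foldl vs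
    obtain ⟨h4, h5⟩ := ih h1
    rw [List.flatMap_cons, List.foldl_append]
    refine ⟨h4, h5.trans ?_⟩
    rw [List.length_cons]
    by_cases hne : st.1 = []
    · rw [hne] at h2 ⊢
      simp only [List.length_nil] at h2 ⊢
      omega
    · obtain ⟨v, hv, h7, h8⟩ := h.exists_vertex hne
      have := h3 ⟨v, hvs v hv, h7, h8⟩
      omega

theorem poly_eq (h : Represents n S st) (hnil : st.1 = []) : st.2.poly = S := by
  rw [← h.total, hnil]
  have : finWeight n [] = fun _ => 0 := rfl
  rw [this, cycleSum_zero, add_zero]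

end Represents

/-- The elimination finds the sum of all cycles. -/
theorem poly_eliminate {n : ℕ} {S : Poly} {rows : List (List Entry)}
    (h : Represents n S (edgesOf rows, zeroExpr)) (hvs : ∀ v < n, v ∈ vertsOf rows) :
    (eliminate rows).2.poly = S := by
  obtain ⟨h1, h2⟩ := h.foldl_sweeps hvs (edgesOf rows)
  refine h1.poly_eq (List.eq_nil_of_length_eq_zero ?_)
  simpa using h2

end StackProg
namespace StackProg

/-! ### The encoded weighted graph -/

theorem bitsVal_bits (n : ℕ) : bitsVal n.bits = n := by
  induction n using Nat.binaryRec' with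
  | zero => simp [bitsVal]
  | bit b n h ih =>
    rw [Nat.bits_append_bit _ _ h]
    exact congrArg (Nat.bit b) ih

theorem foldr_parseStep_bits (l : List Bool) (cur den : List Bool) (rows : List (List Entry)) :
    (l.map InSym.bit).foldr parseStep (cur, den, rows) = (l ++ cur, den, rows) := by
  induction l with
  | nil => rfl
  | cons b l ih =>
    rw [List.map_cons, List.foldr_cons, ih]
    rfl

theorem foldr_parseStep_rat (q : ℚ≥0) (rows : List (List Entry)) :
    (InSym.edge :: encodeRat q).foldr parseStep ([], [], rows) =
      ([], [], consHead (some (q.num.bits, q.den.bits)) rows) := by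
  rw [encodeRat, List.foldr_cons, List.foldr_append, List.foldr_cons, foldr_parseStep_bits]
  have : parseStep InSym.slash (q.den.bits ++ [], [], rows) = ([], q.den.bits, rows) := by
    rw [List.append_nil]; rfl
  rw [foldr_parseStep_bits, this, List.append_nil]
  rfl

theorem foldr_parseStep_row {ι : Type} {word : ι → List InSym} {entry : ι → Entry}
    (h : ∀ i rows, (word i).foldr parseStep ([], [], rows) = ([], [], consHead (entry i) rows))
    (l : List ι) (r : List Entry) (rows : List (List Entry)) :
    (l.map word).flatten.foldr parseStep ([], [], r :: rows) =
      ([], [], (l.map entry ++ r) :: rows) := by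
  induction l with
  | nil => rfl
  | cons i l ih =>
    rw [List.map_cons, List.flatten_cons, List.foldr_append, ih, h]
    rfl

/-- The parser works from the right: the end mark of a row opens an empty row, and the entries are
then put in front of it. -/
theorem foldr_parseStep_rows {ι κ : Type} {word : κ → ι → List InSym} {entry : κ → ι → Entry}
    (h : ∀ k i rows, (word k i).foldr parseStep ([], [], rows) =
      ([], [], consHead (entry k i) rows)) (l : List ι) (m : List κ) :
    (m.map fun k => (l.map (word k)).flatten ++ [InSym.endRow]).flatten.foldr parseStep
      ([], [], []) = ([], [], m.map fun k => l.map (entry k)) := by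
  induction m with
  | nil => rfl
  | cons k m ih =>
    rw [List.map_cons, List.flatten_cons, List.foldr_append, ih, List.foldr_append]
    change (l.map (word k)).flatten.foldr parseStep ([], [], [] :: _) = _
    rw [foldr_parseStep_row (h k), List.append_nil]
    rfl

section Instance

variable {n : ℕ} (G : SimpleGraph (Fin n)) (c : Sym2 (Fin n) → ℚ≥0)

open Classical in
/-- The entries of the weighted adjacency matrix. -/
noncomputable def matrixEntry (i j : Fin n) : Entry :=
  if G.Adj i j then some ((c s(i, j)).num.bits, (c s(i, j)).den.bits) else none

/-- The weighted adjacency matrix. -/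
noncomputable def matrixRows : List (List Entry) :=
  (List.finRange n).map fun i => (List.finRange n).map (matrixEntry G c i)

theorem parse_encodeInstance : parse (encodeInstance G c) = matrixRows G c := by
  classical
  rw [parse, encodeInstance, List.ofFn_eq_map]
  simp only [List.ofFn_eq_map]
  rw [foldr_parseStep_rows (entry := matrixEntry G c)]
  · rfl
  · intro i j rows
    rw [matrixEntry]
    split_ifs
    · exact foldr_parseStep_rat _ rows
    · rfl

theorem vertsOf_matrixRows : vertsOf (matrixRows G c) = List.range n := by
  rw [vertsOf]
  have := List.zipIdx_map_snd 0 (matrixRows G c)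
  refine this.trans ?_
  rw [matrixRows, List.length_map, List.length_finRange, List.range_eq_range']

theorem zipIdx_map_finRange {β : Type} (f : Fin n → β) :
    ((List.finRange n).map f).zipIdx = (List.finRange n).map fun i => (f i, i.val) := by
  refine List.ext_getElem (by simp) fun k h1 h2 => ?_
  simp

theorem edgesOf_matrixRows : edgesOf (matrixRows G c) =
    (List.finRange n).flatMap fun i : Fin n => (List.finRange n).filterMap fun j : Fin n =>
      entryEdge i j (matrixEntry G c i j) := by
  rw [edgesOf, matrixRows, zipIdx_map_finRange, List.flatMap_map]
  refine List.flatMap_congr fun i _ => ?_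
  rw [zipIdx_map_finRange, List.filterMap_map]
  rfl

variable {G} in
/-- The leaf that stands for an edge. -/
def leafOf (e : Sym2 (Fin n)) : Leaf := ((e.inf.val, e.sup.val), ((c e).num, (c e).den))

theorem entryEdge_matrixEntry {i j : Fin n} {x : Edge} :
    entryEdge i j (matrixEntry G c i j) = some x ↔
      i < j ∧ G.Adj i j ∧ x = (i.val, j.val, .leaf (leafOf c s(i, j))) := by
  unfold matrixEntry entryEdge ltB
  by_cases h : G.Adj i j
  · by_cases hij : i < j
    · have hij' : i.val < j.val := hij
      rw [if_pos h]
      simp only [hij', decide_true, cond_true, bitsVal_bits, Option.some.injEq, h, hij,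
        true_and, leafOf, Sym2.inf_mk, Sym2.sup_mk, inf_eq_left.mpr hij.le, sup_eq_right.mpr hij.le]
      exact eq_comm
    · have hij' : ¬ i.val < j.val := hij
      simp [if_pos h, hij', hij]
  · simp [h]

theorem mem_edgesOf {x : Edge} : x ∈ edgesOf (matrixRows G c) ↔ ∃ i j : Fin n, i < j ∧
    G.Adj i j ∧ x = (i.val, j.val, .leaf (leafOf c s(i, j))) := by
  rw [edgesOf_matrixRows, List.mem_flatMap]
  simp only [List.mem_filterMap, entryEdge_matrixEntry, List.mem_finRange, true_and]

/-- Only entries strictly above the diagonal produce edges, so each pair of vertices occurs once, in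
increasing order. -/
theorem nodup_edgesOf : ((edgesOf (matrixRows G c)).map Edge.ends).Nodup := by
  rw [edgesOf_matrixRows, List.Nodup, List.pairwise_map, List.pairwise_flatMap]
  constructor
  · intro i _
    rw [List.pairwise_filterMap]
    refine (List.nodup_finRange n).imp @fun j j' hj x hx y hy h => ?_
    obtain ⟨h1, -, rfl⟩ := (entryEdge_matrixEntry G c).mp hx
    obtain ⟨h2, -, rfl⟩ := (entryEdge_matrixEntry G c).mp hy
    exact hj (Fin.ext (Sym2.congr_right.mp h))
  · refine (List.nodup_finRange n).imp @fun i i' hi x hx y hy h => ?_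
    obtain ⟨j, -, hx⟩ := List.mem_filterMap.mp hx
    obtain ⟨j', -, hy⟩ := List.mem_filterMap.mp hy
    obtain ⟨h1, -, rfl⟩ := (entryEdge_matrixEntry G c).mp hx
    obtain ⟨h2, -, rfl⟩ := (entryEdge_matrixEntry G c).mp hy
    simp only [Edge.ends, Sym2.eq_iff] at h
    omega

open Classical in
theorem finWeight_edgesOf (e : Sym2 (Fin n)) : finWeight n (edgesOf (matrixRows G c)) e =
    if e ∈ G.edgeSet then AddMonoidAlgebra.single {leafOf c e} 1 else 0 := by
  have key : ∀ i j : Fin n, i < j → G.Adj i j →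
      finWeight n (edgesOf (matrixRows G c)) s(i, j) = AddMonoidAlgebra.single {leafOf c s(i, j)} 1 :=
    fun i j hij h =>
      weightAt_eq_of_mem (nodup_edgesOf G c) ((mem_edgesOf G c).mpr ⟨i, j, hij, h, rfl⟩)
  split_ifs with h
  · induction e with | _ i j
    rcases lt_trichotomy i j with hij | hij | hij
    · exact key i j hij h
    · exact absurd hij h.ne
    · rw [Sym2.eq_swap]
      exact key j i hij h.symm
  · refine weightAt_eq_zero fun x hx hxe => h ?_
    obtain ⟨i, j, -, hadj, rfl⟩ := (mem_edgesOf G c).mp hx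
    rw [map_val_eq_iff.mp hxe.symm]
    exact hadj

theorem prod_single_leafOf (C : Finset (Sym2 (Fin n))) :
    ∏ e ∈ C, (AddMonoidAlgebra.single {leafOf c e} 1 : Poly) =
      AddMonoidAlgebra.single (C.val.map (leafOf c)) 1 := by
  induction C using Finset.induction_on with
  | empty => rfl
  | insert e C he ih =>
    rw [Finset.prod_insert he, ih, AddMonoidAlgebra.single_mul_single, Finset.insert_val_of_notMem he,
      Multiset.map_cons, Multiset.singleton_add, mul_one]

/-- The formal sum of all cycles. -/
theorem represents_edgesOf (h : treewidth G ≤ 2) :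
    Represents n (zeroExpr.poly + ∑ C ∈ simpleCycles G,
      AddMonoidAlgebra.single (C.val.map (leafOf c)) 1) (edgesOf (matrixRows G c), zeroExpr) where
  lt z hz := by
    obtain ⟨i, j, hij, -, rfl⟩ := (mem_edgesOf G c).mp hz
    exact ⟨i.isLt, j.isLt, (Fin.lt_def.mp hij).ne⟩
  nodup := nodup_edgesOf G c
  reducible := by
    refine (reducible_of_treewidth_le h).mono fun x y hxy => ?_
    obtain ⟨-, z, hz, hz'⟩ := hxy
    obtain ⟨i, j, -, hadj, rfl⟩ := (mem_edgesOf G c).mp hz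
    have := map_val_eq_iff.mp (show Sym2.map Fin.val s(x, y) = s(i.val, j.val) from hz'.symm)
    rw [← SimpleGraph.mem_edgeSet, this]
    exact hadj
  total := by
    classical
    congr 1
    rw [cycleSum_eq G _ fun e he => by rw [finWeight_edgesOf, if_neg he]]
    refine Finset.sum_congr rfl fun C hC => ?_
    rw [← prod_single_leafOf]
    refine Finset.prod_congr rfl fun e he => ?_
    rw [finWeight_edgesOf, if_pos ((mem_simpleCycles_iff_top.mp hC).2 e he)]

theorem leafWeight_leafOf (e : Sym2 (Fin n)) : leafWeight (leafOf c e) = c e := by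
  have : leafDen (leafOf c e) = (c e).den := by
    have h := (c e).den_pos.ne'
    simp [leafDen, leafOf, eqB]
  rw [leafWeight, this]
  exact NNRat.num_div_den _

/-- The sum of a function over all cycles with their weights. -/
theorem weighted_eliminate (h : treewidth G ≤ 2) (g : Multiset Leaf → ℚ≥0) :
    weighted g (eliminate (matrixRows G c)).2.poly =
      ∑ C ∈ simpleCycles G, g (C.val.map (leafOf c)) * edgeProd c C := by
  rw [poly_eliminate (represents_edgesOf G c h) fun v hv => by
    rw [vertsOf_matrixRows]; exact List.mem_range.mpr hv]
  -- Expressions have no constant zero; its substitute is a leaf with numerator `0`, which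
  -- contributes a monomial of weight zero.
  have h0 : weighted g zeroExpr.poly = 0 := by
    rw [zeroExpr, Expr.poly, weighted_single]
    simp [leafWeight]
  rw [map_add, h0, zero_add, map_sum]
  refine Finset.sum_congr rfl fun C _ => ?_
  rw [weighted_single, Multiset.map_map]
  congr 1
  exact Finset.prod_congr rfl fun e _ => leafWeight_leafOf c e

theorem eqB_iff {a b : ℕ} : eqB a b = true ↔ a = b := decide_eq_true_iff

/-- The analysis controls the sampled leaves only as a multiset, so the output must not depend on
their order. -/
theorem outMatrix_perm {vs : List ℕ} {l l' : List Leaf} (h : l.Perm l') :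
    outMatrix vs l = outMatrix vs l' := by
  unfold outMatrix
  refine List.flatMap_congr fun i _ => List.map_congr_left fun j _ => ?_
  rw [Bool.eq_iff_iff, List.any_eq_true, List.any_eq_true]
  simp only [h.mem_iff]

theorem outMatrix_eq {C : Finset (Sym2 (Fin n))} {l : List Leaf}
    (h : (l : Multiset Leaf) = C.val.map (leafOf c)) :
    outMatrix (List.range n) l = encodeEdgeSet C := by
  rw [outMatrix, encodeEdgeSet, ← List.map_coe_finRange_eq_range, List.flatMap_map,
    List.ofFn_eq_map, List.flatMap]
  simp only [List.ofFn_eq_map, List.map_map]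
  congr 1
  refine List.map_congr_left fun i _ => List.map_congr_left fun j _ => ?_
  rw [Bool.eq_iff_iff, Function.comp_apply, List.any_eq_true, decide_eq_true_eq]
  have hm : ∀ x, x ∈ l ↔ ∃ e ∈ C, leafOf c e = x := fun x => by
    rw [← Multiset.mem_coe, h, Multiset.mem_map]
    rfl
  have hs : ∀ e : Sym2 (Fin n), e = s(e.inf, e.sup) := fun e => by
    induction e with | _ a b
    rcases le_total a b with hab | hab
    · simp [hab]
    · rw [Sym2.eq_swap]; simp [hab]
  have hp : ∀ e : Sym2 (Fin n), ((eqB (leafOf c e).1.1 i && eqB (leafOf c e).1.2 j) ||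
      (eqB (leafOf c e).1.1 j && eqB (leafOf c e).1.2 i)) = true ↔ e = s(i, j) := fun e => by
    conv_rhs => rw [hs e]
    simp only [eqB_iff, leafOf, Bool.or_eq_true, Bool.and_eq_true, Sym2.eq_iff, Fin.ext_iff]
  constructor
  · rintro ⟨x, hx, hxe⟩
    obtain ⟨e, he, rfl⟩ := (hm x).mp hx
    rw [← (hp e).mp hxe]
    exact he
  · exact fun he => ⟨_, (hm _).mpr ⟨_, he, rfl⟩, (hp _).mpr rfl⟩

end Instance

end StackProg
namespace StackProg

/-! ### The law of the output -/

theorem sum_range_two_mul {M : Type} [AddCommMonoid M] (h : ℕ → M) (m : ℕ) :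
    ∑ r ∈ Finset.range (2 * m), h r =
      ∑ r ∈ Finset.range m, h (Nat.bit false r) + ∑ r ∈ Finset.range m, h (Nat.bit true r) := by
  induction m with
  | zero => simp
  | succ m ih =>
    rw [show 2 * (m + 1) = 2 * m + 1 + 1 by ring, Finset.sum_range_succ, Finset.sum_range_succ, ih,
      Finset.sum_range_succ, Finset.sum_range_succ, Nat.bit_false_apply, Nat.bit_true_apply]
    abel

/-- The number with independent fair bits is uniformly distributed. -/
theorem coinList_map_apply {β : Type} [DecidableEq β] (k : ℕ) (F : ℕ → β) (o : β) :
    ((coinList k).map fun bs => F (bitsVal bs)) o =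
      (((Finset.range (2 ^ k)).filter fun r => F r = o).card : ℝ≥0∞) / 2 ^ k := by
  induction k generalizing F with
  | zero =>
    rw [coinList, PMF.pure_map, PMF.pure_apply]
    by_cases h : F 0 = o
    · simp [bitsVal, Finset.filter_singleton, h]
    · simp [bitsVal, Finset.filter_singleton, h, Ne.symm h]
  | succ k ih =>
    have h : ((coinList (k + 1)).map fun bs => F (bitsVal bs)) =
        (PMF.uniformOfFintype Bool).bind fun b =>
          (coinList k).map fun bs => F (Nat.bit b (bitsVal bs)) := by
      rw [coinList, PMF.map_bind]
      congr 1
      funext b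
      rw [PMF.map_comp]
      rfl
    have ih' : ∀ b, ((coinList k).map fun bs => F (Nat.bit b (bitsVal bs))) o = _ :=
      fun b => ih fun r => F (Nat.bit b r)
    rw [h, PMF.bind_apply, tsum_fintype]
    simp only [Finset.card_filter, Nat.cast_sum] at ih' ⊢
    simp only [ih', PMF.uniformOfFintype_apply, Fintype.card_bool, Fintype.sum_bool]
    -- The first coin is the lowest digit: the numbers below `2 ^ (k + 1)` split into even and odd
    -- ones, each class having probability one half.
    rw [pow_succ', sum_range_two_mul, ← mul_add, ← ENNReal.add_div, add_comm, pow_succ',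
      ENNReal.div_eq_inv_mul, ENNReal.div_eq_inv_mul, ENNReal.mul_inv (by simp) (by simp), mul_assoc]
    rfl

theorem Expr.den_pos (x : Expr) : 0 < x.den := by
  induction x with
  | leaf e => exact leafDen_pos e
  | ser x y hx hy => exact Nat.mul_pos hx hy
  | par x y hx hy => exact Nat.mul_pos hx hy

/-- The leading binary digit of `N` is `1`. This is what makes the acceptance probability at least
one half. -/
theorem two_pow_size_le {N : ℕ} (hN : 0 < N) : 2 ^ N.size ≤ 2 * N := by
  obtain ⟨m, hm⟩ := Nat.exists_eq_succ_of_ne_zero (Nat.size_pos.mpr hN).ne'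
  have := Nat.lt_size.mp (show m < N.size by omega)
  rw [hm, pow_succ]
  omega

/-- The embedding of the non-negative rationals in the extended non-negative reals. -/
noncomputable def toENNReal : ℚ≥0 →+* ℝ≥0∞ := ENNReal.ofNNRealHom.comp (NNRat.castHom ℝ≥0)

section Instance

variable {n : ℕ} (G : SimpleGraph (Fin n)) (c : Sym2 (Fin n) → ℚ≥0)

theorem cycleMass_eq (C : Finset (Sym2 (Fin n))) :
    cycleMass G c C = if C ∈ simpleCycles G then toENNReal (edgeProd c C) else 0 := rfl

theorem tsum_cycleMass : ∑' C, cycleMass G c C =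
    toENNReal (∑ C ∈ simpleCycles G, edgeProd c C) := by
  rw [tsum_fintype, map_sum]
  simp only [cycleMass_eq, Finset.sum_ite_mem, Finset.univ_inter]

open Classical in
theorem cycleLaw_map_apply (h : ∃ C ∈ simpleCycles G, edgeProd c C ≠ 0) (y : List Bool) :
    ((cycleLaw G c h).map encodeEdgeSet) y =
      toENNReal (∑ C ∈ simpleCycles G, (if encodeEdgeSet C = y then 1 else 0) * edgeProd c C) *
        (toENNReal (∑ C ∈ simpleCycles G, edgeProd c C))⁻¹ := by
  rw [PMF.map_apply, tsum_fintype, map_sum, Finset.sum_mul, ← Finset.univ_inter (simpleCycles G),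
    ← Finset.sum_ite_mem]
  refine Finset.sum_congr rfl fun C _ => ?_
  rw [cycleLaw, PMF.normalize_apply, tsum_cycleMass, cycleMass_eq, Finset.univ_inter]
  by_cases hC : C ∈ simpleCycles G <;> by_cases hy : encodeEdgeSet C = y
  · simp [hC, hy]
  · simp [hC, hy, Ne.symm hy]
  · simp [hC]
  · simp [hC]

/-- The algorithm answers with the right law. -/
theorem samples_of_outcomeLaw (M : ProbTM InSym Bool) {T : ℕ} (hG : treewidth G ≤ 2)
    (h : ∃ C ∈ simpleCycles G, edgeProd c C ≠ 0)
    (hM : M.outcomeLaw (encodeInstance G c) T =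
      (coinList (eliminate (parse (encodeInstance G c))).2.num.size).map fun bs =>
        answer (bs, (vertsOf (parse (encodeInstance G c)),
          (eliminate (parse (encodeInstance G c))).2))) :
    M.Samples (encodeInstance G c) T ((cycleLaw G c h).map encodeEdgeSet) := by
  classical
  rw [parse_encodeInstance, vertsOf_matrixRows] at hM
  have hweight := weighted_eliminate G c hG
  generalize (eliminate (matrixRows G c)).2 = E at hM hweight
  set k := E.num.size with hk
  have hlt : E.num < 2 ^ k := Nat.lt_size_self _
  set Z : ℚ≥0 := ∑ C ∈ simpleCycles G, edgeProd c C with hZ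
  have hZ0 : Z ≠ 0 := by
    obtain ⟨C, hC, hc⟩ := h
    exact fun h0 => hc (Finset.sum_eq_zero_iff.mp h0 C hC)
  -- The constant test function `1` identifies the number of accepted random numbers.
  have hnum : (E.num : ℚ≥0) = E.den * Z := by
    have := sum_sample (fun _ => 1) E
    rw [hweight] at this
    simpa using this
  have hpos : 0 < E.num := by
    rw [Nat.pos_iff_ne_zero]
    intro h0
    rw [h0, Nat.cast_zero, eq_comm, mul_eq_zero, Nat.cast_eq_zero] at hnum
    exact hnum.elim E.den_pos.ne' hZ0
  have hacc : M.acceptProb (encodeInstance G c) T = E.num / 2 ^ k := by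
    have h1 : M.acceptProb (encodeInstance G c) T =
        ((coinList k).map fun bs => (fun r => ltB r E.num) (bitsVal bs)) true := by
      rw [← PMF.toOuterMeasure_apply_singleton, PMF.toOuterMeasure_map_apply, ProbTM.acceptProb, hM,
        PMF.toOuterMeasure_map_apply]
      congr 1
      ext bs
      simp only [Set.mem_preimage, Set.mem_ofPred_eq, Set.mem_singleton_iff, answer]
      cases ltB (bitsVal bs) E.num <;> simp
    refine h1.trans ((coinList_map_apply k (fun r => ltB r E.num) true).trans ?_)
    congr 2
    have : (Finset.range (2 ^ k)).filter (fun r => ltB r E.num = true) = Finset.range E.num := by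
      ext r
      simp only [Finset.mem_filter, Finset.mem_range, ltB, decide_eq_true_eq]
      omega
    rw [this, Finset.card_range]
  have hout : ∀ y, M.outcomeLaw (encodeInstance G c) T (some y) =
      toENNReal (E.den * ∑ C ∈ simpleCycles G, (if encodeEdgeSet C = y then 1 else 0) *
        edgeProd c C) / 2 ^ k := fun y => by
    have h1 : M.outcomeLaw (encodeInstance G c) T = (coinList k).map fun bs =>
        (fun r => bif ltB r E.num then some (outMatrix (List.range n) (sample E r)) else none)
          (bitsVal bs) := hM
    rw [h1]
    refine (coinList_map_apply k (fun r => bif ltB r E.num then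
      some (outMatrix (List.range n) (sample E r)) else none) (some y)).trans ?_
    congr 1
    have h2 : (Finset.range (2 ^ k)).filter (fun r => (bif ltB r E.num then
        some (outMatrix (List.range n) (sample E r)) else none) = some y) =
        (Finset.range E.num).filter (fun r => outMatrix (List.range n) (sample E r) = y) := by
      ext r
      rw [Finset.mem_filter, Finset.mem_filter, Finset.mem_range, Finset.mem_range]
      by_cases hr : r < E.num
      · simp [ltB, hr, hr.trans hlt]
      · simp [ltB, hr]
    -- The indicator of the output `y` as a test function counts the accepted random numbers that
    -- produce `y`.
    have h3 := sum_sample (fun D => if outMatrix (List.range n) D.toList = y then 1 else 0) E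
    have h4 : ∀ r, outMatrix (List.range n) (sample E r : Multiset Leaf).toList =
        outMatrix (List.range n) (sample E r) := fun r =>
      outMatrix_perm (Multiset.coe_eq_coe.mp (Multiset.coe_toList _))
    have h5 : ∀ C : Finset (Sym2 (Fin n)), outMatrix (List.range n) (C.val.map (leafOf c)).toList =
        encodeEdgeSet C := fun C => outMatrix_eq c (Multiset.coe_toList _)
    simp only [h4] at h3
    rw [hweight, Finset.sum_boole] at h3
    simp only [h5] at h3
    rw [h2, ← h3, map_natCast]
  refine ⟨?_, fun y => ?_⟩
  · rw [hacc, ENNReal.le_div_iff_mul_le (by simp) (by simp), mul_comm, ← mul_div_assoc, mul_one]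
    refine ENNReal.div_le_of_le_mul ?_
    rw [mul_comm]
    exact_mod_cast two_pow_size_le hpos
  · have h6 : ((E.num : ℕ) : ℝ≥0∞) = toENNReal E.den * toENNReal Z := by
      rw [← map_mul, ← hnum, map_natCast]
    have h7 : toENNReal Z ≠ 0 := by
      rw [hZ, ← tsum_cycleMass]
      exact cycleMass_tsum_ne_zero G c h
    have h8 : toENNReal Z ≠ ∞ := by
      rw [hZ, ← tsum_cycleMass]
      exact cycleMass_tsum_ne_top G c
    rw [hacc, hout, cycleLaw_map_apply, h6, map_mul, ← hZ]
    rw [div_eq_mul_inv, div_eq_mul_inv]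
    set X := toENNReal (∑ C ∈ simpleCycles G, (if encodeEdgeSet C = y then 1 else 0) * edgeProd c C)
    -- The unreduced denominator `E.den` occurs in the acceptance probability as well as in the
    -- probability of `y`, so the conditional probability is `X / Z`.
    calc toENNReal E.den * X * (2 ^ k)⁻¹
        = toENNReal E.den * X * (2 ^ k)⁻¹ * (toENNReal Z * (toENNReal Z)⁻¹) := by
          rw [ENNReal.mul_inv_cancel h7 h8, mul_one]
      _ = _ := by ring

end Instance

end StackProg

theorem mainTheorem12 :
    ∃ (M : ProbTM InSym Bool) (p : Polynomial ℕ),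
      (∀ x : List InSym, M.HaltsWithin x (p.eval x.length)) ∧
      ∀ (n : ℕ) (G : SimpleGraph (Fin n)) (c : Sym2 (Fin n) → ℚ≥0),
        treewidth G ≤ 2 →
        ∀ h : ∃ C ∈ simpleCycles G, edgeProd c C ≠ 0,
          M.Samples (encodeInstance G c) (p.eval (encodeInstance G c).length)
            ((cycleLaw G c h).map encodeEdgeSet) := by
  obtain ⟨M, p, hMp⟩ := StackProg.exists_sampler
  exact ⟨M, p, fun x => (hMp x).1, fun n G c hG h =>
    StackProg.samples_of_outcomeLaw G c M hG h (hMp _).2⟩
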